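/- Let $(\mathcal H_n)_{n\ge 1}$ be finite-dimensional complex Hilbert spaces, let $A_n\in\mathcal B(\mathcal H_n)$ be positive operators with $\|A_n\|=1$, let $M_n\in\mathcal B(\mathcal H_n)$ be nilpotent operators with $\sum_{n\ge1}\|A_n-M_n\|<\infty$, and let $\xi_n\in\mathcal H_n$ be unit vectors with $A_n\xi_n=\xi_n$. Let $\mathcal K=\bigotimes_{n\ge1}(\mathcal H_n,\xi_n)$ be the completion of the direct limit of the Hilbert spaces $\mathcal H_1\otimes\cdots\otimes\mathcal H_n$ along the isometries $\zeta\mapsto\zeta\otimes\xi_{n+1}\otimes\cdots\otimes\xi_m$ ($n<m$), with natural inclusions $\phi_n:\mathcal H_1\otimes\cdots\otimes\mathcal H_n\to\mathcal K$. For operators $S_n\in\mathcal B(\mathcal H_n)$ with $\prod_n\max\{\|S_n\|,1\}<\infty$ and $\sum_n\|S_n\xi_n-\xi_n\|<\infty$, let $\bigotimes_{n\ge1}S_n\in\mathcal B(\mathcal K)$ be the unique bounded operator with $$\Big(\bigotimes_{n\ge1}S_n\Big)(\phi_n\zeta)=\lim_{m\to\infty}\phi_m\big((S_1\otimes\cdots\otimes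 S_m)(\zeta\otimes\xi_{n+1}\otimes\cdots\otimes\xi_m)\big)\qquad(n\ge1,\ \zeta\in\mathcal H_1\otimes\cdots\otimes\mathcal H_n).$$ Let $\mathfrak C\subseteq\mathcal B(\mathcal K)$ be the (not necessarily unital) C$^*$-algebra generated by all such operators $\bigotimes_{n\ge1}S_n$ for which $S_n=A_n$ for all sufficiently large $n$. Then $\mathfrak C$ is separable, nuclear, quasidiagonal and approximately homogeneous, where approximately homogeneous means: the inductive limit of a sequence of C$^*$-algebras each of which is a finite direct sum of homogeneous C$^*$-algebras (a C$^*$-algebra is homogeneous if all its irreducible representations have the same finite dimension). Moreover, for $k\ge0$ let $\mathfrak C_k$ be the C$^*$-subalgebra of $\mathfrak C$ generated by the operators $\bigotimes_{n\ge1}S_n$ with $S_n=A_n$ for all $n>k$, and let $\mathfrak A_{k+1}$ be the C$^*$-algebra generated by the operator $a_{k+1}=\bigotimes_{n\ge k+1}A_n$ on $\bigotimes_{n\ge k+1}(\mathcal H_n,\xi_n)$. Then $\mathfrak C_0\subseteq\mathfrak C_1\subseteq\cdots$, $\mathfrak C=\overline{\bigcup_k\mathfrak C_k}$, every $\mathfrak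 A_{k+1}$ is abelian, and there is a $^*$-isomorphism $$\mathcal B(\mathcal H_1)\otimes\cdots\otimes\mathcal B(\mathcal H_k)\otimes\mathfrak A_{k+1}\;\cong\;\mathfrak C_k$$ sending $S_1\otimes\cdots\otimes S_k\otimes a_{k+1}$ to $S_1\otimes\cdots\otimes S_k\otimes A_{k+1}\otimes A_{k+2}\otimes\cdots$. (As the $\mathcal B(\mathcal H_i)$ are finite dimensional, the algebraic tensor product on the left is already complete in its unique C$^*$-norm.) -/

import Mathlib

open scoped TensorProduct ComplexOrder CStarAlgebra
open Filter Topology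

universe u

/-! ### Generated C⋆-subalgebras and properties of C⋆-algebras -/

/-- The (not necessarily unital) C⋆-subalgebra of `B` generated by a set `s`. -/
noncomputable def cstarGen {B : Type u} [NonUnitalCStarAlgebra B] (s : Set B) :
    NonUnitalStarSubalgebra ℂ B :=
  (NonUnitalStarAlgebra.adjoin ℂ s).topologicalClosure

theorem cstarGen_isClosed {B : Type u} [NonUnitalCStarAlgebra B] (s : Set B) :
    IsClosed (cstarGen s : Set B) :=
  NonUnitalStarSubalgebra.isClosed_topologicalClosure _

noncomputable instance cstarGen.instNonUnitalCStarAlgebra {B : Type u} [NonUnitalCStarAlgebra B]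
    (s : Set B) : NonUnitalCStarAlgebra (cstarGen s) :=
  NonUnitalStarSubalgebra.nonUnitalCStarAlgebra (cstarGen s) (h_closed := cstarGen_isClosed s)

/-- Nuclearity (completely positive approximation property): the identity of `A` is a point-norm
limit of maps `ψ ∘ φ`, with `φ : A → M_n(ℂ)` and `ψ : M_n(ℂ) → A` completely positive and
contractive. The order on `A` is the usual C⋆-algebra order. -/
def IsNuclearCStar (A : Type u) [NonUnitalCStarAlgebra A] : Prop :=
  letI : PartialOrder A := CStarAlgebra.spectralOrder A
  haveI : StarOrderedRing A := CStarAlgebra.spectralOrderedRing A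
  ∀ (F : Finset A) (ε : ℝ), 0 < ε →
    ∃ (n : ℕ) (φ : A →CP CStarMatrix (Fin n) (Fin n) ℂ)
      (ψ : CStarMatrix (Fin n) (Fin n) ℂ →CP A),
      (∀ a, ‖φ a‖ ≤ ‖a‖) ∧ (∀ x, ‖ψ x‖ ≤ ‖x‖) ∧ ∀ a ∈ F, ‖ψ (φ a) - a‖ < ε

/-- A set `Ω` of operators on a Hilbert space `E` is quasidiagonal if, for finitely many elements
of `Ω` and finitely many vectors, there is a finite rank orthogonal projection almost commuting
with the operators and almost fixing the vectors. -/
def IsQuasidiagonalSet {E : Type u} [NormedAddCommGroup E] [InnerProductSpace ℂ E]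
    [CompleteSpace E] (Ω : Set (E →L[ℂ] E)) : Prop :=
  ∀ (F : Finset (E →L[ℂ] E)) (G : Finset E) (ε : ℝ), (F : Set (E →L[ℂ] E)) ⊆ Ω → 0 < ε →
    ∃ P : E →L[ℂ] E, IsStarProjection P ∧ FiniteDimensional ℂ P.toLinearMap.range ∧
      (∀ T ∈ F, ‖P * T - T * P‖ < ε) ∧ ∀ v ∈ G, ‖P v - v‖ < ε

/-- A C⋆-algebra is quasidiagonal if it has a faithful representation on a Hilbert space whose
image is a quasidiagonal set of operators. -/
def IsQuasidiagonalCStar (A : Type u) [NonUnitalCStarAlgebra A] : Prop :=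
  ∃ (E : Type u) (_ : NormedAddCommGroup E) (_ : InnerProductSpace ℂ E) (_ : CompleteSpace E)
    (π : A →⋆ₙₐ[ℂ] (E →L[ℂ] E)),
    Function.Injective π ∧ IsQuasidiagonalSet (Set.range π)

/-- A representation of a C⋆-algebra on a Hilbert space is irreducible if it is nonzero and the
only closed invariant subspaces are the trivial ones. -/
def IsIrreducibleRep {A : Type u} [NonUnitalCStarAlgebra A] {E : Type u} [NormedAddCommGroup E]
    [InnerProductSpace ℂ E] [CompleteSpace E] (π : A →⋆ₙₐ[ℂ] (E →L[ℂ] E)) : Prop :=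
  (∃ a, π a ≠ 0) ∧
    ∀ V : Submodule ℂ E, IsClosed (V : Set E) → (∀ a, ∀ v ∈ V, π a v ∈ V) → V = ⊥ ∨ V = ⊤

/-- A C⋆-algebra is `n`-homogeneous if all its irreducible representations have dimension `n`. -/
def IsHomogeneousCStar (n : ℕ) (A : Type u) [NonUnitalCStarAlgebra A] : Prop :=
  ∀ (E : Type u) [NormedAddCommGroup E] [InnerProductSpace ℂ E] [CompleteSpace E]
    (π : A →⋆ₙₐ[ℂ] (E →L[ℂ] E)), IsIrreducibleRep π → Module.rank ℂ E = (n : Cardinal.{u})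

/-- A C⋆-algebra `A` is approximately homogeneous if it is the inductive limit of a sequence of
C⋆-algebras which are finite direct sums of homogeneous C⋆-algebras. Since quotients of homogeneous
C⋆-algebras are homogeneous, the connecting maps may be taken injective, i.e. `A` is the closure of
the union of an increasing sequence of such C⋆-subalgebras. -/
def IsApproximatelyHomogeneous (A : Type u) [NonUnitalCStarAlgebra A] : Prop :=
  ∃ D : ℕ → NonUnitalStarSubalgebra ℂ A,
    Monotone D ∧ (∀ k, IsClosed (D k : Set A)) ∧ Dense (⋃ k, (D k : Set A)) ∧
    ∀ k, ∃ (r : ℕ) (B : Fin r → Type u) (_ : ∀ i, NonUnitalCStarAlgebra (B i)),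
      (∀ i, ∃ n : ℕ, IsHomogeneousCStar n (B i)) ∧ Nonempty (D k ≃⋆ₐ[ℂ] (∀ i, B i))

/-! ### Finite Hilbert space tensor products -/

/-- Bundled complex inner product spaces (auxiliary, for a recursive definition). -/
structure BundledIPS : Type (u + 1) where
  carrier : Type u
  [grp : NormedAddCommGroup carrier]
  [ips : InnerProductSpace ℂ carrier]

attribute [instance] BundledIPS.grp BundledIPS.ips

section
variable (H : ℕ → Type u) [∀ n, NormedAddCommGroup (H n)] [∀ n, InnerProductSpace ℂ (H n)]

/-- Auxiliary recursion for `FinTensor`. -/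
noncomputable def finTensorAux : ℕ → BundledIPS.{u}
  | 0 => ⟨H 0⟩
  | n + 1 => ⟨(finTensorAux n).carrier ⊗[ℂ] H (n + 1)⟩

/-- `FinTensor H n` is `H 0 ⊗ H 1 ⊗ ⋯ ⊗ H n`, with its Hilbert space inner product (complete
when the `H i` are finite dimensional). -/
def FinTensor (n : ℕ) : Type u := (finTensorAux H n).carrier

noncomputable instance (n : ℕ) : NormedAddCommGroup (FinTensor H n) :=
  (finTensorAux H n).grp

noncomputable instance (n : ℕ) : InnerProductSpace ℂ (FinTensor H n) :=
  (finTensorAux H n).ips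

/-- `FinTensor H 0` is `H 0`. -/
noncomputable def finTensorZero : H 0 ≃ₗᵢ[ℂ] FinTensor H 0 :=
  LinearIsometryEquiv.refl ℂ (H 0)

/-- `FinTensor H (n + 1)` is `FinTensor H n ⊗ H (n + 1)`. -/
noncomputable def finTensorSucc (n : ℕ) :
    (FinTensor H n ⊗[ℂ] H (n + 1)) ≃ₗᵢ[ℂ] FinTensor H (n + 1) :=
  LinearIsometryEquiv.refl ℂ (FinTensor H n ⊗[ℂ] H (n + 1))

variable {H}

/-- The operator `S 0 ⊗ S 1 ⊗ ⋯ ⊗ S n` on `H 0 ⊗ ⋯ ⊗ H n`. -/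
noncomputable def finTensorOp (S : ∀ n, H n →L[ℂ] H n) :
    ∀ n, FinTensor H n →L[ℂ] FinTensor H n
  | 0 => (finTensorZero H).toContinuousLinearEquiv.toContinuousLinearMap ∘L S 0 ∘L
      (finTensorZero H).symm.toContinuousLinearEquiv.toContinuousLinearMap
  | n + 1 => (finTensorSucc H n).toContinuousLinearEquiv.toContinuousLinearMap ∘L
      TensorProduct.mapL (finTensorOp S n) (S (n + 1)) ∘L
      (finTensorSucc H n).symm.toContinuousLinearEquiv.toContinuousLinearMap

variable (ξ : ∀ n, H n) (hξ : ∀ n, ‖ξ n‖ = 1)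

/-- The isometry `ζ ↦ ζ ⊗ ξ (n + 1)`. -/
noncomputable def finTensorStep (n : ℕ) : FinTensor H n →ₗᵢ[ℂ] FinTensor H (n + 1) where
  toLinearMap := (finTensorSucc H n).toLinearEquiv.toLinearMap ∘ₗ
    (TensorProduct.mk ℂ (FinTensor H n) (H (n + 1))).flip (ξ (n + 1))
  norm_map' ζ := by simp [hξ]

/-- The connecting isometry `ζ ↦ ζ ⊗ ξ (n + 1) ⊗ ⋯ ⊗ ξ m`. -/
noncomputable def finTensorEmbed (n m : ℕ) (h : n ≤ m) : FinTensor H n →ₗᵢ[ℂ] FinTensor H m :=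
  Nat.leRec (motive := fun m _ => FinTensor H n →ₗᵢ[ℂ] FinTensor H m)
    LinearIsometry.id (fun m _ f => (finTensorStep ξ hξ m).comp f) h

theorem finTensorEmbed_self (n : ℕ) : finTensorEmbed ξ hξ n n le_rfl = LinearIsometry.id := by
  simp [finTensorEmbed]

theorem finTensorEmbed_succ (n m : ℕ) (h : n ≤ m) :
    finTensorEmbed ξ hξ n (m + 1) (h.trans (Nat.le_succ m)) =
      (finTensorStep ξ hξ m).comp (finTensorEmbed ξ hξ n m h) := by
  simp only [finTensorEmbed]
  rw [Nat.leRec_succ]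

instance finTensor_directedSystem :
    DirectedSystem (FinTensor H) (fun i j h => (finTensorEmbed ξ hξ i j h : _ → _)) where
  map_self i x := by rw [finTensorEmbed_self]; rfl
  map_map k j i hij hjk x := by
    induction k, hjk using Nat.le_induction with
    | base => rw [finTensorEmbed_self]; rfl
    | succ k hk ih =>
      rw [finTensorEmbed_succ ξ hξ j k hk, finTensorEmbed_succ ξ hξ i k (hij.trans hk)]
      simp only [LinearIsometry.coe_comp, Function.comp_apply, ih]

/-! ### The infinite tensor product Hilbert space -/

/-- The algebraic direct limit of the spaces `H 0 ⊗ ⋯ ⊗ H n` along the connecting isometries. -/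
def PreInfTensor : Type u :=
  DirectLimit (FinTensor H) (finTensorEmbed ξ hξ)

noncomputable instance : AddCommGroup (PreInfTensor ξ hξ) :=
  inferInstanceAs (AddCommGroup (DirectLimit (FinTensor H) (finTensorEmbed ξ hξ)))

noncomputable instance : Module ℂ (PreInfTensor ξ hξ) :=
  inferInstanceAs (Module ℂ (DirectLimit (FinTensor H) (finTensorEmbed ξ hξ)))

/-- The canonical map of `H 0 ⊗ ⋯ ⊗ H n` into the direct limit. -/
noncomputable def PreInfTensor.of (n : ℕ) : FinTensor H n →ₗ[ℂ] PreInfTensor ξ hξ :=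
  DirectLimit.Module.of ℂ ℕ (FinTensor H) (finTensorEmbed ξ hξ) n

theorem PreInfTensor.exists_of (x : PreInfTensor ξ hξ) :
    ∃ n ζ, x = PreInfTensor.of ξ hξ n ζ :=
  DirectLimit.exists_eq_mk (finTensorEmbed ξ hξ) x

theorem PreInfTensor.exists_of₂ (x y : PreInfTensor ξ hξ) :
    ∃ n ζ η, x = PreInfTensor.of ξ hξ n ζ ∧ y = PreInfTensor.of ξ hξ n η :=
  DirectLimit.exists_eq_mk₂ (finTensorEmbed ξ hξ) x y

theorem PreInfTensor.exists_of₃ (x y z : PreInfTensor ξ hξ) :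
    ∃ n ζ η θ, x = PreInfTensor.of ξ hξ n ζ ∧ y = PreInfTensor.of ξ hξ n η ∧
      z = PreInfTensor.of ξ hξ n θ :=
  DirectLimit.exists_eq_mk₃ (finTensorEmbed ξ hξ) x y z

/-- The inner product on the direct limit, computed at any common stage. -/
noncomputable instance : Inner ℂ (PreInfTensor ξ hξ) where
  inner := DirectLimit.lift₂ (finTensorEmbed ξ hξ) (finTensorEmbed ξ hξ)
    (fun _ ζ η => inner ℂ ζ η) (fun i j h ζ η => by simp)

theorem PreInfTensor.inner_of (n : ℕ) (ζ η : FinTensor H n) :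
    inner ℂ (PreInfTensor.of ξ hξ n ζ) (PreInfTensor.of ξ hξ n η) = inner ℂ ζ η :=
  DirectLimit.lift₂_def (finTensorEmbed ξ hξ) (finTensorEmbed ξ hξ)
    (fun _ ζ η => inner ℂ ζ η) _ n ζ η

/-- The inner product space axioms on the direct limit. -/
@[reducible]
noncomputable def PreInfTensor.core : InnerProductSpace.Core ℂ (PreInfTensor ξ hξ) where
  inner := inner ℂ
  conj_inner_symm x y := by
    obtain ⟨n, ζ, η, rfl, rfl⟩ := PreInfTensor.exists_of₂ ξ hξ x y
    simp only [PreInfTensor.inner_of, inner_conj_symm]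
  re_inner_nonneg x := by
    obtain ⟨n, ζ, rfl⟩ := PreInfTensor.exists_of ξ hξ x
    simp only [PreInfTensor.inner_of, inner_self_nonneg]
  add_left x y z := by
    obtain ⟨n, ζ, η, θ, rfl, rfl, rfl⟩ := PreInfTensor.exists_of₃ ξ hξ x y z
    rw [← map_add]
    simp only [PreInfTensor.inner_of, inner_add_left]
  smul_left x y r := by
    obtain ⟨n, ζ, η, rfl, rfl⟩ := PreInfTensor.exists_of₂ ξ hξ x y
    rw [← map_smul]
    simp only [PreInfTensor.inner_of, inner_smul_left]
  definite x hx := by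
    obtain ⟨n, ζ, rfl⟩ := PreInfTensor.exists_of ξ hξ x
    rw [PreInfTensor.inner_of, inner_self_eq_zero] at hx
    rw [hx, map_zero]

noncomputable instance : NormedAddCommGroup (PreInfTensor ξ hξ) :=
  (PreInfTensor.core ξ hξ).toNormedAddCommGroup

noncomputable instance : InnerProductSpace ℂ (PreInfTensor ξ hξ) :=
  InnerProductSpace.ofCore (PreInfTensor.core ξ hξ).toCore

/-- The Hilbert space `⨂ₙ (H n, ξ n)`: the completion of the direct limit. -/
abbrev InfTensor : Type u := UniformSpace.Completion (PreInfTensor ξ hξ)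

/-- The natural isometric inclusion of `H 0 ⊗ ⋯ ⊗ H n` into the infinite tensor product. -/
noncomputable def infTensorIncl (n : ℕ) : FinTensor H n →ₗᵢ[ℂ] InfTensor ξ hξ :=
  (UniformSpace.Completion.toComplₗᵢ (𝕜 := ℂ) (E := PreInfTensor ξ hξ)).comp
    ((PreInfTensor.of ξ hξ n).isometryOfInner (PreInfTensor.inner_of ξ hξ n))

/-! ### Infinite tensor products of operators and the algebras generated by them -/

/-- The conditions `∏ max {‖S n‖, 1} < ∞` and `∑ ‖S n (ξ n) - ξ n‖ < ∞`. -/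
def TensorAdmissible (S : ∀ n, H n →L[ℂ] H n) : Prop :=
  Multipliable (fun n => max ‖S n‖ 1) ∧ Summable (fun n => ‖S n (ξ n) - ξ n‖)

/-- `T` is the infinite tensor product `⨂ₙ S n`: on the image of `H 0 ⊗ ⋯ ⊗ H n` it is the limit
over `m` of `(S 0 ⊗ ⋯ ⊗ S m) (ζ ⊗ ξ (n + 1) ⊗ ⋯ ⊗ ξ m)`. These images span a dense subspace, so a
bounded operator `T` is determined by this. -/
def IsInfTensorOp (S : ∀ n, H n →L[ℂ] H n) (T : InfTensor ξ hξ →L[ℂ] InfTensor ξ hξ) : Prop :=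
  ∀ (n : ℕ) (ζ : FinTensor H n),
    Tendsto (fun j => infTensorIncl ξ hξ (n + j)
      (finTensorOp S (n + j) (finTensorEmbed ξ hξ n (n + j) (Nat.le_add_right n j) ζ)))
      atTop (𝓝 (T (infTensorIncl ξ hξ n ζ)))

/-- The infinite tensor products `⨂ₙ S n` with `S n = A n` for all `n ≥ k`. -/
def readSet (A : ∀ n, H n →L[ℂ] H n) (k : ℕ) :
    Set (InfTensor ξ hξ →L[ℂ] InfTensor ξ hξ) :=
  {T | ∃ S : ∀ n, H n →L[ℂ] H n, TensorAdmissible ξ S ∧ IsInfTensorOp ξ hξ S T ∧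
    ∀ n, k ≤ n → S n = A n}

/-- The C⋆-algebra generated by all infinite tensor products `⨂ₙ S n` for which `S n = A n` for
all sufficiently large `n`. -/
noncomputable def readAlgebra (A : ∀ n, H n →L[ℂ] H n) :
    NonUnitalStarSubalgebra ℂ (InfTensor ξ hξ →L[ℂ] InfTensor ξ hξ) :=
  cstarGen (⋃ k, readSet ξ hξ A k)

noncomputable instance (A : ∀ n, H n →L[ℂ] H n) : NonUnitalCStarAlgebra (readAlgebra ξ hξ A) :=
  cstarGen.instNonUnitalCStarAlgebra _

/-- The C⋆-subalgebra generated by the `⨂ₙ S n` with `S n = A n` for all `n ≥ k`. -/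
noncomputable def readStage (A : ∀ n, H n →L[ℂ] H n) (k : ℕ) :
    NonUnitalStarSubalgebra ℂ (InfTensor ξ hξ →L[ℂ] InfTensor ξ hξ) :=
  cstarGen (readSet ξ hξ A k)

/-- The Hilbert space `⨂ (H n, ξ n)` over `n ≥ k`. -/
abbrev TailTensor (k : ℕ) : Type u :=
  InfTensor (H := fun n => H (n + k)) (fun n => ξ (n + k)) (fun n => hξ (n + k))

/-- `a` is the infinite tensor product of the operators `A n` over `n ≥ k`. -/
def IsTailOp (A : ∀ n, H n →L[ℂ] H n) (k : ℕ)
    (a : TailTensor ξ hξ k →L[ℂ] TailTensor ξ hξ k) : Prop :=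
  IsInfTensorOp (H := fun n => H (n + k)) (fun n => ξ (n + k)) (fun n => hξ (n + k))
    (fun n => A (n + k)) a

/-- The C⋆-algebra generated by the infinite tensor product of the `A n` over `n ≥ k`. -/
noncomputable def tailAlgebra (A : ∀ n, H n →L[ℂ] H n) (k : ℕ) :
    NonUnitalStarSubalgebra ℂ (TailTensor ξ hξ k →L[ℂ] TailTensor ξ hξ k) :=
  cstarGen {a | IsTailOp ξ hξ A k a}

/-- The sequence `S 0, …, S (k - 1), A k, A (k + 1), …`. -/
def extendBy (A : ∀ n, H n →L[ℂ] H n) (k : ℕ) (S : ∀ i : Fin k, H i →L[ℂ] H i) :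
    ∀ n, H n →L[ℂ] H n :=
  fun n => if h : n < k then S ⟨n, h⟩ else A n

end

/-!
Write `V_k = H 0 ⊗ ⋯ ⊗ H (k - 1)` and let `K` be the infinite tensor product. Splitting off the
first `k` factors gives `K ≅ V_k ⊗ K_k`, where `K_k` is the tensor product over `n ≥ k`
(`tailFactor`). Since `A n` fixes `ξ n`, the limits defining the operators `⨂ₙ S n` with `S n = A n`
for `n ≥ k` are eventually constant (`isInfTensorOp_iff_isStableOp`), and such an operator becomes
`(S 0 ⊗ ⋯ ⊗ S (k - 1)) ⊗ a_k` with `a_k = ⨂_{n ≥ k} A n`. The elementary tensors span `𝓑(V_k)`, so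
the stage `C_k` is exactly `𝓑(V_k) ⊗ C⋆(a_k)` (`StageModel.readStage_eq`). Here a factorization
`K ≅ V ⊗ T` is handled through the maps `η ↦ v ⊗ η` (`HilbertFactor`), and `𝓑(V) ⊗ D` is the algebra
of the operators on `K` whose matrix coefficients lie in `D` (`HilbertFactor.matAlgebra`).

The operator `a_k` is a positive contraction, so `C⋆(a_k)` is commutative and is the closed span of
the powers `a_k, a_k², …`. The assertions follow.

* The stages increase to a dense subalgebra, and each is separable.
* In an irreducible representation of `𝓑(V) ⊗ D` with `D` commutative, the operators coming from
  `1 ⊗ D` are scalars by Schur's lemma, and what remains is an irreducible representation of the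
  matrix algebra `𝓑(V)`; so each stage is homogeneous of dimension `dim V`
  (`isHomogeneousCStar_of_tensor`).
* For nuclearity, let `gᵢ²` be the elements of a fine partition of unity in `C⋆(a)` and let `ηᵢ` be
  unit vectors in the ranges of the `gᵢ`, so that `aʲ ηᵢ ≈ tᵢʲ ηᵢ` for a point `tᵢ` of the `i`-th
  interval. Compressing to the subspaces `V ⊗ ηᵢ` and expanding along the `gᵢ²` sends `S ⊗ aʲ` to
  `∑ᵢ ⟪ηᵢ, aʲ ηᵢ⟫ S ⊗ gᵢ² ≈ S ⊗ aʲ` (`exists_partition_approx`, `HilbertFactor.exists_cp_approx`).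
  The compression is defined on the whole limit algebra and the expansion takes values in the stage,
  so no extension theorem for completely positive maps is needed.
* For quasidiagonality, the finite rank projection onto `H 0 ⊗ ⋯ ⊗ H m` commutes with `C_k` as soon
  as `k ≤ m + 1` (`starProjection_commute`).
-/

universe v

/-! ### Generated C⋆-subalgebras -/

theorem subset_cstarGen {B : Type u} [NonUnitalCStarAlgebra B] (s : Set B) :
    s ⊆ (cstarGen s : Set B) :=
  (NonUnitalStarAlgebra.subset_adjoin ℂ s).trans
    (NonUnitalStarSubalgebra.le_topologicalClosure _)

theorem cstarGen_le {B : Type u} [NonUnitalCStarAlgebra B] {s : Set B}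
    {D : NonUnitalStarSubalgebra ℂ B} (hD : IsClosed (D : Set B)) (h : s ⊆ D) :
    cstarGen s ≤ D :=
  NonUnitalStarSubalgebra.topologicalClosure_minimal _ (NonUnitalStarAlgebra.adjoin_le h) hD

theorem cstarGen_mono {B : Type u} [NonUnitalCStarAlgebra B] {s t : Set B} (h : s ⊆ t) :
    cstarGen s ≤ cstarGen t :=
  cstarGen_le (cstarGen_isClosed t) (h.trans (subset_cstarGen t))

/-! ### Hilbert space tensor factorizations -/

theorem sum_inner_smul_rankOne {V : Type*} [NormedAddCommGroup V] [InnerProductSpace ℂ V]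
    {ι : Type*} [Fintype ι] (e : OrthonormalBasis ι ℂ V) (S : V →L[ℂ] V) :
    ∑ i, ∑ j, (inner ℂ (e i) (S (e j)) : ℂ) • InnerProductSpace.rankOne ℂ (e i) (e j) = S := by
  ext x
  conv_rhs => rw [← e.sum_repr' x]
  simp only [map_sum, map_smul, sum_apply, smul_apply, InnerProductSpace.rankOne_apply]
  rw [Finset.sum_comm]
  refine Finset.sum_congr rfl fun j _ => ?_
  conv_rhs => rw [← e.sum_repr' (S (e j)), Finset.smul_sum]
  exact Finset.sum_congr rfl fun i _ => smul_comm _ _ _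

/-- A factorization `K ≅ V ⊗ T` of Hilbert spaces, encoded by the maps `J v : η ↦ v ⊗ η`. The
vectors `J v η` multiply inner products as elementary tensors do, and they are total in `K`. -/
structure HilbertFactor (V : Type v) (T K : Type u) [NormedAddCommGroup V] [InnerProductSpace ℂ V]
    [NormedAddCommGroup T] [InnerProductSpace ℂ T] [NormedAddCommGroup K]
    [InnerProductSpace ℂ K] where
  J : V →ₗ[ℂ] (T →L[ℂ] K)
  inner_J : ∀ v w η θ, inner ℂ (J v η) (J w θ) = inner ℂ v w * inner ℂ η θ
  total : (Submodule.span ℂ {x | ∃ v η, J v η = x}).topologicalClosure = ⊤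

namespace HilbertFactor

variable {V : Type v} {T K : Type u} [NormedAddCommGroup V] [InnerProductSpace ℂ V]
  [NormedAddCommGroup T] [InnerProductSpace ℂ T] [NormedAddCommGroup K]
  [InnerProductSpace ℂ K] (f : HilbertFactor V T K)

/-- Operators on `K ≅ V ⊗ T` are determined by their values on the elementary tensors. -/
theorem clm_ext {E : Type*} [NormedAddCommGroup E] [NormedSpace ℂ E] {X Y : K →L[ℂ] E}
    (h : ∀ v η, X (f.J v η) = Y (f.J v η)) : X = Y := by
  refine ContinuousLinearMap.ext_on
    ((Submodule.dense_iff_topologicalClosure_eq_top).2 f.total) ?_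
  rintro _ ⟨v, η, rfl⟩
  exact h v η

theorem norm_J (v : V) (η : T) : ‖f.J v η‖ = ‖v‖ * ‖η‖ := by
  have h := f.inner_J v v η η
  simp only [inner_self_eq_norm_sq_to_K] at h
  have h' : ‖f.J v η‖ ^ 2 = (‖v‖ * ‖η‖) ^ 2 := by
    rw [mul_pow]; exact_mod_cast h
  exact (pow_left_inj₀ (norm_nonneg _) (by positivity) two_ne_zero).1 h'

variable [CompleteSpace T] [CompleteSpace K]

theorem adjoint_J_J (v w : V) (η : T) :
    ContinuousLinearMap.adjoint (f.J v) (f.J w η) = inner ℂ v w • η := by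
  refine ext_inner_left ℂ fun θ => ?_
  rw [ContinuousLinearMap.adjoint_inner_right, f.inner_J, inner_smul_right]

/-- The matrix coefficients of an operator on `K ≅ V ⊗ T`, as operators on `T`. -/
noncomputable def entry (v w : V) : (K →L[ℂ] K) →L[ℂ] (T →L[ℂ] T) :=
  (ContinuousLinearMap.compL ℂ T K T (ContinuousLinearMap.adjoint (f.J v))) ∘L
    ((ContinuousLinearMap.compL ℂ T K K).flip (f.J w))

theorem entry_apply (v w : V) (X : K →L[ℂ] K) :
    f.entry v w X = ContinuousLinearMap.adjoint (f.J v) ∘L X ∘L f.J w := rfl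

theorem entry_star (v w : V) (X : K →L[ℂ] K) :
    f.entry v w (star X) = star (f.entry w v X) := by
  simp only [entry_apply, ContinuousLinearMap.star_eq_adjoint, ContinuousLinearMap.adjoint_comp,
    ContinuousLinearMap.adjoint_adjoint, ContinuousLinearMap.comp_assoc]

theorem sum_J_adjoint_J {ι : Type*} [Fintype ι] (e : OrthonormalBasis ι ℂ V) :
    ∑ i, f.J (e i) ∘L ContinuousLinearMap.adjoint (f.J (e i)) = 1 := by
  refine f.clm_ext fun v η => ?_
  simp only [sum_apply, ContinuousLinearMap.comp_apply, adjoint_J_J,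
    map_smul, one_apply_eq_self]
  conv_rhs => rw [← e.sum_repr' v]
  simp

/-- Matrix coefficients multiply like matrices. -/
theorem entry_mul {ι : Type*} [Fintype ι] (e : OrthonormalBasis ι ℂ V) (v w : V)
    (X Y : K →L[ℂ] K) :
    f.entry v w (X * Y) = ∑ i, f.entry v (e i) X * f.entry (e i) w Y := by
  have : X * Y = X * (∑ i, f.J (e i) ∘L ContinuousLinearMap.adjoint (f.J (e i))) * Y := by
    rw [f.sum_J_adjoint_J e, mul_one]
  rw [this]
  ext η
  simp [entry_apply]

variable [FiniteDimensional ℂ V]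

/-- The operator `S ⊗ b` on `K ≅ V ⊗ T`. -/
noncomputable def op (S : V →L[ℂ] V) (b : T →L[ℂ] T) : K →L[ℂ] K :=
  ∑ i, f.J (S (stdOrthonormalBasis ℂ V i)) ∘L b ∘L
    ContinuousLinearMap.adjoint (f.J (stdOrthonormalBasis ℂ V i))

@[simp] theorem op_J (S : V →L[ℂ] V) (b : T →L[ℂ] T) (v : V) (η : T) :
    f.op S b (f.J v η) = f.J (S v) (b η) := by
  simp only [op, sum_apply, ContinuousLinearMap.comp_apply, adjoint_J_J,
    map_smul]
  conv_rhs => rw [← (stdOrthonormalBasis ℂ V).sum_repr' v]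
  simp

theorem op_add_left (S R : V →L[ℂ] V) (b : T →L[ℂ] T) :
    f.op (S + R) b = f.op S b + f.op R b := f.clm_ext fun v η => by simp

theorem op_smul_left (c : ℂ) (S : V →L[ℂ] V) (b : T →L[ℂ] T) :
    f.op (c • S) b = c • f.op S b := f.clm_ext fun v η => by simp

theorem op_add_right (S : V →L[ℂ] V) (b c : T →L[ℂ] T) :
    f.op S (b + c) = f.op S b + f.op S c := f.clm_ext fun v η => by simp

theorem op_smul_right (c : ℂ) (S : V →L[ℂ] V) (b : T →L[ℂ] T) :
    f.op S (c • b) = c • f.op S b := f.clm_ext fun v η => by simp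

theorem op_mul_op (S R : V →L[ℂ] V) (b c : T →L[ℂ] T) :
    f.op S b * f.op R c = f.op (S * R) (b * c) := f.clm_ext fun v η => by simp

/-- The operators `S ⊗ b`, as a bilinear map. -/
noncomputable def opBilin : (V →L[ℂ] V) →ₗ[ℂ] (T →L[ℂ] T) →ₗ[ℂ] (K →L[ℂ] K) :=
  LinearMap.mk₂ ℂ f.op f.op_add_left f.op_smul_left f.op_add_right f.op_smul_right

@[simp] theorem opBilin_apply (S : V →L[ℂ] V) (b : T →L[ℂ] T) : f.opBilin S b = f.op S b := rfl

theorem star_op (S : V →L[ℂ] V) (b : T →L[ℂ] T) :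
    star (f.op S b) = f.op (star S) (star b) := by
  have := FiniteDimensional.complete ℂ V
  refine f.clm_ext fun v η => ?_
  have h : innerSL ℂ (star (f.op S b) (f.J v η)) =
      innerSL ℂ (f.op (star S) (star b) (f.J v η)) := by
    refine f.clm_ext fun w θ => ?_
    simp only [innerSL_apply_apply, ContinuousLinearMap.star_eq_adjoint,
      ContinuousLinearMap.adjoint_inner_left, op_J, f.inner_J]
  exact (innerSL_inj (𝕜 := ℂ)).1 h

theorem entry_op (v w : V) (S : V →L[ℂ] V) (b : T →L[ℂ] T) :
    f.entry v w (f.op S b) = inner ℂ v (S w) • b := by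
  ext η
  simp [entry_apply, adjoint_J_J]

theorem op_rankOne (v w : V) (b : T →L[ℂ] T) :
    f.op (InnerProductSpace.rankOne ℂ v w) b =
      f.J v ∘L b ∘L ContinuousLinearMap.adjoint (f.J w) := by
  refine f.clm_ext fun x η => ?_
  simp [adjoint_J_J]

/-- An operator is recovered from its matrix coefficients with respect to an orthonormal basis. -/
theorem sum_op_entry {ι : Type*} [Fintype ι] (e : OrthonormalBasis ι ℂ V) (X : K →L[ℂ] K) :
    ∑ i, ∑ j, f.op (InnerProductSpace.rankOne ℂ (e i) (e j)) (f.entry (e i) (e j) X) = X := by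
  have : X = (∑ i, f.J (e i) ∘L ContinuousLinearMap.adjoint (f.J (e i))) * X *
      (∑ i, f.J (e i) ∘L ContinuousLinearMap.adjoint (f.J (e i))) := by
    rw [f.sum_J_adjoint_J e, mul_one, one_mul]
  conv_rhs => rw [this]
  simp only [op_rankOne, Finset.sum_mul, Finset.mul_sum, entry_apply]
  rw [Finset.sum_comm]
  rfl

/-- The operators on `K ≅ V ⊗ T` all of whose matrix coefficients lie in `D`; this is
`𝓑(V) ⊗ D`. -/
noncomputable def matAlgebra (D : NonUnitalStarSubalgebra ℂ (T →L[ℂ] T)) :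
    NonUnitalStarSubalgebra ℂ (K →L[ℂ] K) where
  carrier := {X | ∀ v w, f.entry v w X ∈ D}
  add_mem' hX hY v w := by rw [map_add]; exact add_mem (hX v w) (hY v w)
  zero_mem' v w := by rw [map_zero]; exact zero_mem D
  smul_mem' c X hX v w := by rw [map_smul]; exact SMulMemClass.smul_mem c (hX v w)
  mul_mem' hX hY v w := by
    rw [f.entry_mul (stdOrthonormalBasis ℂ V)]
    exact sum_mem fun i _ => mul_mem (hX _ _) (hY _ _)
  star_mem' hX v w := by rw [f.entry_star]; exact star_mem (hX w v)

theorem mem_matAlgebra {D : NonUnitalStarSubalgebra ℂ (T →L[ℂ] T)} {X : K →L[ℂ] K} :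
    X ∈ f.matAlgebra D ↔ ∀ v w, f.entry v w X ∈ D := Iff.rfl

theorem isClosed_matAlgebra {D : NonUnitalStarSubalgebra ℂ (T →L[ℂ] T)}
    (hD : IsClosed (D : Set (T →L[ℂ] T))) : IsClosed (f.matAlgebra D : Set (K →L[ℂ] K)) := by
  have : (f.matAlgebra D : Set (K →L[ℂ] K)) =
      ⋂ v, ⋂ w, f.entry v w ⁻¹' (D : Set (T →L[ℂ] T)) := by
    ext X
    simp [mem_matAlgebra]
  rw [this]
  exact isClosed_iInter fun v => isClosed_iInter fun w => hD.preimage (f.entry v w).continuous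

theorem op_mem_matAlgebra {D : NonUnitalStarSubalgebra ℂ (T →L[ℂ] T)} (S : V →L[ℂ] V)
    {b : T →L[ℂ] T} (hb : b ∈ D) : f.op S b ∈ f.matAlgebra D := fun v w => by
  rw [f.entry_op]; exact SMulMemClass.smul_mem _ hb

theorem continuous_op (S : V →L[ℂ] V) : Continuous (f.op S) := by
  unfold op
  fun_prop

/-- The C⋆-algebra generated by the operators `S ⊗ a`, where `S` runs through a unital
⋆-invariant spanning set of `𝓑(V)`, is `𝓑(V) ⊗ C⋆(a)`. -/
theorem cstarGen_op_eq {𝒮 : Set (V →L[ℂ] V)} (h1 : 1 ∈ 𝒮) (hstar : ∀ S ∈ 𝒮, star S ∈ 𝒮)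
    (hspan : Submodule.span ℂ 𝒮 = ⊤) (a : T →L[ℂ] T) :
    cstarGen {X | ∃ S ∈ 𝒮, f.op S a = X} = f.matAlgebra (cstarGen {a}) := by
  set D := cstarGen {X | ∃ S ∈ 𝒮, f.op S a = X} with hDdef
  have hDcl : IsClosed (D : Set (K →L[ℂ] K)) := cstarGen_isClosed _
  refine le_antisymm (cstarGen_le (f.isClosed_matAlgebra (cstarGen_isClosed _)) ?_) ?_
  · rintro _ ⟨S, -, rfl⟩
    exact f.op_mem_matAlgebra S (subset_cstarGen _ rfl)
  · -- products are reached because `S ⊗ b c = (S ⊗ b) (1 ⊗ c)` with `1 ∈ 𝒮`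
    have key : ∀ b ∈ cstarGen {a}, ∀ S ∈ 𝒮, f.op S b ∈ D := by
      intro b hb
      have hcl : IsClosed {b : T →L[ℂ] T | ∀ S ∈ 𝒮, f.op S b ∈ D} := by
        simp only [Set.ofPred_forall]
        exact isClosed_iInter fun S => isClosed_iInter fun _ =>
          hDcl.preimage (f.continuous_op S)
      refine (closure_minimal (s := (NonUnitalStarAlgebra.adjoin ℂ {a} : Set (T →L[ℂ] T))) ?_
        hcl) hb
      intro b hb
      induction hb using NonUnitalStarAlgebra.adjoin_induction with
      | mem x hx =>
        obtain rfl : x = a := hx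
        exact fun S hS => subset_cstarGen _ ⟨S, hS, rfl⟩
      | add x y _ _ hx hy =>
        intro S hS; rw [f.op_add_right]; exact add_mem (hx S hS) (hy S hS)
      | zero => intro S _; rw [← f.opBilin_apply, map_zero]; exact zero_mem D
      | mul x y _ _ hx hy =>
        intro S hS
        rw [← mul_one S, ← f.op_mul_op]
        exact mul_mem (hx S hS) (hy 1 h1)
      | smul r x _ hx =>
        intro S hS; rw [f.op_smul_right]; exact SMulMemClass.smul_mem r (hx S hS)
      | star x _ hx =>
        intro S hS
        rw [← star_star S, ← f.star_op]
        exact star_mem (hx _ (hstar S hS))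
    have key' : ∀ b ∈ cstarGen {a}, ∀ S, f.op S b ∈ D := by
      intro b hb S
      have hS : S ∈ Submodule.span ℂ 𝒮 := hspan ▸ Submodule.mem_top
      induction hS using Submodule.span_induction with
      | mem S hS => exact key b hb S hS
      | zero => rw [← f.opBilin_apply, map_zero]; exact zero_mem D
      | add S R _ _ hS hR => rw [f.op_add_left]; exact add_mem hS hR
      | smul c S _ hS => rw [f.op_smul_left]; exact SMulMemClass.smul_mem c hS
    intro X hX
    rw [← f.sum_op_entry (stdOrthonormalBasis ℂ V) X]
    exact sum_mem fun i _ => sum_mem fun j _ => key' _ (hX _ _) _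

/-- The isomorphism `𝓑(V) ⊗ D ≅ f.matAlgebra D`, with the algebraic tensor product on the
left. -/
noncomputable def tensorEquiv (D : NonUnitalStarSubalgebra ℂ (T →L[ℂ] T)) :
    ((V →L[ℂ] V) ⊗[ℂ] D) ≃ₗ[ℂ] f.matAlgebra D :=
  let F : ((V →L[ℂ] V) ⊗[ℂ] D) →ₗ[ℂ] (K →L[ℂ] K) :=
    TensorProduct.lift (f.opBilin.compl₂ D.toSubmodule.subtype)
  have hF : ∀ x, F x ∈ f.matAlgebra D := fun x => by
    induction x using TensorProduct.induction_on with
    | zero => rw [map_zero]; exact zero_mem _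
    | tmul S b => exact f.op_mem_matAlgebra S b.2
    | add x y hx hy => rw [map_add]; exact add_mem hx hy
  let e := stdOrthonormalBasis ℂ V
  let G : f.matAlgebra D →ₗ[ℂ] ((V →L[ℂ] V) ⊗[ℂ] D) :=
    { toFun := fun X => ∑ i, ∑ j, (InnerProductSpace.rankOne ℂ (e i) (e j)) ⊗ₜ[ℂ]
        (⟨f.entry (e i) (e j) X, X.2 _ _⟩ : D)
      map_add' := fun X Y => by
        simp only [← Finset.sum_add_distrib, ← TensorProduct.tmul_add]
        refine Finset.sum_congr rfl fun i _ => Finset.sum_congr rfl fun j _ => ?_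
        congr 1
        exact Subtype.ext (map_add (f.entry (e i) (e j)) X.1 Y.1)
      map_smul' := fun c X => by
        simp only [Finset.smul_sum, ← TensorProduct.tmul_smul, RingHom.id_apply]
        refine Finset.sum_congr rfl fun i _ => Finset.sum_congr rfl fun j _ => ?_
        congr 1
        exact Subtype.ext (map_smul (f.entry (e i) (e j)) c X.1) }
  LinearEquiv.ofLinearMap (F.codRestrict (f.matAlgebra D).toSubmodule hF) G
    (by
      ext X : 2
      change F (G X) = (X : K →L[ℂ] K)
      refine Eq.trans ?_ (f.sum_op_entry e X)
      simp only [G, LinearMap.coe_mk, AddHom.coe_mk, map_sum]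
      rfl)
    (by
      refine TensorProduct.ext' fun S b => ?_
      change (∑ i, ∑ j, (InnerProductSpace.rankOne ℂ (e i) (e j)) ⊗ₜ[ℂ]
        (⟨f.entry (e i) (e j) (f.op S b), _⟩ : D)) = S ⊗ₜ b
      conv_rhs => rw [← sum_inner_smul_rankOne e S]
      simp only [TensorProduct.sum_tmul]
      refine Finset.sum_congr rfl fun i _ => Finset.sum_congr rfl fun j _ => ?_
      rw [TensorProduct.smul_tmul]
      congr 1
      exact Subtype.ext (f.entry_op _ _ S b))

@[simp] theorem tensorEquiv_tmul (D : NonUnitalStarSubalgebra ℂ (T →L[ℂ] T)) (S : V →L[ℂ] V)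
    (b : D) : (f.tensorEquiv D (S ⊗ₜ b) : K →L[ℂ] K) = f.op S b := rfl

end HilbertFactor

/-! ### Homogeneity -/

/-- Schur's lemma: a normal operator commuting with an irreducible representation is scalar. -/
theorem IsIrreducibleRep.exists_eq_smul_one {A : Type u} [NonUnitalCStarAlgebra A] {E : Type u}
    [NormedAddCommGroup E] [InnerProductSpace ℂ E] [CompleteSpace E]
    {π : A →⋆ₙₐ[ℂ] (E →L[ℂ] E)} (hπ : IsIrreducibleRep π) (X : E →L[ℂ] E) [IsStarNormal X]
    (hX : ∀ a, Commute X (π a)) : ∃ c : ℂ, X = c • 1 := by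
  obtain ⟨⟨a₀, ha₀⟩, hirr⟩ := hπ
  have hnt : Nontrivial E := by
    by_contra h
    rw [not_nontrivial_iff_subsingleton] at h
    exact ha₀ (Subsingleton.elim _ _)
  have hXs : ∀ a, Commute (star X) (π a) := fun a => by
    have := (hX (star a)).star_star
    rwa [map_star, star_star] at this
  have hcfc : ∀ (f : ℂ → ℂ) a, Commute (cfc f X) (π a) := fun f a =>
    Commute.cfc (hX a) (hXs a) f
  obtain ⟨l, hl⟩ := spectrum.nonempty X
  refine ⟨l, ?_⟩
  by_cases hsub : ∀ m ∈ spectrum ℂ X, m = l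
  · have h1 : cfc (fun _ => l) X = cfc (id : ℂ → ℂ) X :=
      cfc_congr fun m hm => (hsub m hm).symm
    rw [cfc_const l X, cfc_id ℂ X] at h1
    rw [← h1, Algebra.algebraMap_eq_smul_one]
  · exfalso
    push Not at hsub
    obtain ⟨m, hm, hml⟩ := hsub
    set r : ℝ := ‖m - l‖ / 2 with hr
    have hr0 : 0 < r := by
      have := norm_pos_iff.2 (sub_ne_zero.2 hml)
      positivity
    -- two bump functions with disjoint supports around the spectral points `l` and `m`
    let F : ℂ → ℂ → ℂ := fun p z => ((max 0 (r - ‖z - p‖) : ℝ) : ℂ)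
    have hFc : ∀ p, Continuous (F p) := fun p => by
      simp only [F]; fun_prop
    have hne : ∀ p ∈ spectrum ℂ X, cfc (F p) X ≠ 0 := by
      intro p hp h0
      have hmem : F p p ∈ spectrum ℂ (cfc (F p) X) := by
        rw [cfc_map_spectrum (F p) X (by cfc_tac) (hFc p).continuousOn]
        exact ⟨p, hp, rfl⟩
      rw [h0, spectrum.zero_eq] at hmem
      have : F p p = (r : ℂ) := by simp [F, hr0.le]
      rw [this, Set.mem_singleton_iff] at hmem
      exact hr0.ne' (by exact_mod_cast hmem)
    have hmul : cfc (F l) X * cfc (F m) X = 0 := by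
      rw [← cfc_mul (F l) (F m) X (hFc l).continuousOn (hFc m).continuousOn, ← cfc_zero ℂ X]
      refine cfc_congr fun z _ => ?_
      have htri : ‖m - l‖ ≤ ‖z - l‖ + ‖z - m‖ := by
        have := norm_sub_le (z - l) (z - m)
        simpa using this
      change F l z * F m z = 0
      simp only [F]
      rcases le_total r ‖z - l‖ with h | h
      · rw [max_eq_left (by linarith)]; simp
      · rw [max_eq_left (b := r - ‖z - m‖) (by linarith)]; simp
    -- the kernel of `F l (X)` is invariant and is neither `0` nor everything
    rcases hirr (LinearMap.ker (cfc (F l) X).toLinearMap)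
      (ContinuousLinearMap.isClosed_ker (cfc (F l) X)) (fun a v hv => by
        have h := congrArg (fun Y : E →L[ℂ] E => Y v) (hcfc (F l) a).eq
        simp only [mul_apply_eq_comp] at h
        rw [LinearMap.mem_ker] at hv ⊢
        simp only [ContinuousLinearMap.coe_coe] at hv ⊢
        rw [h, hv, map_zero]) with h | h
    · refine hne m hm (ContinuousLinearMap.ext fun x => ?_)
      have hx : cfc (F m) X x ∈ LinearMap.ker (cfc (F l) X).toLinearMap := by
        rw [LinearMap.mem_ker]
        exact congrArg (fun Y : E →L[ℂ] E => Y x) hmul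
      rw [h, Submodule.mem_bot] at hx
      exact hx
    · refine hne l hl (ContinuousLinearMap.ext fun x => ?_)
      have hx : x ∈ LinearMap.ker (cfc (F l) X).toLinearMap := h ▸ Submodule.mem_top
      exact LinearMap.mem_ker.1 hx

/-- A C⋆-algebra of the form `𝓑(V) ⊗ D` with `D` commutative is homogeneous of dimension
`dim V`. -/
theorem isHomogeneousCStar_of_tensor {V : Type v} [NormedAddCommGroup V] [InnerProductSpace ℂ V]
    [FiniteDimensional ℂ V] [CompleteSpace V] {D : Type*} [NonUnitalRing D] [StarRing D]
    [Module ℂ D]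
    (hcomm : ∀ b c : D, b * c = c * b) {A : Type u} [NonUnitalCStarAlgebra A]
    (t : (V →L[ℂ] V) →ₗ[ℂ] D →ₗ[ℂ] A)
    (hmul : ∀ S R b c, t S b * t R c = t (S * R) (b * c))
    (hstar : ∀ S b, star (t S b) = t (star S) (star b))
    (hspan : Submodule.span ℂ {a | ∃ S b, t S b = a} = ⊤) :
    IsHomogeneousCStar (Module.finrank ℂ V) A := by
  intro E _ _ _ π hπ
  -- `1 ⊗ b` is central, so it acts by a scalar `χ b`
  have hcen : ∀ b, ∃ c : ℂ, π (t 1 b) = c • 1 := by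
    intro b
    have hn : IsStarNormal (π (t 1 b)) := ⟨by
      rw [← map_star, hstar, star_one]
      change π _ * π _ = π _ * π _
      rw [← map_mul π, ← map_mul π, hmul, hmul, hcomm]⟩
    refine hπ.exists_eq_smul_one _ fun a => ?_
    have ha : a ∈ Submodule.span ℂ {a | ∃ S b, t S b = a} := hspan ▸ Submodule.mem_top
    induction ha using Submodule.span_induction with
    | mem a ha =>
      obtain ⟨S, c, rfl⟩ := ha
      change _ = _
      rw [← map_mul, ← map_mul, hmul, hmul, hcomm, one_mul, mul_one]
    | zero => rw [map_zero]; exact Commute.zero_right _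
    | add x y _ _ hx hy => rw [map_add]; exact hx.add_right hy
    | smul c x _ hx => rw [map_smul]; exact hx.smul_right c
  choose χ hχ using hcen
  obtain ⟨b, hb⟩ : ∃ b, χ b ≠ 0 := by
    by_contra! h
    obtain ⟨⟨a₀, ha₀⟩, -⟩ := hπ
    refine ha₀ ?_
    have hall : ∀ a, π a = 0 := by
      intro a
      have ha : a ∈ Submodule.span ℂ {a | ∃ S b, t S b = a} := hspan ▸ Submodule.mem_top
      induction ha using Submodule.span_induction with
      | mem a ha =>
        obtain ⟨S, c, rfl⟩ := ha
        have h2 : π (t S c) * star (π (t S c)) = 0 := by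
          rw [← map_star, hstar, ← map_mul, hmul, ← mul_one (S * star S), ← hmul, map_mul, hχ, h,
            zero_smul, mul_zero]
        exact CStarRing.mul_star_self_eq_zero_iff _ |>.1 h2
      | zero => exact map_zero _
      | add x y _ _ hx hy => rw [map_add, hx, hy, add_zero]
      | smul c x _ hx => rw [map_smul, hx, smul_zero]
    exact hall a₀
  -- `ρ` is a unital representation of `𝓑(V)` with the same invariant subspaces as `π`
  let ρ : (V →L[ℂ] V) →ₗ[ℂ] (E →L[ℂ] E) :=
    (χ b)⁻¹ • ((π : A →ₗ[ℂ] (E →L[ℂ] E)) ∘ₗ t.flip b)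
  have hρ : ∀ S, ρ S = (χ b)⁻¹ • π (t S b) := fun S => rfl
  have hρmul : ∀ S R, ρ S * ρ R = ρ (S * R) := by
    intro S R
    rw [hρ, hρ, hρ, smul_mul_smul_comm, ← map_mul, hmul, ← mul_one (S * R), ← hmul, map_mul, hχ,
      mul_smul_comm, mul_one, smul_smul, mul_one]
    congr 1
    field_simp
  have hρ1 : ρ 1 = 1 := by rw [hρ, hχ, smul_smul, inv_mul_cancel₀ hb, one_smul]
  have hπρ : ∀ S c, π (t S c) = χ c • ρ S := by
    intro S c
    have h1 : π (t S c) * π (t 1 b) = π (t S b) * π (t 1 c) := by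
      rw [← map_mul, ← map_mul, hmul, hmul, hcomm]
    rw [hχ, hχ, mul_smul_comm, mul_smul_comm, mul_one, mul_one] at h1
    rw [hρ, smul_comm, ← h1, smul_smul, inv_mul_cancel₀ hb, one_smul]
  have hEnt : (1 : E →L[ℂ] E) ≠ 0 := by
    obtain ⟨⟨a₀, ha₀⟩, -⟩ := hπ
    intro h
    exact ha₀ (by rw [← mul_one (π a₀), h, mul_zero])
  obtain ⟨v, hv⟩ : ∃ v : V, v ≠ 0 := by
    by_contra! h
    refine hEnt ?_
    rw [← hρ1, show (1 : V →L[ℂ] V) = 0 from ContinuousLinearMap.ext fun x => h _, map_zero]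
  -- for `ρ (|v⟩⟨v|) w ≠ 0`, the map `x ↦ ρ (|x⟩⟨v|) w` is an isomorphism from `V` onto `E`
  have hrank : ∀ x y z w : V, InnerProductSpace.rankOne ℂ x y * InnerProductSpace.rankOne ℂ z w =
      (inner ℂ y z : ℂ) • InnerProductSpace.rankOne ℂ x w := by
    intro x y z w
    ext η
    simp only [mul_apply_eq_comp, InnerProductSpace.rankOne_apply, map_smul,
      smul_apply]
    exact smul_comm _ _ _
  have hvv : (inner ℂ v v : ℂ) ≠ 0 := inner_self_ne_zero.2 hv
  have hρv : ρ (InnerProductSpace.rankOne ℂ v v) ≠ 0 := by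
    intro h0
    have h1 : ∀ x y, ρ (InnerProductSpace.rankOne ℂ x y) = 0 := by
      intro x y
      have h2 : ρ (InnerProductSpace.rankOne ℂ x v) * ρ (InnerProductSpace.rankOne ℂ v v) *
          ρ (InnerProductSpace.rankOne ℂ v y) = 0 := by rw [h0, mul_zero, zero_mul]
      rw [hρmul, hrank, map_smul, smul_mul_assoc, hρmul, hrank, map_smul, smul_smul] at h2
      exact (smul_eq_zero.1 h2).resolve_left (mul_ne_zero hvv hvv)
    refine hEnt ?_
    have h3 : (1 : V →L[ℂ] V) = ∑ i, InnerProductSpace.rankOne ℂ (stdOrthonormalBasis ℂ V i)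
        (stdOrthonormalBasis ℂ V i) := by
      ext x
      simp only [sum_apply, InnerProductSpace.rankOne_apply, one_apply_eq_self]
      exact ((stdOrthonormalBasis ℂ V).sum_repr' x).symm
    rw [← hρ1, h3, map_sum]
    exact Finset.sum_eq_zero fun i _ => h1 _ _
  obtain ⟨w, hw⟩ : ∃ w, ρ (InnerProductSpace.rankOne ℂ v v) w ≠ 0 := by
    by_contra! h
    exact hρv (ContinuousLinearMap.ext h)
  let L : V →ₗ[ℂ] E :=
    { toFun := fun x => ρ (InnerProductSpace.rankOne ℂ x v) w
      map_add' := fun x y => by simp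
      map_smul' := fun c x => by simp }
  have hL : ∀ x, L x = ρ (InnerProductSpace.rankOne ℂ x v) w := fun x => rfl
  have hequiv : ∀ S x, ρ S (L x) = L (S x) := by
    intro S x
    rw [hL, hL, ← mul_apply_eq_comp, hρmul]
    congr 2
    ext y
    simp
  have hinj : Function.Injective L := by
    rw [injective_iff_map_eq_zero]
    intro x hx
    by_contra hx0
    have h1 := hequiv (InnerProductSpace.rankOne ℂ v x) x
    rw [hx, map_zero, InnerProductSpace.rankOne_apply, map_smul] at h1
    exact (smul_ne_zero (inner_self_ne_zero.2 hx0) hw) h1.symm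
  have hinv : ∀ a, ∀ y ∈ LinearMap.range L, π a y ∈ LinearMap.range L := by
    intro a
    have ha : a ∈ Submodule.span ℂ {a | ∃ S b, t S b = a} := hspan ▸ Submodule.mem_top
    induction ha using Submodule.span_induction with
    | mem a ha =>
      obtain ⟨S, c, rfl⟩ := ha
      rintro _ ⟨x, rfl⟩
      rw [hπρ, smul_apply, hequiv]
      exact Submodule.smul_mem _ _ ⟨_, rfl⟩
    | zero => intro y _; simp
    | add x y _ _ hx hy =>
      intro z hz; rw [map_add, add_apply]; exact add_mem (hx z hz) (hy z hz)
    | smul c x _ hx =>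
      intro z hz; rw [map_smul, smul_apply]; exact Submodule.smul_mem _ _ (hx z hz)
  have hsurj : LinearMap.range L = ⊤ := by
    refine (hπ.2 _ (Submodule.closed_of_finiteDimensional _) hinv).resolve_left fun h => hw ?_
    have : L v ∈ LinearMap.range L := ⟨v, rfl⟩
    rw [h, Submodule.mem_bot] at this
    exact this
  have hr := (LinearEquiv.ofBijective L ⟨hinj, LinearMap.range_eq_top.1 hsurj⟩).lift_rank_eq
  rw [← Module.finrank_eq_rank ℂ V, Cardinal.lift_natCast] at hr
  rw [← Cardinal.lift_natCast.{v}] at hr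
  exact (Cardinal.lift_injective hr).symm

/-! ### Completely positive maps to and from matrix algebras -/

namespace CStarMatrix

/-- A matrix of the form `(Yₚ⋆ Y_q)` is positive. -/
theorem gram_nonneg {A : Type*} [NonUnitalCStarAlgebra A] [PartialOrder A] [StarOrderedRing A]
    {m : Type*} [Fintype m] (M : CStarMatrix m m A) (Y : m → A)
    (hM : ∀ p q, M p q = star (Y p) * Y q) : 0 ≤ M := by
  classical
  rcases isEmpty_or_nonempty m with h | ⟨⟨p₀⟩⟩
  · exact le_of_eq (by ext p; exact h.elim p)
  · let R : CStarMatrix m m A := fun r q => if r = p₀ then Y q else 0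
    have : M = star R * R := by
      ext p q
      rw [CStarMatrix.mul_apply, hM, Finset.sum_eq_single p₀]
      · rw [CStarMatrix.star_apply]
        simp [R]
      · intro r _ hr
        simp [R, hr]
      · simp
    rw [this]
    exact star_mul_self_nonneg R

theorem sum_apply' {A : Type*} [AddCommMonoid A] {m n ι : Type*} (s : Finset ι)
    (M : ι → CStarMatrix m n A) (i : m) (j : n) : (∑ k ∈ s, M k) i j = ∑ k ∈ s, M k i j := by
  classical
  induction s using Finset.induction_on with
  | empty => rfl
  | insert a s ha ih => rw [Finset.sum_insert ha, Finset.sum_insert ha, ← ih]; rfl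

theorem sum_gram_nonneg {A : Type*} [NonUnitalCStarAlgebra A] [PartialOrder A] [StarOrderedRing A]
    {m ι : Type*} [Fintype m] [Fintype ι] (M : CStarMatrix m m A) (Y : ι → m → A)
    (hM : ∀ p q, M p q = ∑ k, star (Y k p) * Y k q) : 0 ≤ M := by
  have : M = ∑ k, (show CStarMatrix m m A from fun p q => star (Y k p) * Y k q) := by
    ext p q
    rw [sum_apply', hM]
  rw [this]
  exact Finset.sum_nonneg fun k _ => gram_nonneg _ (Y k) fun p q => rfl

theorem exists_eq_star_mul_self_of_nonneg {B : Type*} [NonUnitalCStarAlgebra B] [PartialOrder B]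
    [StarOrderedRing B] {x : B} (hx : 0 ≤ x) : ∃ y, x = star y * y :=
  CStarAlgebra.nonneg_iff_eq_star_mul_self.1 hx

/-- A positive matrix is a sum of matrices of the form `(Yₚ⋆ Y_q)`. -/
theorem exists_gram_of_nonneg {A : Type*} [NonUnitalCStarAlgebra A] [PartialOrder A]
    [StarOrderedRing A] {m : Type*} [Fintype m] {M : CStarMatrix m m A} (hM : 0 ≤ M) :
    ∃ N : m → m → A, ∀ p q, M p q = ∑ r, star (N r p) * N r q := by
  obtain ⟨N, rfl⟩ := exists_eq_star_mul_self_of_nonneg hM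
  exact ⟨N, fun p q => by simp [CStarMatrix.mul_apply, CStarMatrix.star_apply]⟩

/-- The action of a matrix on Euclidean space, as an isometric representation. -/
noncomputable def toEuclidean (n : ℕ) : CStarMatrix (Fin n) (Fin n) ℂ →⋆ₐ[ℂ]
    (EuclideanSpace ℂ (Fin n) →L[ℂ] EuclideanSpace ℂ (Fin n)) :=
  ((Matrix.toEuclideanCLM (n := Fin n) (𝕜 := ℂ)).toStarAlgHom).comp
    (ofMatrixStarAlgEquiv.symm : CStarMatrix (Fin n) (Fin n) ℂ ≃⋆ₐ[ℂ] _).toStarAlgHom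

theorem norm_toEuclidean {n : ℕ} (x : CStarMatrix (Fin n) (Fin n) ℂ) :
    ‖toEuclidean n x‖ = ‖x‖ := by
  refine NonUnitalStarAlgHom.norm_map (toEuclidean n) ?_ x
  intro x y h
  exact ofMatrixStarAlgEquiv.symm.injective (Matrix.toEuclideanCLM.injective h)

theorem inner_toEuclidean {n : ℕ} (x : CStarMatrix (Fin n) (Fin n) ℂ)
    (c d : EuclideanSpace ℂ (Fin n)) :
    inner ℂ c (toEuclidean n x d) = ∑ i, ∑ j, star (c i) * x i j * d j := by
  have h : ∀ i, (toEuclidean n x d) i = ∑ j, x i j * d j := fun i => rfl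
  simp only [PiLp.inner_apply, h, RCLike.inner_apply, Finset.sum_mul]
  refine Finset.sum_congr rfl fun i _ => Finset.sum_congr rfl fun j _ => ?_
  simp only [Complex.star_def]
  ring

theorem norm_sum_le {n : ℕ} (x : CStarMatrix (Fin n) (Fin n) ℂ) (c d : Fin n → ℂ) :
    ‖∑ i, ∑ j, star (c i) * x i j * d j‖ ≤
      ‖x‖ * (√(∑ i, ‖c i‖ ^ 2) * √(∑ i, ‖d i‖ ^ 2)) := by
  have h := inner_toEuclidean x (WithLp.toLp 2 c) (WithLp.toLp 2 d)
  simp only at h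
  rw [← h, ← norm_toEuclidean x]
  refine (norm_inner_le_norm _ _).trans ?_
  rw [← EuclideanSpace.norm_eq (WithLp.toLp 2 c), ← EuclideanSpace.norm_eq (WithLp.toLp 2 d)]
  calc _ ≤ ‖WithLp.toLp 2 c‖ * (‖toEuclidean n x‖ * ‖WithLp.toLp 2 d‖) := by
        gcongr; exact ContinuousLinearMap.le_opNorm _ _
    _ = _ := by ring

theorem norm_le_of_forall_sum_le {n : ℕ} (x : CStarMatrix (Fin n) (Fin n) ℂ) {C : ℝ} (hC : 0 ≤ C)
    (h : ∀ c d : Fin n → ℂ, ‖∑ i, ∑ j, star (c i) * x i j * d j‖ ≤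
      C * (√(∑ i, ‖c i‖ ^ 2) * √(∑ i, ‖d i‖ ^ 2))) : ‖x‖ ≤ C := by
  rw [← norm_toEuclidean x]
  refine ContinuousLinearMap.opNorm_le_bound _ hC fun d => ?_
  set y := toEuclidean n x d with hy
  have h1 := h y.ofLp d.ofLp
  rw [← inner_toEuclidean x y d, ← hy, ← EuclideanSpace.norm_eq, ← EuclideanSpace.norm_eq,
    inner_self_eq_norm_sq_to_K] at h1
  have h2 : ‖y‖ * ‖y‖ ≤ (C * ‖d‖) * ‖y‖ := by
    have : ‖((‖y‖ : ℂ)) ^ 2‖ = ‖y‖ * ‖y‖ := by simp [sq]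
    rw [← this]; refine h1.trans (le_of_eq (by ring))
  rcases (norm_nonneg y).eq_or_lt with h0 | h0
  · rw [← h0]; positivity
  · exact le_of_mul_le_mul_right h2 h0

end CStarMatrix

/-- A scalar Gram matrix is a sum of rank one positive matrices. -/
theorem exists_gram_expansion {E ι : Type*} [NormedAddCommGroup E] [InnerProductSpace ℂ E]
    [Finite ι] (y : ι → E) :
    ∃ (m : ℕ) (c : Fin m → ι → ℂ), ∀ i j, inner ℂ (y i) (y j) = ∑ b, star (c b i) * c b j := by
  let W := Submodule.span ℂ (Set.range y)
  have : FiniteDimensional ℂ W := FiniteDimensional.span_of_finite ℂ (Set.finite_range y)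
  let e := stdOrthonormalBasis ℂ W
  let z : ι → W := fun i => ⟨y i, Submodule.subset_span ⟨i, rfl⟩⟩
  refine ⟨_, fun b i => inner ℂ (e b) (z i), fun i j => ?_⟩
  have h := e.sum_inner_mul_inner (z i) (z j)
  rw [show (inner ℂ (y i) (y j) : ℂ) = inner ℂ (z i) (z j) from rfl, ← h]
  exact Finset.sum_congr rfl fun b _ => by rw [← inner_conj_symm (z i) (e b)]; rfl

/-- The amplification `x ⊗ 1` of a scalar matrix `x` has norm at most `‖x‖`. -/
theorem CStarMatrix.norm_sum_inner_le {n : ℕ} (x : CStarMatrix (Fin n) (Fin n) ℂ) {E : Type*}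
    [NormedAddCommGroup E] [InnerProductSpace ℂ E] (y z : Fin n → E) :
    ‖∑ i, ∑ j, x i j * inner ℂ (y i) (z j)‖ ≤
      ‖x‖ * (√(∑ i, ‖y i‖ ^ 2) * √(∑ i, ‖z i‖ ^ 2)) := by
  obtain ⟨m, c, hc⟩ := exists_gram_expansion (Sum.elim y z)
  have h1 : ∀ i j, inner ℂ (y i) (z j) = ∑ b, star (c b (Sum.inl i)) * c b (Sum.inr j) :=
    fun i j => hc (Sum.inl i) (Sum.inr j)
  have hn : ∀ s, ‖Sum.elim y z s‖ ^ 2 = ∑ b, ‖c b s‖ ^ 2 := fun s => by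
    have h := hc s s
    rw [inner_self_eq_norm_sq_to_K] at h
    have h' : ∀ b, star (c b s) * c b s = ((‖c b s‖ ^ 2 : ℝ) : ℂ) := fun b => by
      rw [Complex.star_def, Complex.conj_mul']; norm_cast
    simp only [h', ← Complex.ofReal_sum] at h
    refine Complex.ofReal_injective (Eq.trans ?_ h)
    push_cast
    rfl
  have h2 : ∑ i, ∑ j, x i j * inner ℂ (y i) (z j) =
      ∑ b, ∑ i, ∑ j, star (c b (Sum.inl i)) * x i j * c b (Sum.inr j) := by
    simp only [h1, Finset.mul_sum]
    rw [Finset.sum_comm' (t' := Finset.univ) (s' := fun _ => Finset.univ) (by simp)]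
    simp only [Finset.sum_comm (s := Finset.univ (α := Fin n)) (t := Finset.univ (α := Fin m))]
    rw [Finset.sum_congr rfl fun b _ => Finset.sum_comm]
    refine Finset.sum_congr rfl fun b _ => Finset.sum_congr rfl fun i _ =>
      Finset.sum_congr rfl fun j _ => ?_
    ring
  rw [h2]
  refine (_root_.norm_sum_le _ _).trans ?_
  refine (Finset.sum_le_sum fun b _ => CStarMatrix.norm_sum_le x _ _).trans ?_
  rw [← Finset.mul_sum]
  gcongr
  refine (Real.sum_sqrt_mul_sqrt_le _ (fun b => by positivity) (fun b => by positivity)).trans ?_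
  refine le_of_eq ?_
  congr 2
  · rw [Finset.sum_comm]
    exact Finset.sum_congr rfl fun i _ => (hn (Sum.inl i)).symm
  · rw [Finset.sum_comm]
    exact Finset.sum_congr rfl fun i _ => (hn (Sum.inr i)).symm

section
variable {A : Type*} [NonUnitalCStarAlgebra A]
  {K : Type*} [NormedAddCommGroup K] [InnerProductSpace ℂ K] [CompleteSpace K]
  (π : A →⋆ₙₐ[ℂ] (K →L[ℂ] K)) {n : ℕ} {σ : Type*} [Fintype σ]

theorem inner_map_star_mul (a b : A) (x y : K) :
    inner ℂ x (π (star a * b) y) = inner ℂ (π a x) (π b y) := by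
  rw [map_mul, map_star, ContinuousLinearMap.star_eq_adjoint, mul_apply_eq_comp,
    ContinuousLinearMap.adjoint_inner_right]

variable [PartialOrder A] [StarOrderedRing A]

/-- The completely positive map `a ↦ (∑ₛ ⟪f s i, π a (f s j)⟫)ᵢⱼ` defined by compressing a
representation to finitely many vectors. -/
noncomputable def compressionCP (f : σ → Fin n → K) : A →CP CStarMatrix (Fin n) (Fin n) ℂ where
  toFun a := fun i j => ∑ s, inner ℂ (f s i) (π a (f s j))
  map_add' a b := by
    ext i j
    change ∑ s, inner ℂ (f s i) (π (a + b) (f s j)) =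
      ∑ s, inner ℂ (f s i) (π a (f s j)) + ∑ s, inner ℂ (f s i) (π b (f s j))
    simp [Finset.sum_add_distrib]
  map_smul' c a := by
    ext i j
    change ∑ s, inner ℂ (f s i) (π (c • a) (f s j)) = c * ∑ s, inner ℂ (f s i) (π a (f s j))
    simp [Finset.mul_sum]
  map_cstarMatrix_nonneg' k M hM := by
    obtain ⟨N, hN⟩ := CStarMatrix.exists_gram_of_nonneg hM
    have hexp : ∀ sr : σ × Fin k, ∃ (m : ℕ) (c : Fin m → (Fin k × Fin n) → ℂ), ∀ i j,
        inner ℂ (π (N sr.2 i.1) (f sr.1 i.2)) (π (N sr.2 j.1) (f sr.1 j.2)) =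
          ∑ b, star (c b i) * c b j := fun sr =>
      exists_gram_expansion fun pi : Fin k × Fin n => π (N sr.2 pi.1) (f sr.1 pi.2)
    choose m c hc using hexp
    rcases isEmpty_or_nonempty (Fin n) with hn | ⟨⟨i₀⟩⟩
    · exact le_of_eq (by ext p q i; exact hn.elim i)
    let Z : (Σ sr : σ × Fin k, Fin (m sr)) → Fin k → CStarMatrix (Fin n) (Fin n) ℂ :=
      fun b p i j => if i = i₀ then c b.1 b.2 (p, j) else 0
    refine CStarMatrix.sum_gram_nonneg _ Z fun p q => ?_
    ext i j
    rw [CStarMatrix.sum_apply']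
    have h1 : ∀ b, (star (Z b p) * Z b q) i j = star (c b.1 b.2 (p, i)) * c b.1 b.2 (q, j) := by
      intro b
      rw [CStarMatrix.mul_apply, Finset.sum_eq_single i₀]
      · rw [CStarMatrix.star_apply]
        simp [Z]
      · intro r _ hr
        simp [Z, hr]
      · simp
    rw [Finset.sum_congr rfl fun b _ => h1 b, Fintype.sum_sigma]
    rw [Finset.sum_congr rfl fun sr _ => (hc sr (p, i) (q, j)).symm, Fintype.sum_prod_type]
    change ∑ s, inner ℂ (f s i) (π (M p q) (f s j)) = _
    simp only [hN, map_sum, sum_apply, inner_sum, inner_map_star_mul]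

theorem compressionCP_apply (f : σ → Fin n → K) (a : A) (i j : Fin n) :
    compressionCP π f a i j = ∑ s, inner ℂ (f s i) (π a (f s j)) := rfl

/-- If `c ↦ (∑ᵢ cᵢ f s i)ₛ` is a contraction, the compression is contractive. -/
theorem norm_compressionCP_le (f : σ → Fin n → K)
    (hf : ∀ c : Fin n → ℂ, ∑ s, ‖∑ i, c i • f s i‖ ^ 2 ≤ ∑ i, ‖c i‖ ^ 2) (a : A) :
    ‖compressionCP π f a‖ ≤ ‖a‖ := by
  refine CStarMatrix.norm_le_of_forall_sum_le _ (norm_nonneg _) fun c d => ?_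
  have h : ∑ i, ∑ j, star (c i) * compressionCP π f a i j * d j =
      ∑ s, inner ℂ (∑ i, c i • f s i) (π a (∑ i, d i • f s i)) := by
    simp only [compressionCP_apply, map_sum, map_smul, sum_inner, inner_sum, inner_smul_left,
      inner_smul_right, Finset.mul_sum, Finset.sum_mul]
    rw [Finset.sum_comm' (t' := Finset.univ) (s' := fun _ => Finset.univ) (by simp)]
    rw [Finset.sum_congr rfl fun i _ => Finset.sum_comm]
    rw [Finset.sum_comm]
    refine Finset.sum_congr rfl fun s _ => ?_
    refine Finset.sum_congr rfl fun i _ => Finset.sum_congr rfl fun j _ => ?_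
    simp only [Complex.star_def]
    ring
  rw [h]
  refine (norm_sum_le _ _).trans ?_
  calc ∑ s, ‖inner ℂ (∑ i, c i • f s i) (π a (∑ i, d i • f s i))‖
      ≤ ∑ s, ‖a‖ * (‖∑ i, c i • f s i‖ * ‖∑ i, d i • f s i‖) := by
        refine Finset.sum_le_sum fun s _ => (norm_inner_le_norm _ _).trans ?_
        calc _ ≤ ‖∑ i, c i • f s i‖ * (‖a‖ * ‖∑ i, d i • f s i‖) := by
              gcongr
              exact (ContinuousLinearMap.le_opNorm _ _).trans
                (by gcongr; exact NonUnitalStarAlgHom.norm_apply_le π a)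
          _ = _ := by ring
    _ = ‖a‖ * ∑ s, ‖∑ i, c i • f s i‖ * ‖∑ i, d i • f s i‖ := by rw [Finset.mul_sum]
    _ ≤ ‖a‖ * (√(∑ s, ‖∑ i, c i • f s i‖ ^ 2) * √(∑ s, ‖∑ i, d i • f s i‖ ^ 2)) := by
        gcongr
        exact Real.sum_mul_le_sqrt_mul_sqrt _ _ _
    _ ≤ _ := by
        gcongr
        · exact hf c
        · exact hf d

/-- The completely positive map `x ↦ ∑ₛ ∑ᵢⱼ xᵢⱼ u s i (u s j)⋆`. -/
noncomputable def expansionCP (u : σ → Fin n → A) : CStarMatrix (Fin n) (Fin n) ℂ →CP A where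
  toFun x := ∑ s, ∑ i, ∑ j, x i j • (u s i * star (u s j))
  map_add' x y := by simp [add_smul, Finset.sum_add_distrib]
  map_smul' c x := by simp [mul_smul, Finset.smul_sum]
  map_cstarMatrix_nonneg' k M hM := by
    obtain ⟨N, hN⟩ := CStarMatrix.exists_gram_of_nonneg hM
    refine CStarMatrix.sum_gram_nonneg (ι := σ × Fin k × Fin n) _
      (fun t p => ∑ j, N t.2.1 p t.2.2 j • star (u t.1 j)) fun p q => ?_
    have h1 : ∀ i j, M p q i j = ∑ r, ∑ l, star (N r p l i) * N r q l j := fun i j => by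
      rw [hN, CStarMatrix.sum_apply']
      exact Finset.sum_congr rfl fun r _ => by
        rw [CStarMatrix.mul_apply]; rfl
    change ∑ s, ∑ i, ∑ j, M p q i j • (u s i * star (u s j)) = _
    simp only [Fintype.sum_prod_type, star_sum, star_smul, star_star, Finset.sum_mul_sum,
      smul_mul_smul_comm, h1, Finset.sum_smul]
    refine Finset.sum_congr rfl fun s _ => ?_
    rw [Finset.sum_congr rfl fun i _ => Finset.sum_comm]
    rw [Finset.sum_comm]
    refine Finset.sum_congr rfl fun r _ => ?_
    rw [Finset.sum_congr rfl fun i _ => Finset.sum_comm]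
    rw [Finset.sum_comm]

theorem expansionCP_apply (u : σ → Fin n → A) (x : CStarMatrix (Fin n) (Fin n) ℂ) :
    expansionCP u x = ∑ s, ∑ i, ∑ j, x i j • (u s i * star (u s j)) := rfl

/-- If the row `(u s i)` is a contraction for a faithful representation, the expansion is
contractive. -/
theorem norm_expansionCP_le (hπ : Function.Injective π) (u : σ → Fin n → A)
    (hu : ∀ ζ : K, ∑ s, ∑ i, ‖π (star (u s i)) ζ‖ ^ 2 ≤ ‖ζ‖ ^ 2)
    (x : CStarMatrix (Fin n) (Fin n) ℂ) : ‖expansionCP u x‖ ≤ ‖x‖ := by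
  rw [← NonUnitalStarAlgHom.norm_map π hπ]
  refine ContinuousLinearMap.opNorm_le_of_re_inner_le (norm_nonneg _) fun ζ θ hζ hθ => ?_
  refine (RCLike.re_le_norm _).trans ?_
  rw [norm_inner_symm]
  have h : inner ℂ θ (π (expansionCP u x) ζ) =
      ∑ s, ∑ i, ∑ j, x i j * inner ℂ (π (star (u s i)) θ) (π (star (u s j)) ζ) := by
    simp only [expansionCP_apply, map_sum, map_smul, sum_apply, smul_apply, inner_sum,
      inner_smul_right, ← inner_map_star_mul, star_star]
  rw [h]
  refine (norm_sum_le _ _).trans ?_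
  refine (Finset.sum_le_sum fun s _ => CStarMatrix.norm_sum_inner_le x _ _).trans ?_
  rw [← Finset.mul_sum]
  refine mul_le_of_le_one_right (norm_nonneg _) ?_
  refine (Real.sum_sqrt_mul_sqrt_le _ (fun b => by positivity) (fun b => by positivity)).trans ?_
  refine mul_le_one₀ ?_ (Real.sqrt_nonneg _) ?_
  · rw [Real.sqrt_le_one]
    simpa [hθ] using hu θ
  · rw [Real.sqrt_le_one]
    simpa [hζ] using hu ζ

end

/-! ### A partition of unity in the functional calculus of a positive contraction -/

/-- The piecewise linear function rising from `0` to `1` on `[i / r, (i + 1) / r]`. -/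
noncomputable def ramp (r i : ℕ) (t : ℝ) : ℝ := max 0 (min 1 (r * t - i))

/-- The hat function supported on `[i / r, (i + 2) / r]`. As a difference of ramps, its sum over
`i` telescopes. -/
noncomputable def hat (r i : ℕ) (t : ℝ) : ℝ := ramp r i t - ramp r (i + 1) t

theorem continuous_hat (r i : ℕ) : Continuous (hat r i) := by
  unfold hat ramp
  fun_prop

theorem hat_nonneg (r i : ℕ) (t : ℝ) : 0 ≤ hat r i t := by
  unfold hat ramp
  push_cast
  refine sub_nonneg.2 (max_le_max le_rfl (min_le_min le_rfl (by linarith)))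

theorem hat_zero (r i : ℕ) : hat r i 0 = 0 := by
  unfold hat ramp
  have h1 : ((r : ℝ) * 0 - i) ≤ 0 := by have : (0 : ℝ) ≤ i := by positivity
                                        linarith
  have h2 : ((r : ℝ) * 0 - ((i + 1 : ℕ) : ℝ)) ≤ 0 := by
    have : (0 : ℝ) ≤ ((i + 1 : ℕ) : ℝ) := by positivity
    linarith
  rw [max_eq_left ((min_le_right _ _).trans h1), max_eq_left ((min_le_right _ _).trans h2),
    sub_zero]

theorem sum_hat {r : ℕ} {t : ℝ} (h0 : 0 ≤ t) (h1 : t ≤ 1) :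
    ∑ i : Fin r, hat r i t = min 1 (r * t) := by
  rw [← Finset.sum_range fun i => hat r i t]
  have h2 : (r : ℝ) * t - r ≤ 0 := by nlinarith [(Nat.cast_nonneg r : (0 : ℝ) ≤ r)]
  have h3 : 0 ≤ (r : ℝ) * t := by positivity
  unfold hat
  rw [Finset.sum_range_sub' (fun i => ramp r i t)]
  unfold ramp
  rw [max_eq_left ((min_le_right _ _).trans h2), Nat.cast_zero, sub_zero, sub_zero,
    max_eq_right (le_min zero_le_one h3)]

/-- On the support of the `i`-th hat function, `t` is within `2 / r` of `i / r`. -/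
theorem hat_eq_zero_or {r : ℕ} (hr : 0 < r) (i : ℕ) (t : ℝ) :
    hat r i t = 0 ∨ |t - i / r| ≤ 2 / r := by
  have hr' : (0 : ℝ) < r := by exact_mod_cast hr
  by_cases h1 : (r : ℝ) * t < i
  · left
    unfold hat ramp
    push_cast
    rw [max_eq_left ((min_le_right _ _).trans (by linarith)),
      max_eq_left ((min_le_right _ _).trans (by linarith)), sub_zero]
  by_cases h2 : (i : ℝ) + 2 < r * t
  · left
    unfold hat ramp
    push_cast
    rw [min_eq_left (by linarith), min_eq_left (by linarith), sub_self]
  · right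
    push Not at h1 h2
    have : t - i / r = (r * t - i) / r := by field_simp
    rw [this, abs_div, abs_of_pos hr']
    gcongr
    rw [abs_le]
    constructor <;> linarith

theorem abs_hat_mul_pow_sub_le {r : ℕ} (i : Fin r) {t : ℝ} (h0 : 0 ≤ t)
    (h1 : t ≤ 1) (j : ℕ) :
    |t ^ j - ((i : ℕ) / r : ℝ) ^ j| * hat r i t ≤ 2 * j / r * hat r i t := by
  have hr : 0 < r := i.pos
  have hr' : (0 : ℝ) < r := by exact_mod_cast hr
  rcases hat_eq_zero_or hr i t with h | h
  · simp [h]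
  · have hi : ((i : ℕ) / r : ℝ) ≤ 1 := by
      rw [div_le_one hr']; exact_mod_cast i.2.le
    have hi0 : (0 : ℝ) ≤ ((i : ℕ) / r : ℝ) := by positivity
    refine mul_le_mul_of_nonneg_right ?_ (hat_nonneg _ _ _)
    refine (abs_pow_sub_pow_le ..).trans ?_
    have hm : max |t| |((i : ℕ) / r : ℝ)| ^ (j - 1) ≤ 1 := by
      refine pow_le_one₀ (by positivity) (max_le ?_ ?_)
      · rwa [abs_of_nonneg h0]
      · rwa [abs_of_nonneg hi0]
    calc |t - (i : ℕ) / r| * j * max |t| |((i : ℕ) / r : ℝ)| ^ (j - 1) ≤ 2 / r * j * 1 := by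
          gcongr
      _ = 2 * j / r := by ring

/-- For a positive contraction `a`, the powers of `a` are approximated by
`∑ᵢ ⟪ηᵢ, aʲ ηᵢ⟫ gᵢ²`, where the `gᵢ² ∈ C⋆(a)` are the hat functions of `a` and `ηᵢ` is a unit
vector in the range of `gᵢ` (zero if `gᵢ = 0`), hence an approximate eigenvector. The hat functions
sum to `1` only on `[1 / r, 1]`, which suffices because `tʲ` is small near `0` for `j ≥ 1`. -/
theorem exists_partition_approx {T : Type u} [NormedAddCommGroup T] [InnerProductSpace ℂ T]
    [CompleteSpace T] (a : T →L[ℂ] T) (ha : 0 ≤ a) (ha1 : ‖a‖ ≤ 1) {r : ℕ} (hr0 : 0 < r) :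
    ∃ (g : Fin r → (T →L[ℂ] T)) (η : Fin r → T),
      (∀ i, g i ∈ cstarGen {a}) ∧ (∀ i, IsSelfAdjoint (g i)) ∧ (∀ i, ‖η i‖ ≤ 1) ∧
      (∀ ζ, ∑ i, ‖g i ζ‖ ^ 2 ≤ ‖ζ‖ ^ 2) ∧
      ∀ j : ℕ, 1 ≤ j → ‖∑ i, (inner ℂ (η i) ((a ^ j) (η i)) : ℂ) • (g i * g i) - a ^ j‖ ≤
        (4 * j + 1) / r := by
  classical
  have hasa : IsSelfAdjoint a := ha.isSelfAdjoint
  have hspec : ∀ t ∈ spectrum ℝ a, 0 ≤ t ∧ t ≤ 1 := by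
    intro t ht
    exact ⟨spectrum_nonneg_of_nonneg ha ht,
      (le_abs_self t).trans ((spectrum.norm_le_norm_mul_of_mem ht).trans
        (mul_le_one₀ ha1 (norm_nonneg _) ContinuousLinearMap.norm_id_le))⟩
  have hsq : ∀ i : ℕ, Continuous fun t => √(hat r i t) := fun i =>
    (continuous_hat r i).sqrt
  let g : Fin r → (T →L[ℂ] T) := fun i => cfc (fun t => √(hat r i t)) a
  have hgg : ∀ i, g i * g i = cfc (hat r i) a := by
    intro i
    simp only [g]
    rw [← cfc_mul _ _ a (hsq i).continuousOn (hsq i).continuousOn]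
    exact cfc_congr fun t _ => Real.mul_self_sqrt (hat_nonneg r i t)
  have hgsa : ∀ i, IsSelfAdjoint (g i) := fun i => cfc_predicate _ _
  let η : Fin r → T := fun i =>
    if h : ∃ ζ, g i ζ ≠ 0 then ((‖g i h.choose‖⁻¹ : ℝ) : ℂ) • g i h.choose else 0
  refine ⟨g, η, ?_, hgsa, ?_, ?_, ?_⟩
  · intro i
    have h : g i = cfcₙ (fun t => √(hat r i t)) a :=
      (cfcₙ_eq_cfc (hsq i).continuousOn (by simp [hat_zero])).symm
    rw [h]
    have : IsClosed (cstarGen {a} : Set (T →L[ℂ] T)) := cstarGen_isClosed _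
    exact cfcₙ_mem _ (subset_cstarGen _ rfl)
  · intro i
    simp only [η]
    split_ifs with h
    · rw [norm_smul, Complex.norm_real, norm_inv, norm_norm,
        inv_mul_cancel₀ (norm_ne_zero_iff.2 h.choose_spec)]
    · simp
  · intro ζ
    have h1 : ∀ i, ‖g i ζ‖ ^ 2 = RCLike.re (inner ℂ ζ (cfc (hat r i) a ζ)) := by
      intro i
      rw [← hgg, mul_apply_eq_comp, ← ContinuousLinearMap.adjoint_inner_left,
        ← ContinuousLinearMap.star_eq_adjoint, (hgsa i).star_eq, inner_self_eq_norm_sq]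
    have h2 : ∑ i : Fin r, cfc (hat r i) a = cfc (∑ i : Fin r, hat r i) a :=
      (cfc_sum_univ (fun i : Fin r => hat r i) a fun i => (continuous_hat r i).continuousOn).symm
    have h3 : ‖cfc (∑ i : Fin r, hat r i) a‖ ≤ 1 := by
      refine norm_cfc_le zero_le_one fun t ht => ?_
      obtain ⟨h0, h1⟩ := hspec t ht
      rw [Finset.sum_apply, sum_hat h0 h1, Real.norm_eq_abs,
        abs_of_nonneg (le_min zero_le_one (by positivity))]
      exact min_le_left _ _
    simp only [h1]
    rw [← map_sum, ← inner_sum, ← sum_apply, h2]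
    refine (RCLike.re_le_norm _).trans ((norm_inner_le_norm _ _).trans ?_)
    calc _ ≤ ‖ζ‖ * (1 * ‖ζ‖) := by
          gcongr
          exact (ContinuousLinearMap.le_opNorm _ _).trans (by gcongr)
      _ = _ := by ring
  · intro j hj
    have hajc : cfc (fun t : ℝ => t ^ j) a = a ^ j := cfc_pow_id a j
    -- the scalars `⟪ηᵢ, aʲ ηᵢ⟫` are real and close to `(i / r) ^ j` unless `gᵢ = 0`
    have hs : ∀ i : Fin r, ∃ s : ℝ,
        (inner ℂ (η i) ((a ^ j) (η i)) : ℂ) • (g i * g i) = s • cfc (hat r i) a ∧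
          |s - ((i : ℕ) / r : ℝ) ^ j| ≤ 2 * j / r := by
      intro i
      have hr : (0 : ℝ) < r := by exact_mod_cast i.pos
      by_cases h : ∃ ζ, g i ζ ≠ 0
      · refine ⟨RCLike.re (inner ℂ (η i) ((a ^ j) (η i))), ?_, ?_⟩
        · have hre : ((RCLike.re (inner ℂ (η i) ((a ^ j) (η i))) : ℝ) : ℂ) =
              inner ℂ (η i) ((a ^ j) (η i)) := by
            refine Complex.conj_eq_iff_re.1 ?_
            rw [inner_conj_symm, ← ContinuousLinearMap.adjoint_inner_right,
              ← ContinuousLinearMap.star_eq_adjoint, (hasa.pow j).star_eq]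
          rw [hgg, ← hre]
          exact Complex.coe_smul _ _
        · set p : ℝ := ((i : ℕ) / r : ℝ) ^ j with hp
          set δ : ℝ := 2 * j / r with hδ
          have hδ0 : 0 ≤ δ := by positivity
          -- truncating `tʲ - p` to `[-δ, δ]` changes nothing on the support of the hat function,
          -- and bounds the norm
          let q : ℝ → ℝ := fun t => max (-δ) (min δ (t ^ j - p))
          have hq : Continuous q := by simp only [q]; fun_prop
          have hqn : ‖cfc q a‖ ≤ δ := by
            refine norm_cfc_le hδ0 fun t _ => ?_
            rw [Real.norm_eq_abs, abs_le]
            exact ⟨le_max_left _ _, max_le (by linarith) (min_le_left _ _)⟩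
          have hprod : cfc q a * g i = (a ^ j - (p : ℂ) • 1) * g i := by
            have h1 : a ^ j - (p : ℂ) • 1 = cfc (fun t : ℝ => t ^ j - p) a := by
              rw [cfc_sub (fun t : ℝ => t ^ j) (fun _ => p) a, hajc, cfc_const p a,
                Algebra.algebraMap_eq_smul_one]
              rfl
            rw [h1]
            simp only [g]
            rw [← cfc_mul q _ a hq.continuousOn (hsq i).continuousOn,
              ← cfc_mul _ _ a (by fun_prop) (hsq i).continuousOn]
            refine cfc_congr fun t ht => ?_
            obtain ⟨ht0, ht1⟩ := hspec t ht
            rcases (hat_nonneg r i t).eq_or_lt with hz | hz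
            · simp [← hz]
            · have hle := le_of_mul_le_mul_right (abs_hat_mul_pow_sub_le i ht0 ht1 j) hz
              rw [abs_le] at hle
              simp only [q]
              rw [min_eq_right hle.2, max_eq_right hle.1]
          have hη : η i = ((‖g i h.choose‖⁻¹ : ℝ) : ℂ) • g i h.choose := by
            simp only [η]; rw [dif_pos h]
          have hηn : ‖η i‖ = 1 := by
            rw [hη, norm_smul, Complex.norm_real, norm_inv, norm_norm,
              inv_mul_cancel₀ (norm_ne_zero_iff.2 h.choose_spec)]
          have hdiff : (a ^ j - (p : ℂ) • 1) (η i) = cfc q a (η i) := by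
            rw [hη, map_smul, map_smul, ← mul_apply_eq_comp, ← mul_apply_eq_comp, hprod]
          have hin : inner ℂ (η i) ((a ^ j) (η i)) - (p : ℂ) = inner ℂ (η i) (cfc q a (η i)) := by
            rw [← hdiff, sub_apply, inner_sub_right, smul_apply, one_apply_eq_self,
              inner_smul_right, inner_self_eq_norm_sq_to_K, hηn]
            simp
          calc |RCLike.re (inner ℂ (η i) ((a ^ j) (η i))) - p|
              = |RCLike.re (inner ℂ (η i) ((a ^ j) (η i)) - (p : ℂ))| := by
                rw [map_sub]; rfl
            _ ≤ ‖inner ℂ (η i) (cfc q a (η i))‖ := by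
                rw [hin]; exact RCLike.abs_re_le_norm _
            _ ≤ ‖η i‖ * (δ * ‖η i‖) := by
                refine (norm_inner_le_norm _ _).trans ?_
                gcongr
                exact (ContinuousLinearMap.le_opNorm _ _).trans (by gcongr)
            _ = δ := by rw [hηn]; ring
      · refine ⟨((i : ℕ) / r : ℝ) ^ j, ?_, ?_⟩
        · have hg0 : g i = 0 := by
            push Not at h
            exact ContinuousLinearMap.ext h
          rw [← hgg, hg0, mul_zero, smul_zero, smul_zero]
        · rw [sub_self, abs_zero]; positivity
    choose s hs1 hs2 using hs
    have hsum : ∑ i, (inner ℂ (η i) ((a ^ j) (η i)) : ℂ) • (g i * g i) - a ^ j =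
        cfc (fun t => (∑ i : Fin r, fun t => s i * hat r i t) t - t ^ j) a := by
      have hc : ∀ i : Fin r, Continuous fun t => s i * hat r i t := fun i =>
        (continuous_hat r i).const_mul (s i)
      have hcs : Continuous (∑ i : Fin r, fun t => s i * hat r i t) := by
        have : (∑ i : Fin r, fun t => s i * hat r i t) = fun t => ∑ i : Fin r, s i * hat r i t := by
          ext t; simp
        rw [this]
        exact continuous_finsetSum _ fun i _ => hc i
      rw [cfc_sub _ (fun t : ℝ => t ^ j) a hcs.continuousOn (by fun_prop),
        cfc_sum_univ (fun i : Fin r => fun t => s i * hat r i t) a fun i => (hc i).continuousOn,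
        hajc]
      congr 1
      refine Finset.sum_congr rfl fun i _ => ?_
      rw [hs1, cfc_const_mul _ _ a (continuous_hat r i).continuousOn]
    rw [hsum]
    refine norm_cfc_le (by positivity) fun t ht => ?_
    obtain ⟨h0, h1⟩ := hspec t ht
    have hr : (0 : ℝ) < r := by exact_mod_cast hr0
    have hS := sum_hat (r := r) h0 h1
    have hS1 : ∑ i : Fin r, hat r i t ≤ 1 := hS ▸ min_le_left _ _
    -- with `pᵢ = (i / r)ʲ`: errors from `sᵢ ≈ pᵢ`, from `tʲ ≈ pᵢ` on the support of the `i`-th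
    -- hat function, and from the interval near `0` where the hat functions sum to less than `1`
    have hdec : (∑ i : Fin r, fun t => s i * hat r i t) t - t ^ j =
        ∑ i : Fin r, (s i - ((i : ℕ) / r : ℝ) ^ j) * hat r i t -
        ∑ i : Fin r, (t ^ j - ((i : ℕ) / r : ℝ) ^ j) * hat r i t -
        t ^ j * (1 - ∑ i : Fin r, hat r i t) := by
      simp only [Finset.sum_apply, sub_mul, Finset.sum_sub_distrib, mul_sub, Finset.mul_sum]
      ring
    have hb1 : |∑ i : Fin r, (s i - ((i : ℕ) / r : ℝ) ^ j) * hat r i t| ≤ 2 * j / r := by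
      calc _ ≤ ∑ i : Fin r, 2 * j / r * hat r i t := by
            refine (Finset.abs_sum_le_sum_abs _ _).trans (Finset.sum_le_sum fun i _ => ?_)
            rw [abs_mul, abs_of_nonneg (hat_nonneg r i t)]
            exact mul_le_mul_of_nonneg_right (hs2 i) (hat_nonneg r i t)
        _ ≤ 2 * j / r * 1 := by rw [← Finset.mul_sum]; gcongr
        _ = _ := mul_one _
    have hb2 : |∑ i : Fin r, (t ^ j - ((i : ℕ) / r : ℝ) ^ j) * hat r i t| ≤ 2 * j / r := by
      calc _ ≤ ∑ i : Fin r, 2 * j / r * hat r i t := by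
            refine (Finset.abs_sum_le_sum_abs _ _).trans (Finset.sum_le_sum fun i _ => ?_)
            rw [abs_mul, abs_of_nonneg (hat_nonneg r i t)]
            exact abs_hat_mul_pow_sub_le i h0 h1 j
        _ ≤ 2 * j / r * 1 := by rw [← Finset.mul_sum]; gcongr
        _ = _ := mul_one _
    have hb3 : |t ^ j * (1 - ∑ i : Fin r, hat r i t)| ≤ 1 / r := by
      rw [hS]
      rcases le_total 1 (r * t) with h | h
      · rw [min_eq_left h, sub_self, mul_zero, abs_zero]; positivity
      · rw [min_eq_right h, abs_mul, abs_of_nonneg (pow_nonneg h0 j),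
          abs_of_nonneg (by linarith)]
        have h2 : t ^ j ≤ t := pow_le_of_le_one h0 h1 (by lia)
        have h3 : t ≤ 1 / r := by rw [le_div_iff₀ hr]; linarith
        have h4 : 0 ≤ (r : ℝ) * t := by positivity
        calc t ^ j * (1 - r * t) ≤ 1 / r * 1 := by
              gcongr
              · exact h2.trans h3
              · linarith
          _ = _ := mul_one _
    rw [hdec, Real.norm_eq_abs]
    refine (abs_sub _ _).trans ((add_le_add (abs_sub _ _) le_rfl).trans ?_)
    refine (add_le_add (add_le_add hb1 hb2) hb3).trans (le_of_eq ?_)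
    ring

/-! ### Nuclearity -/

theorem adjoin_singleton_le_span {B : Type u} [CStarAlgebra B] {a : B} (ha : IsSelfAdjoint a) :
    (NonUnitalStarAlgebra.adjoin ℂ {a} : Set B) ⊆
      Submodule.span ℂ (Set.range fun j : ℕ => a ^ (j + 1)) := by
  intro b hb
  induction hb using NonUnitalStarAlgebra.adjoin_induction with
  | mem x hx =>
    obtain rfl : x = a := hx
    exact Submodule.subset_span ⟨0, by simp⟩
  | add x y _ _ hx hy => exact add_mem hx hy
  | zero => exact zero_mem _
  | mul x y _ _ hx hy =>
    refine Submodule.span_induction₂ (p := fun x y _ _ => x * y ∈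
      Submodule.span ℂ (Set.range fun j : ℕ => a ^ (j + 1))) ?_ ?_ ?_ ?_ ?_ ?_ ?_ hx hy
    · rintro _ _ ⟨i, rfl⟩ ⟨j, rfl⟩
      refine Submodule.subset_span ⟨i + j + 1, ?_⟩
      simp only [← pow_add]
      congr 1
      ring
    · intro y _; rw [zero_mul]; exact zero_mem _
    · intro y _; rw [mul_zero]; exact zero_mem _
    · intro x y z _ _ _ h1 h2; rw [add_mul]; exact add_mem h1 h2
    · intro x y z _ _ _ h1 h2; rw [mul_add]; exact add_mem h1 h2
    · intro c x y _ _ h; rw [smul_mul_assoc]; exact Submodule.smul_mem _ c h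
    · intro c x y _ _ h; rw [mul_smul_comm]; exact Submodule.smul_mem _ c h
  | smul r x _ hx => exact Submodule.smul_mem _ r hx
  | star x hx' hx =>
    clear hx'
    induction hx using Submodule.span_induction with
    | mem x hx =>
      obtain ⟨j, rfl⟩ := hx
      refine Submodule.subset_span ⟨j, ?_⟩
      exact (ha.pow (j + 1)).star_eq.symm
    | zero => rw [star_zero]; exact zero_mem _
    | add x y _ _ hx hy => rw [star_add]; exact add_mem hx hy
    | smul c x _ hx => rw [star_smul]; exact Submodule.smul_mem _ _ hx

/-- Only positive powers occur, as the generated algebra is non-unital. -/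
theorem cstarGen_singleton_subset_closure_span {B : Type u} [CStarAlgebra B] {a : B}
    (ha : IsSelfAdjoint a) :
    (cstarGen {a} : Set B) ⊆
      closure (Submodule.span ℂ (Set.range fun j : ℕ => a ^ (j + 1)) : Set B) :=
  closure_mono (adjoin_singleton_le_span ha)

theorem sum_eq_sum_of_block {r d : ℕ} {E : Type*} [AddCommMonoid E]
    (ι : Fin r × Fin d ≃ Fin (r * d)) (s : Fin r) (G : Fin (r * d) → E)
    (hG : ∀ i, (ι.symm i).1 ≠ s → G i = 0) :
    ∑ i, G i = ∑ w, G (ι (s, w)) := by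
  rw [← ι.sum_comp, Fintype.sum_prod_type, Finset.sum_eq_single s]
  · intro s' _ hs'
    exact Finset.sum_eq_zero fun w _ => hG _ (by simpa using hs')
  · simp

namespace HilbertFactor

variable {V : Type v} {T K : Type u} [NormedAddCommGroup V] [InnerProductSpace ℂ V]
  [NormedAddCommGroup T] [InnerProductSpace ℂ T] [NormedAddCommGroup K]
  [InnerProductSpace ℂ K] (f : HilbertFactor V T K) [CompleteSpace T] [CompleteSpace K]

theorem sum_norm_adjoint_J {ι : Type*} [Fintype ι] (e : OrthonormalBasis ι ℂ V) (ζ : K) :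
    ∑ i, ‖ContinuousLinearMap.adjoint (f.J (e i)) ζ‖ ^ 2 = ‖ζ‖ ^ 2 := by
  have h := congrArg (fun X : K →L[ℂ] K => RCLike.re (inner ℂ ζ (X ζ))) (f.sum_J_adjoint_J e)
  simp only [sum_apply, inner_sum, ContinuousLinearMap.comp_apply, one_apply_eq_self, map_sum,
    inner_self_eq_norm_sq] at h
  rw [← h]
  refine Finset.sum_congr rfl fun i _ => ?_
  rw [← ContinuousLinearMap.adjoint_inner_left, inner_self_eq_norm_sq]

variable [FiniteDimensional ℂ V]

theorem exists_norm_op_le (S : V →L[ℂ] V) : ∃ C : ℝ, 0 ≤ C ∧ ∀ b, ‖f.op S b‖ ≤ C * ‖b‖ := by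
  refine ⟨∑ i, ‖f.J (S (stdOrthonormalBasis ℂ V i))‖ *
    ‖ContinuousLinearMap.adjoint (f.J (stdOrthonormalBasis ℂ V i))‖, by positivity, fun b => ?_⟩
  rw [Finset.sum_mul]
  refine (norm_sum_le _ _).trans (Finset.sum_le_sum fun i _ => ?_)
  calc _ ≤ ‖f.J (S (stdOrthonormalBasis ℂ V i))‖ * (‖b‖ *
        ‖ContinuousLinearMap.adjoint (f.J (stdOrthonormalBasis ℂ V i))‖) :=
        (ContinuousLinearMap.opNorm_comp_le _ _).trans
          (by gcongr; exact ContinuousLinearMap.opNorm_comp_le _ _)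
    _ = _ := by ring

/-- The approximation of `S ⊗ aʲ` through matrix algebras: compress to the vectors `e ⊗ ηᵢ`, then
expand along the elements `gᵢ²` of the partition of unity in `C⋆(a)`. The bound is uniform in `S` up
to the norm of `b ↦ S ⊗ b`, and one pair of maps serves all `S` and `j`. -/
theorem exists_cp_approx (a : T →L[ℂ] T) (ha : 0 ≤ a) (ha1 : ‖a‖ ≤ 1) (hV : ∃ v : V, ‖v‖ = 1)
    {C : Type*} [NonUnitalCStarAlgebra C] [PartialOrder C] [StarOrderedRing C]
    (π : C →⋆ₙₐ[ℂ] (K →L[ℂ] K)) (hπ : Function.Injective π)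
    (hrange : ∀ X ∈ f.matAlgebra (cstarGen {a}), ∃ x, π x = X) {r : ℕ} (hr : 0 < r) :
    ∃ (n : ℕ) (φ : C →CP CStarMatrix (Fin n) (Fin n) ℂ) (ψ : CStarMatrix (Fin n) (Fin n) ℂ →CP C),
      (∀ x, ‖φ x‖ ≤ ‖x‖) ∧ (∀ x, ‖ψ x‖ ≤ ‖x‖) ∧
      ∀ (S : V →L[ℂ] V) (B : ℝ), 0 ≤ B → (∀ b, ‖f.op S b‖ ≤ B * ‖b‖) → ∀ j : ℕ, 1 ≤ j → ∀ x,
        π x = f.op S (a ^ j) → ‖ψ (φ x) - x‖ ≤ B * ((4 * j + 1) / r) := by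
  obtain ⟨g, η, hgmem, hgsa, hη, hgsum, hgη⟩ := exists_partition_approx a ha ha1 hr
  obtain ⟨v₀, hv₀⟩ := hV
  set d := Module.finrank ℂ V with hd
  let e : OrthonormalBasis (Fin d) ℂ V := stdOrthonormalBasis ℂ V
  let ι : Fin r × Fin d ≃ Fin (r * d) := finProdFinEquiv
  -- `U s w = |e w⟩⟨v₀| ⊗ gₛ`, so that `U s w (U s w')⋆ = |e w⟩⟨e w'| ⊗ gₛ²`
  have hU : ∀ s w, ∃ x, π x = f.op (InnerProductSpace.rankOne ℂ (e w) v₀) (g s) := fun s w =>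
    hrange _ (f.op_mem_matAlgebra _ (hgmem s))
  choose U hU using hU
  -- the `r` blocks of size `d` are placed along the diagonal of one matrix of size `r * d`
  let F : Fin r → Fin (r * d) → K := fun s i =>
    if (ι.symm i).1 = s then f.J (e (ι.symm i).2) (η s) else 0
  let u : Fin r → Fin (r * d) → C := fun s i =>
    if (ι.symm i).1 = s then U s (ι.symm i).2 else 0
  have hFι : ∀ s w, F s (ι (s, w)) = f.J (e w) (η s) := fun s w => by simp [F]
  have huι : ∀ s w, u s (ι (s, w)) = U s w := fun s w => by simp [u]
  have hF0 : ∀ s i, (ι.symm i).1 ≠ s → F s i = 0 := fun s i h => by simp [F, h]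
  have hu0 : ∀ s i, (ι.symm i).1 ≠ s → u s i = 0 := fun s i h => by simp [u, h]
  refine ⟨r * d, compressionCP π F, expansionCP u, norm_compressionCP_le π F ?_,
    norm_expansionCP_le π hπ u ?_, ?_⟩
  · intro c
    have h1 : ∀ s, ‖∑ i, c i • F s i‖ ^ 2 ≤ ∑ w, ‖c (ι (s, w))‖ ^ 2 := by
      intro s
      rw [sum_eq_sum_of_block ι s _ fun i hi => by rw [hF0 s i hi, smul_zero]]
      have h2 : ∑ w, c (ι (s, w)) • F s (ι (s, w)) = f.J (∑ w, c (ι (s, w)) • e w) (η s) := by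
        simp [hFι]
      rw [h2, f.norm_J, mul_pow]
      have h3 : ‖∑ w, c (ι (s, w)) • e w‖ ^ 2 = ∑ w, ‖c (ι (s, w))‖ ^ 2 := by
        rw [← e.sum_sq_norm_inner_right]
        refine Finset.sum_congr rfl fun w _ => ?_
        rw [e.orthonormal.inner_right_fintype]
      rw [h3]
      refine mul_le_of_le_one_right (by positivity) ?_
      exact pow_le_one₀ (norm_nonneg _) (hη s)
    refine (Finset.sum_le_sum fun s _ => h1 s).trans (le_of_eq ?_)
    rw [← Fintype.sum_prod_type', ι.sum_comp fun i => ‖c i‖ ^ 2]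
  · intro ζ
    have h1 : ∀ s w, ‖π (star (U s w)) ζ‖ =
        ‖g s (ContinuousLinearMap.adjoint (f.J (e w)) ζ)‖ := by
      intro s w
      have h2 : π (star (U s w)) = f.J v₀ ∘L g s ∘L ContinuousLinearMap.adjoint (f.J (e w)) := by
        rw [map_star, hU, f.op_rankOne, ContinuousLinearMap.star_eq_adjoint,
          ContinuousLinearMap.adjoint_comp, ContinuousLinearMap.adjoint_comp,
          ContinuousLinearMap.adjoint_adjoint, ← ContinuousLinearMap.star_eq_adjoint (g s),
          (hgsa s).star_eq, ContinuousLinearMap.comp_assoc]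
      rw [h2, ContinuousLinearMap.comp_apply, ContinuousLinearMap.comp_apply, f.norm_J, hv₀,
        one_mul]
    have h3 : ∀ s, ∑ i, ‖π (star (u s i)) ζ‖ ^ 2 =
        ∑ w, ‖g s (ContinuousLinearMap.adjoint (f.J (e w)) ζ)‖ ^ 2 := by
      intro s
      rw [sum_eq_sum_of_block ι s _ fun i hi => by rw [hu0 s i hi]; simp]
      exact Finset.sum_congr rfl fun w _ => by rw [huι, h1]
    rw [Finset.sum_congr rfl fun s _ => h3 s, Finset.sum_comm, ← f.sum_norm_adjoint_J e ζ]
    exact Finset.sum_le_sum fun w _ => hgsum _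
  · intro S B hB0 hB j hj x hx
    have hφ : ∀ s w w', compressionCP π F x (ι (s, w)) (ι (s, w')) =
        inner ℂ (e w) (S (e w')) * inner ℂ (η s) ((a ^ j) (η s)) := by
      intro s w w'
      rw [compressionCP_apply, Finset.sum_eq_single s]
      · rw [hFι, hFι, hx, op_J, f.inner_J]
      · intro s' _ hs'
        rw [hF0 s' (ι (s, w)) (by simpa using hs'.symm), inner_zero_left]
      · simp
    have hUU : ∀ s w w', π (U s w * star (U s w')) =
        f.op (InnerProductSpace.rankOne ℂ (e w) (e w')) (g s * g s) := by
      intro s w w'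
      have := FiniteDimensional.complete ℂ V
      have hr1 : star (InnerProductSpace.rankOne ℂ (e w') v₀) =
          InnerProductSpace.rankOne ℂ v₀ (e w') := by
        rw [ContinuousLinearMap.star_eq_adjoint, InnerProductSpace.adjoint_rankOne]
      rw [map_mul, map_star, hU, hU, f.star_op, f.op_mul_op, (hgsa s).star_eq, hr1]
      congr 1
      ext y
      simp [hv₀]
    have hψ : π (expansionCP u (compressionCP π F x)) =
        f.op S (∑ s, (inner ℂ (η s) ((a ^ j) (η s)) : ℂ) • (g s * g s)) := by
      rw [expansionCP_apply, map_sum, ← f.opBilin_apply, map_sum]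
      refine Finset.sum_congr rfl fun s _ => ?_
      rw [sum_eq_sum_of_block ι s _ fun i hi => by simp [hu0 s i hi], map_sum]
      conv_rhs => rw [← sum_inner_smul_rankOne e S]
      simp only [map_sum, map_smul, LinearMap.sum_apply, LinearMap.smul_apply, opBilin_apply]
      rw [Finset.smul_sum]
      refine Finset.sum_congr rfl fun w _ => ?_
      rw [sum_eq_sum_of_block ι s _ fun i hi => by simp [hu0 s i hi], Finset.smul_sum]
      refine Finset.sum_congr rfl fun w' _ => ?_
      rw [huι, huι, hUU, hφ, smul_smul, mul_comm]
    rw [← NonUnitalStarAlgHom.norm_map π hπ, map_sub, hψ, hx, ← f.opBilin_apply,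
      ← f.opBilin_apply, ← map_sub, f.opBilin_apply]
    exact (hB _).trans (by gcongr; exact hgη j hj)

/-- The completely positive approximation property along `𝓑(V) ⊗ C⋆(a)`. -/
theorem exists_cp_approx_finset (a : T →L[ℂ] T) (ha : 0 ≤ a) (ha1 : ‖a‖ ≤ 1)
    (hV : ∃ v : V, ‖v‖ = 1)
    {C : Type*} [NonUnitalCStarAlgebra C] [PartialOrder C] [StarOrderedRing C]
    (π : C →⋆ₙₐ[ℂ] (K →L[ℂ] K)) (hπ : Function.Injective π)
    (hrange : ∀ X ∈ f.matAlgebra (cstarGen {a}), ∃ x, π x = X) (F : Finset C)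
    (hF : ∀ x ∈ F, π x ∈ f.matAlgebra (cstarGen {a})) {ε : ℝ} (hε : 0 < ε) :
    ∃ (n : ℕ) (φ : C →CP CStarMatrix (Fin n) (Fin n) ℂ) (ψ : CStarMatrix (Fin n) (Fin n) ℂ →CP C),
      (∀ x, ‖φ x‖ ≤ ‖x‖) ∧ (∀ x, ‖ψ x‖ ≤ ‖x‖) ∧ ∀ x ∈ F, ‖ψ (φ x) - x‖ < ε := by
  choose n φ ψ hφ hψ happ using fun r : ℕ =>
    f.exists_cp_approx a ha ha1 hV π hπ hrange (Nat.succ_pos r)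
  -- the elements on which the approximations converge form a closed subspace
  let Z : Submodule ℂ C :=
    { carrier := {x | Tendsto (fun r => ψ r (φ r x)) atTop (𝓝 x)}
      add_mem' := fun {x y} hx hy => by
        have := Tendsto.add hx hy
        simpa [map_add] using this
      zero_mem' := by simp
      smul_mem' := fun c x hx => by
        have := Tendsto.const_smul hx c
        simpa [map_smul] using this }
  have hZ : ∀ x, x ∈ Z ↔ Tendsto (fun r => ψ r (φ r x)) atTop (𝓝 x) := fun x => Iff.rfl
  have hcl : ∀ x, (∀ δ > 0, ∃ y ∈ Z, ‖x - y‖ < δ) → x ∈ Z := by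
    intro x hx
    rw [hZ, Metric.tendsto_atTop]
    intro δ hδ
    obtain ⟨y, hy, hxy⟩ := hx (δ / 3) (by positivity)
    obtain ⟨R, hR⟩ := Metric.tendsto_atTop.1 ((hZ y).1 hy) (δ / 3) (by positivity)
    refine ⟨R, fun r hr => ?_⟩
    have h1 := hR r hr
    rw [dist_eq_norm] at h1 ⊢
    have h2 : ψ r (φ r x) - x = ψ r (φ r (x - y)) + (ψ r (φ r y) - y) - (x - y) := by
      rw [map_sub, map_sub]; abel
    rw [h2]
    calc _ ≤ ‖ψ r (φ r (x - y))‖ + ‖ψ r (φ r y) - y‖ + ‖x - y‖ :=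
          (norm_sub_le _ _).trans (by gcongr; exact norm_add_le _ _)
      _ < δ / 3 + δ / 3 + δ / 3 := by
          gcongr
          exact ((hψ r _).trans (hφ r _)).trans_lt hxy
      _ = δ := by ring
  have hpow : ∀ (S : V →L[ℂ] V) (j : ℕ) x, π x = f.op S (a ^ (j + 1)) → x ∈ Z := by
    intro S j x hx
    obtain ⟨B, hB0, hB⟩ := f.exists_norm_op_le S
    rw [hZ, tendsto_iff_norm_sub_tendsto_zero]
    refine squeeze_zero (fun _ => norm_nonneg _)
      (fun r => happ r S B hB0 hB (j + 1) (by lia) x hx) ?_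
    have h := (tendsto_one_div_add_atTop_nhds_zero_nat (𝕜 := ℝ)).const_mul
      (B * (4 * ((j + 1 : ℕ) : ℝ) + 1))
    rw [mul_zero] at h
    refine h.congr fun r => ?_
    push_cast
    ring
  have hspan : ∀ (S : V →L[ℂ] V), ∀ b ∈ Submodule.span ℂ (Set.range fun j : ℕ => a ^ (j + 1)),
      ∃ x ∈ Z, π x = f.op S b := by
    intro S b hb
    induction hb using Submodule.span_induction with
    | mem b hb =>
      obtain ⟨j, rfl⟩ := hb
      obtain ⟨x, hx⟩ := hrange (f.op S (a ^ (j + 1))) (f.op_mem_matAlgebra S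
        (by
          have : ∀ j : ℕ, a ^ (j + 1) ∈ cstarGen {a} := fun j => by
            induction j with
            | zero => simpa using subset_cstarGen {a} rfl
            | succ j ih => rw [pow_succ]; exact mul_mem ih (subset_cstarGen {a} rfl)
          exact this j))
      exact ⟨x, hpow S j x hx, hx⟩
    | zero => exact ⟨0, zero_mem _, by rw [map_zero, ← f.opBilin_apply, map_zero]⟩
    | add b c _ _ hb hc =>
      obtain ⟨x, hx, hx'⟩ := hb
      obtain ⟨y, hy, hy'⟩ := hc
      exact ⟨x + y, add_mem hx hy, by rw [map_add, hx', hy', f.op_add_right]⟩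
    | smul c b _ hb =>
      obtain ⟨x, hx, hx'⟩ := hb
      exact ⟨c • x, Submodule.smul_mem _ c hx, by rw [map_smul, hx', f.op_smul_right]⟩
  have hop : ∀ (S : V →L[ℂ] V), ∀ b ∈ cstarGen {a}, ∀ x, π x = f.op S b → x ∈ Z := by
    intro S b hb x hx
    obtain ⟨B, hB0, hB⟩ := f.exists_norm_op_le S
    refine hcl x fun δ hδ => ?_
    obtain ⟨c, hc, hbc⟩ := Metric.mem_closure_iff.1
      (cstarGen_singleton_subset_closure_span ha.isSelfAdjoint hb) (δ / (B + 1)) (by positivity)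
    obtain ⟨y, hy, hy'⟩ := hspan S c hc
    refine ⟨y, hy, ?_⟩
    rw [← NonUnitalStarAlgHom.norm_map π hπ, map_sub, hx, hy', ← f.opBilin_apply,
      ← f.opBilin_apply, ← map_sub, f.opBilin_apply]
    rw [dist_eq_norm, lt_div_iff₀ (by positivity)] at hbc
    calc _ ≤ B * ‖b - c‖ := hB _
      _ ≤ ‖b - c‖ * (B + 1) := by nlinarith [norm_nonneg (b - c)]
      _ < δ := hbc
  have hall : ∀ x ∈ F, x ∈ Z := by
    intro x hx
    have hx' := hF x hx
    have h1 : ∀ i j, ∃ y, π y = f.op (InnerProductSpace.rankOne ℂ (stdOrthonormalBasis ℂ V i)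
        (stdOrthonormalBasis ℂ V j)) (f.entry (stdOrthonormalBasis ℂ V i)
        (stdOrthonormalBasis ℂ V j) (π x)) := fun i j =>
      hrange _ (f.op_mem_matAlgebra _ (hx' _ _))
    choose y hy using h1
    have h2 : x = ∑ i, ∑ j, y i j := by
      refine hπ ?_
      simp only [map_sum, hy]
      exact (f.sum_op_entry _ _).symm
    rw [h2]
    exact sum_mem fun i _ => sum_mem fun j _ => hop _ _ (hx' _ _) _ (hy i j)
  have hev : ∀ᶠ r in atTop, ∀ x ∈ F, ‖ψ r (φ r x) - x‖ < ε := by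
    rw [Filter.eventually_all_finset]
    intro x hx
    filter_upwards [Metric.tendsto_nhds.1 ((hZ x).1 (hall x hx)) ε hε] with r hr
    rwa [dist_eq_norm] at hr
  obtain ⟨r, hr⟩ := hev.exists
  exact ⟨n r, φ r, ψ r, hφ r, hψ r, hr⟩

end HilbertFactor

/-- The completely positive approximation property passes to closures of increasing unions. -/
theorem isNuclearCStar_of_dense {A : Type u} [NonUnitalCStarAlgebra A] (Z : ℕ → Set A)
    (hmono : Monotone Z) (hdense : Dense (⋃ k, Z k))
    (h : letI : PartialOrder A := CStarAlgebra.spectralOrder A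
      haveI : StarOrderedRing A := CStarAlgebra.spectralOrderedRing A
      ∀ k, ∀ F : Finset A, (∀ x ∈ F, x ∈ Z k) → ∀ ε : ℝ, 0 < ε →
      ∃ (n : ℕ) (φ : A →CP CStarMatrix (Fin n) (Fin n) ℂ)
        (ψ : CStarMatrix (Fin n) (Fin n) ℂ →CP A),
        (∀ x, ‖φ x‖ ≤ ‖x‖) ∧ (∀ x, ‖ψ x‖ ≤ ‖x‖) ∧ ∀ x ∈ F, ‖ψ (φ x) - x‖ < ε) :
    IsNuclearCStar A := by
  classical
  intro F ε hε
  have h1 : ∀ x, ∃ y, ∃ k, y ∈ Z k ∧ ‖x - y‖ < ε / 3 := by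
    intro x
    obtain ⟨y, hy, hxy⟩ := Metric.mem_closure_iff.1 (hdense x) (ε / 3) (by positivity)
    obtain ⟨k, hk⟩ := Set.mem_iUnion.1 hy
    exact ⟨y, k, hk, by rwa [dist_eq_norm] at hxy⟩
  choose y k hk hxy using h1
  obtain ⟨n, φ, ψ, hφ, hψ, happ⟩ := h (F.sup k) (F.image y) (fun x hx => by
    obtain ⟨z, hz, rfl⟩ := Finset.mem_image.1 hx
    exact hmono (Finset.le_sup hz) (hk z)) (ε / 3) (by positivity)
  refine ⟨n, φ, ψ, hφ, hψ, fun x hx => ?_⟩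
  have h2 := happ (y x) (Finset.mem_image_of_mem y hx)
  have h3 : ψ (φ x) - x = ψ (φ (x - y x)) + (ψ (φ (y x)) - y x) - (x - y x) := by
    rw [map_sub, map_sub]; abel
  rw [h3]
  calc _ ≤ ‖ψ (φ (x - y x))‖ + ‖ψ (φ (y x)) - y x‖ + ‖x - y x‖ :=
        (norm_sub_le _ _).trans (by gcongr; exact norm_add_le _ _)
    _ < ε / 3 + ε / 3 + ε / 3 := by
        gcongr
        · exact ((hψ _).trans (hφ _)).trans_lt (hxy x)
        · exact hxy x
    _ = ε := by ring

/-! ### Operators on finite tensor products -/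

section
variable {H : ℕ → Type u} [∀ n, NormedAddCommGroup (H n)] [∀ n, InnerProductSpace ℂ (H n)]

instance finTensor_finiteDimensional [∀ n, FiniteDimensional ℂ (H n)] (n : ℕ) :
    FiniteDimensional ℂ (FinTensor H n) := by
  induction n with
  | zero => exact inferInstanceAs (FiniteDimensional ℂ (H 0))
  | succ n ih => exact inferInstanceAs (FiniteDimensional ℂ (FinTensor H n ⊗[ℂ] H (n + 1)))

instance finTensor_completeSpace [∀ n, FiniteDimensional ℂ (H n)] (n : ℕ) :
    CompleteSpace (FinTensor H n) := FiniteDimensional.complete ℂ _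

theorem finrank_finTensor [∀ n, FiniteDimensional ℂ (H n)] (n : ℕ) :
    Module.finrank ℂ (FinTensor H n) = ∏ i ∈ Finset.range (n + 1), Module.finrank ℂ (H i) := by
  induction n with
  | zero => simpa using (finTensorZero H).toLinearEquiv.finrank_eq.symm
  | succ n ih =>
    rw [Finset.prod_range_succ, ← ih, ← (finTensorSucc H n).toLinearEquiv.finrank_eq,
      Module.finrank_tensorProduct]

/-- Induction along `FinTensor H n ⊗ H (n + 1)`. -/
theorem finTensor_induction {n : ℕ} {p : FinTensor H (n + 1) → Prop} (x : FinTensor H (n + 1))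
    (zero : p 0) (add : ∀ x y, p x → p y → p (x + y))
    (tmul : ∀ ζ η, p (finTensorSucc H n (ζ ⊗ₜ η))) : p x := by
  obtain ⟨y, rfl⟩ := (finTensorSucc H n).surjective x
  induction y using TensorProduct.induction_on with
  | zero => rwa [map_zero]
  | tmul ζ η => exact tmul ζ η
  | add y z hy hz => rw [map_add]; exact add _ _ hy hz

theorem finTensor_clm_ext {n : ℕ} {E : Type*} [NormedAddCommGroup E] [NormedSpace ℂ E]
    {X Y : FinTensor H (n + 1) →L[ℂ] E}
    (h : ∀ ζ η, X (finTensorSucc H n (ζ ⊗ₜ η)) = Y (finTensorSucc H n (ζ ⊗ₜ η))) : X = Y := by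
  ext x
  induction x using finTensor_induction with
  | zero => rw [map_zero, map_zero]
  | add x y hx hy => rw [map_add, map_add, hx, hy]
  | tmul ζ η => exact h ζ η

@[simp] theorem finTensorOp_zero_apply (S : ∀ n, H n →L[ℂ] H n) (ζ : H 0) :
    finTensorOp S 0 (finTensorZero H ζ) = finTensorZero H (S 0 ζ) := rfl

@[simp] theorem finTensorOp_succ_tmul (S : ∀ n, H n →L[ℂ] H n) (n : ℕ) (ζ : FinTensor H n)
    (η : H (n + 1)) : finTensorOp S (n + 1) (finTensorSucc H n (ζ ⊗ₜ η)) =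
      finTensorSucc H n (finTensorOp S n ζ ⊗ₜ S (n + 1) η) := rfl

theorem finTensorOp_mul (S R : ∀ n, H n →L[ℂ] H n) (n : ℕ) :
    finTensorOp (fun i => S i * R i) n = finTensorOp S n * finTensorOp R n := by
  induction n with
  | zero => rfl
  | succ n ih =>
    refine finTensor_clm_ext fun ζ η => ?_
    simp [ih]

theorem finTensorOp_one (n : ℕ) : finTensorOp (fun i => (1 : H i →L[ℂ] H i)) n = 1 := by
  induction n with
  | zero => rfl
  | succ n ih =>
    refine finTensor_clm_ext fun ζ η => ?_
    simp [ih]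

theorem finTensorOp_congr {S R : ∀ n, H n →L[ℂ] H n} {n : ℕ} (h : ∀ i ≤ n, S i = R i) :
    finTensorOp S n = finTensorOp R n := by
  induction n with
  | zero => simp only [finTensorOp, h 0 le_rfl]
  | succ n ih => simp only [finTensorOp, ih fun i hi => h i (hi.trans n.le_succ), h _ le_rfl]

theorem norm_finTensorOp_le_one {S : ∀ n, H n →L[ℂ] H n} (hS : ∀ n, ‖S n‖ ≤ 1) (n : ℕ) :
    ‖finTensorOp S n‖ ≤ 1 := by
  induction n with
  | zero =>
    refine ContinuousLinearMap.opNorm_le_bound _ zero_le_one fun x => ?_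
    obtain ⟨y, rfl⟩ := (finTensorZero H).surjective x
    rw [finTensorOp_zero_apply, LinearIsometryEquiv.norm_map, LinearIsometryEquiv.norm_map]
    exact (S 0).le_of_opNorm_le (hS 0) y
  | succ n ih =>
    refine ContinuousLinearMap.opNorm_le_bound _ zero_le_one fun x => ?_
    obtain ⟨y, rfl⟩ := (finTensorSucc H n).surjective x
    have h : finTensorOp S (n + 1) (finTensorSucc H n y) =
        finTensorSucc H n (TensorProduct.mapL (finTensorOp S n) (S (n + 1)) y) := rfl
    rw [h, LinearIsometryEquiv.norm_map, LinearIsometryEquiv.norm_map]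
    refine ContinuousLinearMap.le_of_opNorm_le _ ?_ y
    exact (TensorProduct.norm_mapL_le _ _).trans (mul_le_one₀ ih (norm_nonneg _) (hS _))

theorem inner_finTensorOp [∀ n, CompleteSpace (H n)] (S : ∀ n, H n →L[ℂ] H n) (n : ℕ)
    (x y : FinTensor H n) :
    inner ℂ (finTensorOp S n x) y = inner ℂ x (finTensorOp (fun i => star (S i)) n y) := by
  induction n with
  | zero =>
    obtain ⟨x, rfl⟩ := (finTensorZero H).surjective x
    obtain ⟨y, rfl⟩ := (finTensorZero H).surjective y
    rw [finTensorOp_zero_apply, finTensorOp_zero_apply, LinearIsometryEquiv.inner_map_map,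
      LinearIsometryEquiv.inner_map_map, ContinuousLinearMap.star_eq_adjoint,
      ContinuousLinearMap.adjoint_inner_right]
  | succ n ih =>
    induction x using finTensor_induction with
    | zero => simp
    | add a b ha hb => rw [map_add, inner_add_left, inner_add_left, ha, hb]
    | tmul ζ η =>
      induction y using finTensor_induction with
      | zero => simp
      | add a b ha hb => rw [map_add, inner_add_right, inner_add_right, ha, hb]
      | tmul ζ' η' =>
        simp only [finTensorOp_succ_tmul, LinearIsometryEquiv.inner_map_map,
          TensorProduct.inner_tmul, ih, ContinuousLinearMap.star_eq_adjoint,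
          ContinuousLinearMap.adjoint_inner_right]

theorem finTensorOp_star [∀ n, CompleteSpace (H n)] [∀ n, FiniteDimensional ℂ (H n)]
    (S : ∀ n, H n →L[ℂ] H n) (n : ℕ) :
    finTensorOp (fun i => star (S i)) n = star (finTensorOp S n) := by
  ext x
  refine ext_inner_left ℂ fun y => ?_
  rw [ContinuousLinearMap.star_eq_adjoint, ContinuousLinearMap.adjoint_inner_right,
    inner_finTensorOp]

/-- In finite dimensions, every operator on a tensor product is a sum of elementary tensors. -/
theorem span_mapL_eq_top {E F : Type*} [NormedAddCommGroup E] [InnerProductSpace ℂ E]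
    [NormedAddCommGroup F] [InnerProductSpace ℂ F] [FiniteDimensional ℂ E]
    [FiniteDimensional ℂ F] :
    Submodule.span ℂ {X : (E ⊗[ℂ] F) →L[ℂ] (E ⊗[ℂ] F) | ∃ S R, TensorProduct.mapL S R = X} =
      ⊤ := by
  rw [eq_top_iff]
  intro X _
  rw [← sum_inner_smul_rankOne
    ((stdOrthonormalBasis ℂ E).tensorProduct (stdOrthonormalBasis ℂ F)) X]
  refine sum_mem fun i _ => sum_mem fun j _ => Submodule.smul_mem _ _ (Submodule.subset_span ?_)
  refine ⟨InnerProductSpace.rankOne ℂ (stdOrthonormalBasis ℂ E i.1) (stdOrthonormalBasis ℂ E j.1),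
    InnerProductSpace.rankOne ℂ (stdOrthonormalBasis ℂ F i.2) (stdOrthonormalBasis ℂ F j.2), ?_⟩
  refine ContinuousLinearMap.coe_injective (TensorProduct.ext' fun x y => ?_)
  simp only [TensorProduct.toLinearMap_mapL, TensorProduct.map_tmul, ContinuousLinearMap.coe_coe,
    InnerProductSpace.rankOne_apply, OrthonormalBasis.tensorProduct_apply',
    TensorProduct.inner_tmul, TensorProduct.smul_tmul_smul]

/-- The elementary tensors span `𝓑(H 0 ⊗ ⋯ ⊗ H n)`. -/
theorem span_finTensorOp_eq_top [∀ n, FiniteDimensional ℂ (H n)] (n : ℕ) :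
    Submodule.span ℂ (Set.range fun S : ∀ n, H n →L[ℂ] H n => finTensorOp S n) = ⊤ := by
  induction n with
  | zero =>
    rw [eq_top_iff]
    intro X _
    refine Submodule.subset_span ⟨fun n => match n with
      | 0 => (finTensorZero H).symm.toContinuousLinearEquiv.toContinuousLinearMap ∘L X ∘L
        (finTensorZero H).toContinuousLinearEquiv.toContinuousLinearMap
      | _ + 1 => 0, ?_⟩
    rfl
  | succ n ih =>
    rw [eq_top_iff]
    intro X _
    have hX : (show (FinTensor H n ⊗[ℂ] H (n + 1)) →L[ℂ] (FinTensor H n ⊗[ℂ] H (n + 1)) from X) ∈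
        Submodule.span ℂ {X : (FinTensor H n ⊗[ℂ] H (n + 1)) →L[ℂ] (FinTensor H n ⊗[ℂ] H (n + 1)) |
          ∃ S R, TensorProduct.mapL S R = X} :=
      span_mapL_eq_top (E := FinTensor H n) (F := H (n + 1)) ▸ Submodule.mem_top
    refine Submodule.span_induction (p := fun Y _ => (show FinTensor H (n + 1) →L[ℂ]
      FinTensor H (n + 1) from Y) ∈ Submodule.span ℂ (Set.range fun S : ∀ n, H n →L[ℂ] H n =>
      finTensorOp S (n + 1))) ?_ (zero_mem _) (fun _ _ _ _ h1 h2 => add_mem h1 h2)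
      (fun c _ _ h => Submodule.smul_mem _ c h) hX
    rintro _ ⟨S, R, rfl⟩
    have hS : S ∈ Submodule.span ℂ (Set.range fun S : ∀ n, H n →L[ℂ] H n => finTensorOp S n) :=
      ih ▸ Submodule.mem_top
    induction hS using Submodule.span_induction with
    | mem S hS =>
      obtain ⟨S, rfl⟩ := hS
      refine Submodule.subset_span ⟨Function.update S (n + 1) R, ?_⟩
      refine finTensor_clm_ext fun ζ η => ?_
      rw [finTensorOp_succ_tmul, Function.update_self, finTensorOp_congr (R := S)]
      · rfl
      · intro i hi
        exact Function.update_of_ne (by lia) _ _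
    | zero => rw [TensorProduct.mapL_zero_left]; exact zero_mem _
    | add S S' _ _ h1 h2 => rw [TensorProduct.mapL_add_left]; exact add_mem h1 h2
    | smul c S _ h => rw [TensorProduct.mapL_smul_left]; exact Submodule.smul_mem _ c h

theorem finTensorOp_update_add [DecidableEq ℕ] (S : ∀ n, H n →L[ℂ] H n) (n : ℕ) {i : ℕ} (hi : i ≤ n)
    (X Y : H i →L[ℂ] H i) :
    finTensorOp (Function.update S i (X + Y)) n =
      finTensorOp (Function.update S i X) n + finTensorOp (Function.update S i Y) n := by
  induction n with
  | zero =>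
    obtain rfl : i = 0 := by lia
    ext x
    simp [finTensorOp]
  | succ n ih =>
    refine finTensor_clm_ext fun ζ η => ?_
    rcases eq_or_ne i (n + 1) with rfl | hne
    · have h : ∀ Z, finTensorOp (Function.update S (n + 1) Z) n = finTensorOp S n := fun Z =>
        finTensorOp_congr fun i hi => Function.update_of_ne (by lia) _ _
      simp [h, TensorProduct.tmul_add]
    · have h : ∀ Z, Function.update S i Z (n + 1) = S (n + 1) := fun Z =>
        Function.update_of_ne hne.symm _ _
      simp [h, ih (by lia), TensorProduct.add_tmul]

theorem finTensorOp_update_smul [DecidableEq ℕ] (S : ∀ n, H n →L[ℂ] H n) (n : ℕ) {i : ℕ}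
    (hi : i ≤ n) (c : ℂ) (X : H i →L[ℂ] H i) :
    finTensorOp (Function.update S i (c • X)) n = c • finTensorOp (Function.update S i X) n := by
  induction n with
  | zero =>
    obtain rfl : i = 0 := by lia
    ext x
    simp [finTensorOp]
  | succ n ih =>
    refine finTensor_clm_ext fun ζ η => ?_
    rcases eq_or_ne i (n + 1) with rfl | hne
    · have h : ∀ Z, finTensorOp (Function.update S (n + 1) Z) n = finTensorOp S n := fun Z =>
        finTensorOp_congr fun i hi => Function.update_of_ne (by lia) _ _
      simp [h]
    · have h : ∀ Z, Function.update S i Z (n + 1) = S (n + 1) := fun Z =>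
        Function.update_of_ne hne.symm _ _
      simp [h, ih (by lia), ← TensorProduct.smul_tmul']

end

section
variable {H : ℕ → Type u} [∀ n, NormedAddCommGroup (H n)] [∀ n, InnerProductSpace ℂ (H n)]

/-! ### Operators on infinite tensor products -/

section
variable (ξ : ∀ n, H n) (hξ : ∀ n, ‖ξ n‖ = 1)

theorem finTensorStep_apply (n : ℕ) (ζ : FinTensor H n) :
    finTensorStep ξ hξ n ζ = finTensorSucc H n (ζ ⊗ₜ ξ (n + 1)) := rfl

theorem infTensorIncl_embed (n m : ℕ) (h : n ≤ m) (ζ : FinTensor H n) :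
    infTensorIncl ξ hξ m (finTensorEmbed ξ hξ n m h ζ) = infTensorIncl ξ hξ n ζ := by
  have : PreInfTensor.of ξ hξ m (finTensorEmbed ξ hξ n m h ζ) = PreInfTensor.of ξ hξ n ζ :=
    (DirectLimit.eq_of_le (f := finTensorEmbed ξ hξ) ⟨n, ζ⟩ m h).symm
  exact congrArg (UniformSpace.Completion.toComplₗᵢ (𝕜 := ℂ) (E := PreInfTensor ξ hξ)) this

theorem infTensorIncl_step (n : ℕ) (ζ : FinTensor H n) :
    infTensorIncl ξ hξ (n + 1) (finTensorStep ξ hξ n ζ) = infTensorIncl ξ hξ n ζ := by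
  have h := infTensorIncl_embed ξ hξ n (n + 1) n.le_succ ζ
  rwa [finTensorEmbed_succ ξ hξ n n le_rfl, finTensorEmbed_self] at h

theorem denseRange_preInfTensor : DenseRange (UniformSpace.Completion.toComplₗᵢ (𝕜 := ℂ)
    (E := PreInfTensor ξ hξ)) :=
  UniformSpace.Completion.denseRange_coe

/-- The images of the finite tensor products of length at least `N` are dense. -/
theorem dense_infTensorIncl (N : ℕ) :
    Dense {x | ∃ n, N ≤ n ∧ ∃ ζ, infTensorIncl ξ hξ n ζ = x} := by
  refine (denseRange_preInfTensor ξ hξ).mono ?_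
  rintro _ ⟨x, rfl⟩
  obtain ⟨n, ζ, rfl⟩ := PreInfTensor.exists_of ξ hξ x
  exact ⟨max N n, le_max_left _ _, finTensorEmbed ξ hξ n _ (le_max_right N n) ζ,
    infTensorIncl_embed ξ hξ n _ _ ζ⟩

variable {ξ hξ}

theorem infTensor_clm_ext {E : Type*} [NormedAddCommGroup E] [NormedSpace ℂ E]
    {X Y : InfTensor ξ hξ →L[ℂ] E} (N : ℕ)
    (h : ∀ n, N ≤ n → ∀ ζ, X (infTensorIncl ξ hξ n ζ) = Y (infTensorIncl ξ hξ n ζ)) : X = Y := by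
  refine ContinuousLinearMap.coeFn_injective
    (Continuous.ext_on (dense_infTensorIncl ξ hξ N) X.continuous Y.continuous ?_)
  rintro _ ⟨n, hn, ζ, rfl⟩
  exact h n hn ζ

variable (ξ hξ)

/-- A compatible, uniformly bounded family of operators on the finite tensor products extends to
the infinite tensor product. -/
theorem exists_infTensorLift {E : Type*} [NormedAddCommGroup E] [NormedSpace ℂ E]
    [CompleteSpace E] (g : ∀ n, FinTensor H n →ₗ[ℂ] E)
    (hg : ∀ n ζ, g (n + 1) (finTensorStep ξ hξ n ζ) = g n ζ) (C : ℝ)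
    (hC : ∀ n ζ, ‖g n ζ‖ ≤ C * ‖ζ‖) :
    ∃ X : InfTensor ξ hξ →L[ℂ] E, ∀ n ζ, X (infTensorIncl ξ hξ n ζ) = g n ζ := by
  have hcompat : ∀ i j (h : i ≤ j) (x : FinTensor H i),
      g i x = g j (finTensorEmbed ξ hξ i j h x) := by
    intro i j h x
    induction j, h using Nat.le_induction with
    | base => rw [finTensorEmbed_self]; rfl
    | succ j h ih =>
      rw [finTensorEmbed_succ ξ hξ i j h, LinearIsometry.coe_comp, Function.comp_apply, hg, ih]
  let L : PreInfTensor ξ hξ →ₗ[ℂ] E :=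
    DirectLimit.Module.lift ℂ ℕ (FinTensor H) (finTensorEmbed ξ hξ) g
      fun i j h x => (hcompat i j h x).symm
  have hL : ∀ n ζ, L (PreInfTensor.of ξ hξ n ζ) = g n ζ := fun n ζ => rfl
  let Lc : PreInfTensor ξ hξ →L[ℂ] E := L.mkContinuous C fun x => by
    obtain ⟨n, ζ, rfl⟩ := PreInfTensor.exists_of ξ hξ x
    rw [hL]
    refine (hC n ζ).trans (le_of_eq ?_)
    congr 1
    exact (((PreInfTensor.of ξ hξ n).isometryOfInner (PreInfTensor.inner_of ξ hξ n)).norm_map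
      ζ).symm
  refine ⟨Lc.extend (UniformSpace.Completion.toComplL (𝕜 := ℂ) (E := PreInfTensor ξ hξ)),
    fun n ζ => ?_⟩
  exact Lc.extend_eq (e := UniformSpace.Completion.toComplL (𝕜 := ℂ) (E := PreInfTensor ξ hξ))
    UniformSpace.Completion.denseRange_coe
    (UniformSpace.Completion.isUniformInducing_coe _) (PreInfTensor.of ξ hξ n ζ)

/-- `T` acts on the finite tensor products `H 0 ⊗ ⋯ ⊗ H n` with `k ≤ n + 1`, that is, on those
containing the first `k` factors, as `S 0 ⊗ ⋯ ⊗ S n`. -/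
def IsStableOp (S : ∀ n, H n →L[ℂ] H n) (k : ℕ)
    (T : InfTensor ξ hξ →L[ℂ] InfTensor ξ hξ) : Prop :=
  ∀ n, k ≤ n + 1 → ∀ ζ, T (infTensorIncl ξ hξ n ζ) = infTensorIncl ξ hξ n (finTensorOp S n ζ)

variable {ξ hξ}

theorem finTensorOp_step {S : ∀ n, H n →L[ℂ] H n} {n : ℕ} (hS : S (n + 1) (ξ (n + 1)) = ξ (n + 1))
    (ζ : FinTensor H n) :
    finTensorOp S (n + 1) (finTensorStep ξ hξ n ζ) =
      finTensorStep ξ hξ n (finTensorOp S n ζ) := by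
  rw [finTensorStep_apply, finTensorOp_succ_tmul, hS, finTensorStep_apply]

theorem finTensorOp_embed {S : ∀ n, H n →L[ℂ] H n} {k n : ℕ} (hS : ∀ i, k ≤ i → S i (ξ i) = ξ i)
    (hn : k ≤ n + 1) (m : ℕ) (h : n ≤ m) (ζ : FinTensor H n) :
    finTensorOp S m (finTensorEmbed ξ hξ n m h ζ) =
      finTensorEmbed ξ hξ n m h (finTensorOp S n ζ) := by
  induction m, h using Nat.le_induction with
  | base => rw [finTensorEmbed_self]; rfl
  | succ m h ih =>
    rw [finTensorEmbed_succ ξ hξ n m h, LinearIsometry.coe_comp, Function.comp_apply,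
      Function.comp_apply, finTensorOp_step (hS _ (by lia)), ih]

/-- If all but finitely many `S n` fix the reference vectors, the limits defining `⨂ₙ S n` are
eventually constant. -/
theorem isInfTensorOp_iff_isStableOp {S : ∀ n, H n →L[ℂ] H n} {k : ℕ}
    (hS : ∀ i, k ≤ i → S i (ξ i) = ξ i) {T : InfTensor ξ hξ →L[ℂ] InfTensor ξ hξ} :
    IsInfTensorOp ξ hξ S T ↔ IsStableOp ξ hξ S k T := by
  constructor
  · intro h n hn ζ
    refine tendsto_nhds_unique (h n ζ) (tendsto_const_nhds.congr fun j => ?_)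
    rw [finTensorOp_embed hS hn, infTensorIncl_embed]
  · intro h n ζ
    refine tendsto_const_nhds.congr' ?_
    filter_upwards [eventually_ge_atTop k] with j hj
    rw [← h (n + j) (by lia), infTensorIncl_embed]

theorem IsStableOp.unique {S : ∀ n, H n →L[ℂ] H n} {k : ℕ}
    {T T' : InfTensor ξ hξ →L[ℂ] InfTensor ξ hξ} (h : IsStableOp ξ hξ S k T)
    (h' : IsStableOp ξ hξ S k T') : T = T' :=
  infTensor_clm_ext k fun n hn ζ => by rw [h n (by lia), h' n (by lia)]

theorem IsStableOp.star [∀ n, CompleteSpace (H n)] {S : ∀ n, H n →L[ℂ] H n} {k : ℕ}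
    (hS : ∀ i, k ≤ i → star (S i) (ξ i) = ξ i) {T : InfTensor ξ hξ →L[ℂ] InfTensor ξ hξ}
    (h : IsStableOp ξ hξ S k T) : IsStableOp ξ hξ (fun i => star (S i)) k (star T) := by
  intro n hn ζ
  refine (innerSL_inj (𝕜 := ℂ)).1 (infTensor_clm_ext n fun m hm θ => ?_)
  rw [innerSL_apply_apply, innerSL_apply_apply, ContinuousLinearMap.star_eq_adjoint,
    ContinuousLinearMap.adjoint_inner_left, h m (by lia), ← infTensorIncl_embed ξ hξ n m hm,
    ← infTensorIncl_embed ξ hξ n m hm, LinearIsometry.inner_map_map, LinearIsometry.inner_map_map,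
    ← finTensorOp_embed (S := fun i => Star.star (S i)) hS hn, inner_finTensorOp]
  simp only [star_star]

/-- The infinite tensor product of contractions fixing the reference vectors exists and is a
contraction. -/
theorem exists_isStableOp {A : ∀ n, H n →L[ℂ] H n} (hA : ∀ n, ‖A n‖ ≤ 1)
    (hAξ : ∀ n, A n (ξ n) = ξ n) :
    ∃ a : InfTensor ξ hξ →L[ℂ] InfTensor ξ hξ, ‖a‖ ≤ 1 ∧ IsStableOp ξ hξ A 0 a := by
  obtain ⟨a, ha⟩ := exists_infTensorLift ξ hξ
    (fun n => (infTensorIncl ξ hξ n).toLinearMap ∘ₗ (finTensorOp A n).toLinearMap)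
    (fun n ζ => by
      change infTensorIncl ξ hξ (n + 1) (finTensorOp A (n + 1) (finTensorStep ξ hξ n ζ)) = _
      rw [finTensorOp_step (hAξ _), infTensorIncl_step]; rfl) 1
    (fun n ζ => by
      change ‖infTensorIncl ξ hξ n (finTensorOp A n ζ)‖ ≤ _
      rw [LinearIsometry.norm_map]
      exact (finTensorOp A n).le_of_opNorm_le (norm_finTensorOp_le_one hA n) ζ)
  refine ⟨a, ?_, fun n _ ζ => ha n ζ⟩
  refine ContinuousLinearMap.opNorm_le_bound _ zero_le_one fun x => ?_
  refine (dense_infTensorIncl ξ hξ 0).induction (P := fun x => ‖a x‖ ≤ 1 * ‖x‖) ?_ ?_ x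
  · rintro _ ⟨n, -, ζ, rfl⟩
    rw [ha, LinearIsometry.norm_map]
    change ‖infTensorIncl ξ hξ n (finTensorOp A n ζ)‖ ≤ _
    rw [LinearIsometry.norm_map]
    exact (finTensorOp A n).le_of_opNorm_le (norm_finTensorOp_le_one hA n) ζ
  · exact isClosed_le (by fun_prop) (by fun_prop)

/-- Positivity is inherited: `⨂ₙ A n` is the square of `⨂ₙ √(A n)` on each finite tensor product. -/
theorem IsStableOp.nonneg [∀ n, CompleteSpace (H n)] [∀ n, FiniteDimensional ℂ (H n)]
    {A : ∀ n, H n →L[ℂ] H n} (hA : ∀ n, (A n).IsPositive)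
    {a : InfTensor ξ hξ →L[ℂ] InfTensor ξ hξ} (ha : IsStableOp ξ hξ A 0 a) : 0 ≤ a := by
  have hB : ∀ n, ∃ B, IsSelfAdjoint B ∧ B * B = A n := fun n =>
    ⟨CFC.sqrt (A n), CFC.sqrt_nonneg (A n) |>.isSelfAdjoint,
      CFC.sqrt_mul_sqrt_self (A n) ((ContinuousLinearMap.nonneg_iff_isPositive _).2 (hA n))⟩
  choose B hBsa hBB using hB
  rw [ContinuousLinearMap.nonneg_iff_isPositive, ContinuousLinearMap.isPositive_iff_complex]
  intro x
  refine (dense_infTensorIncl ξ hξ 0).induction (P := fun x =>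
    ((RCLike.re (inner ℂ (a x) x) : ℝ) : ℂ) = inner ℂ (a x) x ∧
      0 ≤ RCLike.re (inner ℂ (a x) x)) ?_ ?_ x
  · rintro _ ⟨n, -, ζ, rfl⟩
    have h : inner ℂ (a (infTensorIncl ξ hξ n ζ)) (infTensorIncl ξ hξ n ζ) =
        inner ℂ (finTensorOp B n ζ) (finTensorOp B n ζ) := by
      have h1 : finTensorOp A n = finTensorOp B n * finTensorOp B n := by
        rw [← finTensorOp_mul]; exact finTensorOp_congr fun i _ => (hBB i).symm
      rw [ha n (by lia), LinearIsometry.inner_map_map, h1, mul_apply_eq_comp,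
        inner_finTensorOp]
      simp only [(hBsa _).star_eq]
    rw [h]
    exact ⟨inner_self_ofReal_re _, inner_self_nonneg⟩
  · have hc : Continuous fun x => inner ℂ (a x) x := by fun_prop
    exact (isClosed_eq (Complex.continuous_ofReal.comp (Complex.continuous_re.comp hc)) hc).inter
      (isClosed_le continuous_const (Complex.continuous_re.comp hc))

end
end

section
variable {H : ℕ → Type u} [∀ n, NormedAddCommGroup (H n)] [∀ n, InnerProductSpace ℂ (H n)]

/-! ### Splitting off finitely many tensor factors -/

/-- The identification of finite tensor products along an equality of lengths. -/
noncomputable def finTensorCast {a b : ℕ} (h : a = b) : FinTensor H a ≃ₗᵢ[ℂ] FinTensor H b :=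
  h ▸ LinearIsometryEquiv.refl ℂ (FinTensor H a)

theorem finTensorOp_cast (S : ∀ n, H n →L[ℂ] H n) {a b : ℕ} (h : a = b) (ζ : FinTensor H a) :
    finTensorOp S b (finTensorCast h ζ) = finTensorCast h (finTensorOp S a ζ) := by
  subst h; rfl

theorem infTensorIncl_cast (ξ : ∀ n, H n) (hξ : ∀ n, ‖ξ n‖ = 1) {a b : ℕ} (h : a = b)
    (ζ : FinTensor H a) :
    infTensorIncl ξ hξ b (finTensorCast h ζ) = infTensorIncl ξ hξ a ζ := by
  subst h; rfl

variable (H) in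
/-- The associativity isometry
`(H 0 ⊗ ⋯ ⊗ H n) ⊗ (H (n + 1) ⊗ ⋯ ⊗ H (n + 1 + m)) ≃ H 0 ⊗ ⋯ ⊗ H (n + 1 + m)`. -/
noncomputable def finTensorAssoc (n : ℕ) : ∀ m, (FinTensor H n ⊗[ℂ]
    FinTensor (fun i => H (i + (n + 1))) m) ≃ₗᵢ[ℂ] FinTensor H (m + (n + 1))
  | 0 => (TensorProduct.congrIsometry (finTensorCast (Nat.zero_add n).symm)
      (finTensorZero (fun i => H (i + (n + 1)))).symm).trans (finTensorSucc H (0 + n))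
  | m + 1 => ((TensorProduct.congrIsometry (LinearIsometryEquiv.refl ℂ _)
      (finTensorSucc (fun i => H (i + (n + 1))) m).symm).trans
      (TensorProduct.assocIsometry ℂ _ _ _).symm).trans
      ((TensorProduct.congrIsometry
        ((finTensorAssoc n m).trans (finTensorCast (by lia : m + (n + 1) = m + 1 + n)))
        (LinearIsometryEquiv.refl ℂ _)).trans (finTensorSucc H (m + 1 + n)))

theorem finTensorAssoc_zero (n : ℕ) (v : FinTensor H n) (η : H (0 + (n + 1))) :
    finTensorAssoc H n 0 (v ⊗ₜ finTensorZero (fun i => H (i + (n + 1))) η) =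
      finTensorSucc H (0 + n) (finTensorCast (Nat.zero_add n).symm v ⊗ₜ η) := rfl

theorem finTensorAssoc_succ (n m : ℕ) (v : FinTensor H n)
    (ζ : FinTensor (fun i => H (i + (n + 1))) m) (η : H (m + 1 + (n + 1))) :
    finTensorAssoc H n (m + 1) (v ⊗ₜ finTensorSucc (fun i => H (i + (n + 1))) m (ζ ⊗ₜ η)) =
      finTensorSucc H (m + 1 + n)
        (finTensorCast (by lia) (finTensorAssoc H n m (v ⊗ₜ ζ)) ⊗ₜ η) := rfl

/-- The associativity isometry intertwines `S 0 ⊗ ⋯ ⊗ S (n + 1 + m)` with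
`(S 0 ⊗ ⋯ ⊗ S n) ⊗ (S (n + 1) ⊗ ⋯ ⊗ S (n + 1 + m))`. -/
theorem finTensorOp_assoc (S : ∀ n, H n →L[ℂ] H n) (n m : ℕ) (v : FinTensor H n)
    (ζ : FinTensor (fun i => H (i + (n + 1))) m) :
    finTensorOp S (m + (n + 1)) (finTensorAssoc H n m (v ⊗ₜ ζ)) =
      finTensorAssoc H n m (finTensorOp S n v ⊗ₜ finTensorOp (fun i => S (i + (n + 1))) m ζ) := by
  induction m with
  | zero =>
    obtain ⟨η, rfl⟩ := (finTensorZero (fun i => H (i + (n + 1)))).surjective ζ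
    rw [finTensorAssoc_zero, finTensorOp_zero_apply, finTensorAssoc_zero, ← finTensorOp_cast]
    exact finTensorOp_succ_tmul S (0 + n) _ _
  | succ m ih =>
    induction ζ using finTensor_induction with
    | zero => simp
    | add x y hx hy => simp only [TensorProduct.tmul_add, map_add, hx, hy]
    | tmul ζ η =>
      rw [finTensorAssoc_succ, finTensorOp_succ_tmul, finTensorAssoc_succ, ← ih,
        ← finTensorOp_cast]
      exact finTensorOp_succ_tmul S (m + 1 + n) _ _

section
variable (ξ : ∀ n, H n) (hξ : ∀ n, ‖ξ n‖ = 1)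

/-- The associativity isometries are compatible with the connecting isometries. -/
theorem infTensorIncl_assoc_step (n m : ℕ) (v : FinTensor H n)
    (ζ : FinTensor (fun i => H (i + (n + 1))) m) :
    infTensorIncl ξ hξ (m + 1 + (n + 1)) (finTensorAssoc H n (m + 1)
      (v ⊗ₜ finTensorStep (fun i => ξ (i + (n + 1))) (fun i => hξ (i + (n + 1))) m ζ)) =
    infTensorIncl ξ hξ (m + (n + 1)) (finTensorAssoc H n m (v ⊗ₜ ζ)) := by
  rw [finTensorStep_apply, finTensorAssoc_succ]
  exact (infTensorIncl_step ξ hξ (m + 1 + n) _).trans (infTensorIncl_cast ξ hξ _ _)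

theorem exists_tailFactor (n : ℕ) : ∃ J : FinTensor H n →ₗ[ℂ] (TailTensor ξ hξ (n + 1) →L[ℂ]
    InfTensor ξ hξ), ∀ v m ζ, J v (infTensorIncl (fun i => ξ (i + (n + 1)))
      (fun i => hξ (i + (n + 1))) m ζ) =
        infTensorIncl ξ hξ (m + (n + 1)) (finTensorAssoc H n m (v ⊗ₜ ζ)) := by
  have h := fun v : FinTensor H n => exists_infTensorLift (fun i => ξ (i + (n + 1)))
    (fun i => hξ (i + (n + 1)))
    (fun m => (infTensorIncl ξ hξ (m + (n + 1))).toLinearMap ∘ₗ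
      (finTensorAssoc H n m).toLinearEquiv.toLinearMap ∘ₗ TensorProduct.mk ℂ _ _ v)
    (fun m ζ => infTensorIncl_assoc_step ξ hξ n m v ζ) ‖v‖ (fun m ζ => by
      change ‖infTensorIncl ξ hξ (m + (n + 1)) (finTensorAssoc H n m (v ⊗ₜ ζ))‖ ≤ _
      rw [LinearIsometry.norm_map, LinearIsometryEquiv.norm_map, TensorProduct.norm_tmul])
  choose J hJ using h
  replace hJ : ∀ v m ζ, J v (infTensorIncl _ _ m ζ) =
    infTensorIncl ξ hξ (m + (n + 1)) (finTensorAssoc H n m (v ⊗ₜ ζ)) := hJ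
  refine ⟨{ toFun := J, map_add' := fun v w => ?_, map_smul' := fun c v => ?_ }, hJ⟩
  · refine infTensor_clm_ext 0 fun m _ ζ => ?_
    rw [add_apply]
    simp only [hJ, TensorProduct.add_tmul, map_add]
  · refine infTensor_clm_ext 0 fun m _ ζ => ?_
    rw [RingHom.id_apply, smul_apply]
    simp only [hJ, ← TensorProduct.smul_tmul', map_smul]

/-- The operators `η ↦ v ⊗ η` from the tail tensor product to the whole tensor product. -/
noncomputable def tailFactorMap (n : ℕ) :
    FinTensor H n →ₗ[ℂ] (TailTensor ξ hξ (n + 1) →L[ℂ] InfTensor ξ hξ) :=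
  (exists_tailFactor ξ hξ n).choose

theorem tailFactorMap_incl (n : ℕ) (v : FinTensor H n) (m : ℕ)
    (ζ : FinTensor (fun i => H (i + (n + 1))) m) :
    tailFactorMap ξ hξ n v (infTensorIncl (fun i => ξ (i + (n + 1)))
      (fun i => hξ (i + (n + 1))) m ζ) =
        infTensorIncl ξ hξ (m + (n + 1)) (finTensorAssoc H n m (v ⊗ₜ ζ)) :=
  (exists_tailFactor ξ hξ n).choose_spec v m ζ

theorem inner_tailFactorMap (n : ℕ) (v w : FinTensor H n) (η θ : TailTensor ξ hξ (n + 1)) :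
    inner ℂ (tailFactorMap ξ hξ n v η) (tailFactorMap ξ hξ n w θ) =
      inner ℂ v w * inner ℂ η θ := by
  refine (dense_infTensorIncl _ _ 0).induction (P := fun η =>
    inner ℂ (tailFactorMap ξ hξ n v η) (tailFactorMap ξ hξ n w θ) =
      inner ℂ v w * inner ℂ η θ) ?_ (isClosed_eq (by fun_prop) (by fun_prop)) η
  rintro _ ⟨i, -, x, rfl⟩
  refine (dense_infTensorIncl _ _ i).induction (P := fun θ =>
    inner ℂ (tailFactorMap ξ hξ n v (infTensorIncl _ _ i x)) (tailFactorMap ξ hξ n w θ) =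
        inner ℂ v w * inner ℂ (infTensorIncl _ _ i x) θ) ?_
    (isClosed_eq (by fun_prop) (by fun_prop)) θ
  rintro _ ⟨j, hj, y, rfl⟩
  rw [← infTensorIncl_embed _ _ i j hj, tailFactorMap_incl, tailFactorMap_incl,
    LinearIsometry.inner_map_map, LinearIsometry.inner_map_map,
    LinearIsometryEquiv.inner_map_map, TensorProduct.inner_tmul]

theorem dense_span_tailFactorMap (n : ℕ) : Dense (Submodule.span ℂ
    {x | ∃ v η, tailFactorMap ξ hξ n v η = x} : Set (InfTensor ξ hξ)) := by
  refine (dense_infTensorIncl ξ hξ (n + 1)).mono ?_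
  rintro _ ⟨N, hN, θ, rfl⟩
  obtain ⟨m, rfl⟩ := Nat.exists_eq_add_of_le' hN
  obtain ⟨x, rfl⟩ := (finTensorAssoc H n m).surjective θ
  induction x using TensorProduct.induction_on with
  | zero => rw [map_zero, map_zero]; exact zero_mem (Submodule.span ℂ _)
  | add x y hx hy => rw [map_add, map_add]; exact Submodule.add_mem _ hx hy
  | tmul v ζ => exact Submodule.subset_span ⟨v, _, tailFactorMap_incl ξ hξ n v m ζ⟩

/-- The factorization
`⨂ᵢ (H i, ξ i) = (H 0 ⊗ ⋯ ⊗ H n) ⊗ ⨂ (H i, ξ i)`, the last product being over `i ≥ n + 1`. -/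
noncomputable def tailFactor (n : ℕ) :
    HilbertFactor (FinTensor H n) (TailTensor ξ hξ (n + 1)) (InfTensor ξ hξ) where
  J := tailFactorMap ξ hξ n
  inner_J := inner_tailFactorMap ξ hξ n
  total := Submodule.dense_iff_topologicalClosure_eq_top.1 (dense_span_tailFactorMap ξ hξ n)

theorem tailFactor_J_incl (n : ℕ) (v : FinTensor H n) (m : ℕ)
    (ζ : FinTensor (fun i => H (i + (n + 1))) m) :
    (tailFactor ξ hξ n).J v (infTensorIncl (fun i => ξ (i + (n + 1)))
      (fun i => hξ (i + (n + 1))) m ζ) =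
        infTensorIncl ξ hξ (m + (n + 1)) (finTensorAssoc H n m (v ⊗ₜ ζ)) :=
  tailFactorMap_incl ξ hξ n v m ζ

variable {ξ hξ}

/-- Tensoring an operator on the first `n + 1` factors with the stable product of the remaining
operators gives the stable product of the whole sequence. -/
theorem isStableOp_tailFactor_op [∀ n, FiniteDimensional ℂ (H n)] {S : ∀ n, H n →L[ℂ] H n} {n : ℕ}
    (hS : ∀ i, n + 1 ≤ i → S i (ξ i) = ξ i)
    {a : TailTensor ξ hξ (n + 1) →L[ℂ] TailTensor ξ hξ (n + 1)}
    (ha : IsStableOp (fun i => ξ (i + (n + 1))) (fun i => hξ (i + (n + 1)))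
      (fun i => S (i + (n + 1))) 0 a) :
    IsStableOp ξ hξ S (n + 1) ((tailFactor ξ hξ n).op (finTensorOp S n) a) := by
  have key : ∀ m (θ : FinTensor H (m + (n + 1))), (tailFactor ξ hξ n).op (finTensorOp S n) a
      (infTensorIncl ξ hξ _ θ) = infTensorIncl ξ hξ _ (finTensorOp S _ θ) := by
    intro m θ
    obtain ⟨x, rfl⟩ := (finTensorAssoc H n m).surjective θ
    induction x using TensorProduct.induction_on with
    | zero => simp
    | add x y hx hy => simp only [map_add, hx, hy]
    | tmul v ζ =>
      rw [← tailFactor_J_incl, HilbertFactor.op_J, ha m (by lia), tailFactor_J_incl,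
        finTensorOp_assoc]
  intro N hN θ
  -- `N = n` is not of the form `m + (n + 1)`, so one more factor is adjoined
  obtain ⟨m, rfl⟩ : ∃ m, N = m + n := ⟨N - n, by lia⟩
  rw [← infTensorIncl_step ξ hξ (m + n) θ]
  refine (key m _).trans ?_
  rw [← infTensorIncl_step ξ hξ (m + n), ← finTensorOp_step (hS _ (by lia))]
  rfl

variable (ξ hξ) in
/-- The trivial factorization, splitting off no factors. -/
noncomputable def scalarFactor :
    HilbertFactor ℂ (InfTensor ξ hξ) (InfTensor ξ hξ) where
  J := LinearMap.toSpanSingleton ℂ _ (ContinuousLinearMap.id ℂ _)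
  inner_J v w η θ := by
    simp [mul_left_comm, mul_comm]
  total := by
    rw [← Submodule.dense_iff_topologicalClosure_eq_top]
    refine dense_univ.mono fun x _ => Submodule.subset_span ⟨1, x, by simp⟩

theorem scalarFactor_op (S : ℂ →L[ℂ] ℂ) (a : InfTensor ξ hξ →L[ℂ] InfTensor ξ hξ) :
    (scalarFactor ξ hξ).op S a = S 1 • a := by
  refine (scalarFactor ξ hξ).clm_ext fun v η => ?_
  rw [HilbertFactor.op_J]
  have : S v = S 1 * v := by rw [← mul_one v, ← smul_eq_mul, map_smul]; simp [mul_comm]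
  simp [scalarFactor, this, smul_smul, mul_comm]

end
end

section
variable {H : ℕ → Type u} [∀ n, NormedAddCommGroup (H n)] [∀ n, InnerProductSpace ℂ (H n)]

/-! ### The stages as matrix algebras over the tail algebras -/

theorem extendBy_of_lt (A : ∀ n, H n →L[ℂ] H n) {k : ℕ} (S : ∀ i : Fin k, H i →L[ℂ] H i) {n : ℕ}
    (h : n < k) : extendBy A k S n = S ⟨n, h⟩ := dif_pos h

theorem extendBy_of_le (A : ∀ n, H n →L[ℂ] H n) {k : ℕ} (S : ∀ i : Fin k, H i →L[ℂ] H i) {n : ℕ}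
    (h : k ≤ n) : extendBy A k S n = A n := dif_neg (by lia)

theorem extendBy_restrict {A S : ∀ n, H n →L[ℂ] H n} {k : ℕ} (h : ∀ n, k ≤ n → S n = A n) :
    extendBy A k (fun i => S i) = S := by
  funext n
  rcases lt_or_ge n k with hn | hn
  · rw [extendBy_of_lt _ _ hn]
  · rw [extendBy_of_le _ _ hn, h n hn]

theorem extendBy_update [DecidableEq ℕ] (A : ∀ n, H n →L[ℂ] H n) {k : ℕ} [DecidableEq (Fin k)]
    (S : ∀ i : Fin k, H i →L[ℂ] H i) (i : Fin k) (X : H i →L[ℂ] H i) :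
    extendBy A k (Function.update S i X) = Function.update (extendBy A k S) i X := by
  funext n
  by_cases hni : n = i
  · subst hni
    rw [Function.update_self, extendBy_of_lt _ _ i.2, Function.update_self]
  · rw [Function.update_of_ne hni]
    rcases lt_or_ge n k with hn | hn
    · rw [extendBy_of_lt _ _ hn, extendBy_of_lt _ _ hn, Function.update_of_ne]
      exact fun h => hni (congrArg Fin.val h)
    · rw [extendBy_of_le _ _ hn, extendBy_of_le _ _ hn]

variable (H) in
/-- The multilinear map `(S 0, …, S n) ↦ S 0 ⊗ ⋯ ⊗ S n`. -/
noncomputable def finTensorOpMultilinear (n : ℕ) :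
    MultilinearMap ℂ (fun i : Fin (n + 1) => H i →L[ℂ] H i)
      (FinTensor H n →L[ℂ] FinTensor H n) where
  toFun S := finTensorOp (extendBy (fun _ => 1) (n + 1) S) n
  map_update_add' S i X Y := by
    classical
    rw [extendBy_update, extendBy_update, extendBy_update, finTensorOp_update_add _ _ (by lia)]
  map_update_smul' S i c X := by
    classical
    rw [extendBy_update, extendBy_update, finTensorOp_update_smul _ _ (by lia)]

theorem finTensorOpMultilinear_restrict (S : ∀ n, H n →L[ℂ] H n) (n : ℕ) :
    finTensorOpMultilinear H n (fun i => S i) = finTensorOp S n :=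
  finTensorOp_congr fun i hi => extendBy_of_lt _ _ (by lia)

theorem finrank_clm (E : Type*) [NormedAddCommGroup E] [NormedSpace ℂ E] [FiniteDimensional ℂ E] :
    Module.finrank ℂ (E →L[ℂ] E) = Module.finrank ℂ E * Module.finrank ℂ E := by
  rw [← (LinearMap.toContinuousLinearMap (𝕜 := ℂ) (E := E) (F' := E)).finrank_eq,
    Module.finrank_linearMap]

theorem isTailOp_iff {ξ : ∀ n, H n} {hξ : ∀ n, ‖ξ n‖ = 1} {A : ∀ n, H n →L[ℂ] H n}
    (hAξ : ∀ n, A n (ξ n) = ξ n)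
    (k : ℕ) {a : TailTensor ξ hξ k →L[ℂ] TailTensor ξ hξ k} :
    IsTailOp ξ hξ A k a ↔ IsStableOp (fun n => ξ (n + k)) (fun n => hξ (n + k))
      (fun n => A (n + k)) 0 a :=
  isInfTensorOp_iff_isStableOp fun i _ => hAξ (i + k)

variable (H) in
/-- The empty tensor product of operator algebras is `𝓑(ℂ)`. -/
noncomputable def emptyOpEquiv :
    (⨂[ℂ] i : Fin 0, (H i →L[ℂ] H i)) ≃ₗ[ℂ] (ℂ →L[ℂ] ℂ) :=
  (PiTensorProduct.isEmptyEquiv (Fin 0)).trans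
    ((LinearMap.ringLmapEquivSelf ℂ ℂ ℂ).symm.trans LinearMap.toContinuousLinearMap)

theorem emptyOpEquiv_tprod (S : ∀ i : Fin 0, H i →L[ℂ] H i) :
    emptyOpEquiv H (PiTensorProduct.tprod ℂ S) = 1 := by
  ext; simp [emptyOpEquiv]

section
variable [∀ n, FiniteDimensional ℂ (H n)]

/-- The elementary tensors span, and the dimensions agree. -/
theorem bijective_lift_finTensorOpMultilinear (n : ℕ) :
    Function.Bijective (PiTensorProduct.lift (finTensorOpMultilinear H n)) := by
  have hs : Function.Surjective (PiTensorProduct.lift (finTensorOpMultilinear H n)) := by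
    rw [← LinearMap.range_eq_top, eq_top_iff, ← span_finTensorOp_eq_top n, Submodule.span_le]
    rintro _ ⟨S, rfl⟩
    exact ⟨PiTensorProduct.tprod ℂ fun i => S i,
      (PiTensorProduct.lift.tprod _).trans (finTensorOpMultilinear_restrict S n)⟩
  have : ∀ i : Fin (n + 1), Module.Free ℂ (H i →L[ℂ] H i) := fun i => Module.Free.of_divisionRing ..
  let b := Basis.piTensorProduct
    fun i : Fin (n + 1) => Module.finBasis ℂ (H i →L[ℂ] H i)
  have : FiniteDimensional ℂ (⨂[ℂ] i : Fin (n + 1), (H i →L[ℂ] H i)) :=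
    Module.Finite.of_basis b
  refine ⟨(LinearMap.injective_iff_surjective_of_finrank_eq_finrank ?_).2 hs, hs⟩
  rw [Module.finrank_eq_card_basis b, finrank_clm, finrank_finTensor, Fintype.card_pi,
    ← Finset.prod_mul_distrib, Finset.prod_range]
  simp only [Fintype.card_fin, finrank_clm]

variable (H) in
/-- `𝓑(H 0) ⊗ ⋯ ⊗ 𝓑(H n) ≅ 𝓑(H 0 ⊗ ⋯ ⊗ H n)`. -/
noncomputable def finTensorOpEquiv (n : ℕ) :
    (⨂[ℂ] i : Fin (n + 1), (H i →L[ℂ] H i)) ≃ₗ[ℂ] (FinTensor H n →L[ℂ] FinTensor H n) :=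
  LinearEquiv.ofBijective _ (bijective_lift_finTensorOpMultilinear n)

theorem finTensorOpEquiv_tprod (n : ℕ) (S : ∀ i : Fin (n + 1), H i →L[ℂ] H i) :
    finTensorOpEquiv H n (PiTensorProduct.tprod ℂ S) =
      finTensorOp (extendBy (fun _ => 1) (n + 1) S) n :=
  PiTensorProduct.lift.tprod _

variable (ξ : ∀ n, H n) (hξ : ∀ n, ‖ξ n‖ = 1) (A : ∀ n, H n →L[ℂ] H n)

/-- A factorization of `⨂ (H i, ξ i)` as `V ⊗ ⨂_{i ≥ k} (H i, ξ i)` together with an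
identification of `𝓑(H 0) ⊗ ⋯ ⊗ 𝓑(H (k - 1))` with `𝓑(V)`, such that the operators
`S 0 ⊗ ⋯ ⊗ S (k - 1) ⊗ A k ⊗ A (k + 1) ⊗ ⋯` respect the factorization. -/
structure StageModel (k : ℕ) (V : Type v) [NormedAddCommGroup V] [InnerProductSpace ℂ V]
    [FiniteDimensional ℂ V] where
  factor : HilbertFactor V (TailTensor ξ hξ k) (InfTensor ξ hξ)
  equiv : (⨂[ℂ] i : Fin k, (H i →L[ℂ] H i)) ≃ₗ[ℂ] (V →L[ℂ] V)
  equiv_one : equiv (PiTensorProduct.tprod ℂ fun _ => 1) = 1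
  equiv_mul : ∀ S R : ∀ i : Fin k, H i →L[ℂ] H i,
    equiv (PiTensorProduct.tprod ℂ fun i => S i * R i) =
      equiv (PiTensorProduct.tprod ℂ S) * equiv (PiTensorProduct.tprod ℂ R)
  equiv_star : ∀ S : ∀ i : Fin k, H i →L[ℂ] H i,
    letI := FiniteDimensional.complete ℂ V
    equiv (PiTensorProduct.tprod ℂ fun i => star (S i)) = star (equiv (PiTensorProduct.tprod ℂ S))
  isInfTensorOp : ∀ a, IsTailOp ξ hξ A k a → ∀ S : ∀ i : Fin k, H i →L[ℂ] H i,
    IsInfTensorOp ξ hξ (extendBy A k S) (factor.op (equiv (PiTensorProduct.tprod ℂ S)) a)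

variable {ξ hξ A}

/-- The model of the stage `k = 0`. -/
noncomputable def stageModelZero : StageModel ξ hξ A 0 ℂ where
  factor := scalarFactor ξ hξ
  equiv := emptyOpEquiv H
  equiv_one := emptyOpEquiv_tprod _
  equiv_mul S R := by
    rw [emptyOpEquiv_tprod, emptyOpEquiv_tprod, emptyOpEquiv_tprod, mul_one]
  equiv_star S := by
    rw [emptyOpEquiv_tprod, emptyOpEquiv_tprod, star_one]
  isInfTensorOp a ha S := by
    rw [emptyOpEquiv_tprod]
    have h : (scalarFactor ξ hξ).op 1 a = a := by
      rw [scalarFactor_op, one_apply_eq_self, one_smul]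
    rw [h]
    exact ha

/-- The model of the stage `k = n + 1`. -/
noncomputable def stageModelSucc (hAξ : ∀ n, A n (ξ n) = ξ n) (n : ℕ) :
    StageModel ξ hξ A (n + 1) (FinTensor H n) where
  factor := tailFactor ξ hξ n
  equiv := finTensorOpEquiv H n
  equiv_one := by
    rw [finTensorOpEquiv_tprod, ← finTensorOp_one]
    exact finTensorOp_congr fun i hi => extendBy_of_lt _ _ (by lia)
  equiv_mul S R := by
    rw [finTensorOpEquiv_tprod, finTensorOpEquiv_tprod, finTensorOpEquiv_tprod, ← finTensorOp_mul]
    refine finTensorOp_congr fun i hi => ?_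
    have hi : i < n + 1 := by lia
    simp only [extendBy_of_lt _ _ hi]
  equiv_star S := by
    rw [finTensorOpEquiv_tprod, finTensorOpEquiv_tprod]
    refine Eq.trans ?_ (finTensorOp_star _ _)
    refine finTensorOp_congr fun i hi => ?_
    have hi : i < n + 1 := by lia
    simp only [extendBy_of_lt _ _ hi]
  isInfTensorOp a ha S := by
    rw [isTailOp_iff hAξ] at ha
    have hS : ∀ i, n + 1 ≤ i → extendBy A (n + 1) S i (ξ i) = ξ i := fun i hi => by
      rw [extendBy_of_le _ _ hi, hAξ]
    rw [isInfTensorOp_iff_isStableOp hS, finTensorOpEquiv_tprod]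
    rw [finTensorOp_congr (R := extendBy A (n + 1) S) fun i hi => by
      rw [extendBy_of_lt _ _ (by lia), extendBy_of_lt _ _ (by lia)]]
    refine isStableOp_tailFactor_op hS ?_
    convert ha using 2 with i
    exact extendBy_of_le _ _ (by lia)

end
end

/-! ### Algebras generated by one selfadjoint element -/

theorem cstarGen_le_centralizer {B : Type u} [NonUnitalCStarAlgebra B] {s t : Set B}
    (h : s ⊆ NonUnitalStarSubalgebra.centralizer ℂ t) :
    cstarGen s ≤ NonUnitalStarSubalgebra.centralizer ℂ t := by
  refine cstarGen_le ?_ h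
  rw [NonUnitalStarSubalgebra.coe_centralizer]
  exact Set.isClosed_centralizer _

/-- A C⋆-algebra generated by one selfadjoint element is commutative. -/
theorem cstarGen_singleton_comm {B : Type u} [NonUnitalCStarAlgebra B] {a : B}
    (ha : IsSelfAdjoint a) {x y : B} (hx : x ∈ cstarGen {a}) (hy : y ∈ cstarGen {a}) :
    x * y = y * x := by
  have h1 : cstarGen {a} ≤ NonUnitalStarSubalgebra.centralizer ℂ {a} :=
    cstarGen_le_centralizer <| by
      rintro _ rfl
      exact NonUnitalStarSubalgebra.mem_centralizer_iff ℂ |>.2 (by rintro _ rfl; simp [ha.star_eq])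
  have h2 : cstarGen {a} ≤ NonUnitalStarSubalgebra.centralizer ℂ {y} :=
    cstarGen_le_centralizer <| by
      rintro _ rfl
      refine NonUnitalStarSubalgebra.mem_centralizer_iff ℂ |>.2 ?_
      rintro _ rfl
      exact ⟨((NonUnitalStarSubalgebra.mem_centralizer_iff ℂ).1 (h1 hy) _ rfl).1.symm,
        ((NonUnitalStarSubalgebra.mem_centralizer_iff ℂ).1 (h1 (star_mem hy)) _ rfl).1.symm⟩
  exact (((NonUnitalStarSubalgebra.mem_centralizer_iff ℂ).1 (h2 hx) _ rfl).1).symm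

theorem isSeparable_cstarGen_singleton {B : Type u} [CStarAlgebra B] {a : B}
    (ha : IsSelfAdjoint a) : TopologicalSpace.IsSeparable (cstarGen {a} : Set B) :=
  ((Set.countable_range fun j : ℕ => a ^ (j + 1)).isSeparable.span (R := ℂ)).closure.mono
    (cstarGen_singleton_subset_closure_span ha)

theorem HilbertFactor.isSeparable_matAlgebra {V : Type v} {T K : Type u} [NormedAddCommGroup V]
    [InnerProductSpace ℂ V] [NormedAddCommGroup T] [InnerProductSpace ℂ T] [NormedAddCommGroup K]
    [InnerProductSpace ℂ K] [CompleteSpace T] [CompleteSpace K] [FiniteDimensional ℂ V]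
    (f : HilbertFactor V T K) {D : NonUnitalStarSubalgebra ℂ (T →L[ℂ] T)}
    (hD : TopologicalSpace.IsSeparable (D : Set (T →L[ℂ] T))) :
    TopologicalSpace.IsSeparable (f.matAlgebra D : Set (K →L[ℂ] K)) := by
  let e := stdOrthonormalBasis ℂ V
  have h : TopologicalSpace.IsSeparable
      (⋃ i, ⋃ j, f.op (InnerProductSpace.rankOne ℂ (e i) (e j)) '' (D : Set (T →L[ℂ] T))) :=
    .iUnion fun i => .iUnion fun j => hD.image (f.continuous_op _)
  refine (h.span (R := ℂ)).mono fun X hX => ?_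
  rw [← f.sum_op_entry e X]
  exact sum_mem fun i _ => sum_mem fun j _ => Submodule.subset_span <|
    Set.mem_iUnion.2 ⟨i, Set.mem_iUnion.2 ⟨j, _, hX _ _, rfl⟩⟩

/-! ### The increasing sequence of stages -/

section
variable {H : ℕ → Type u} [∀ n, NormedAddCommGroup (H n)] [∀ n, InnerProductSpace ℂ (H n)]
  {ξ : ∀ n, H n} {hξ : ∀ n, ‖ξ n‖ = 1} {A : ∀ n, H n →L[ℂ] H n}

theorem tensorAdmissible_extendBy (hA : ∀ n, ‖A n‖ ≤ 1) (hAξ : ∀ n, A n (ξ n) = ξ n) (k : ℕ)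
    (S : ∀ i : Fin k, H i →L[ℂ] H i) : TensorAdmissible ξ (extendBy A k S) := by
  constructor
  · refine multipliable_of_hasFiniteMulSupport ((Set.finite_lt_nat k).subset fun n hn => ?_)
    by_contra h
    refine hn ?_
    change max ‖extendBy A k S n‖ 1 = 1
    rw [extendBy_of_le _ _ (not_lt.1 h), max_eq_right (hA n)]
  · refine summable_of_hasFiniteSupport ((Set.finite_lt_nat k).subset fun n hn => ?_)
    by_contra h
    refine hn ?_
    change ‖extendBy A k S n (ξ n) - ξ n‖ = 0
    rw [extendBy_of_le _ _ (not_lt.1 h), hAξ, sub_self, norm_zero]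

theorem readSet_mono : Monotone (readSet ξ hξ A) :=
  fun _ _ hkl _ ⟨S, hS, hT, hSA⟩ => ⟨S, hS, hT, fun n hn => hSA n (hkl.trans hn)⟩

theorem readStage_mono : Monotone (readStage ξ hξ A) :=
  fun _ _ hkl => cstarGen_mono (readSet_mono hkl)

theorem readStage_le_readAlgebra (k : ℕ) : readStage ξ hξ A k ≤ readAlgebra ξ hξ A :=
  cstarGen_mono (Set.subset_iUnion _ k)

theorem closure_iUnion_readStage :
    closure (⋃ k, (readStage ξ hξ A k : Set (InfTensor ξ hξ →L[ℂ] InfTensor ξ hξ))) =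
      (readAlgebra ξ hξ A : Set (InfTensor ξ hξ →L[ℂ] InfTensor ξ hξ)) := by
  refine (closure_minimal (Set.iUnion_subset fun k => readStage_le_readAlgebra k)
    (cstarGen_isClosed _)).antisymm ?_
  rw [← NonUnitalStarSubalgebra.coe_iSup_of_directed (readStage_mono (ξ := ξ) (hξ := hξ)
    (A := A)).directed_le]
  change readAlgebra ξ hξ A ≤ (iSup (readStage ξ hξ A)).topologicalClosure
  refine cstarGen_le (NonUnitalStarSubalgebra.isClosed_topologicalClosure _) ?_
  refine Set.iUnion_subset fun k => ?_
  exact (subset_cstarGen _).trans ((le_iSup (readStage ξ hξ A) k).trans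
    (NonUnitalStarSubalgebra.le_topologicalClosure _))

/-! ### Quasidiagonality -/

/-- The stage `C_k` commutes with the projection onto `H 0 ⊗ ⋯ ⊗ H m` if `k ≤ m + 1`: the generators
and their adjoints leave this subspace invariant. -/
theorem starProjection_commute [∀ n, FiniteDimensional ℂ (H n)] [∀ n, CompleteSpace (H n)]
    (hA : ∀ n, IsSelfAdjoint (A n)) (hAξ : ∀ n, A n (ξ n) = ξ n) {k m : ℕ} (hkm : k ≤ m + 1)
    {T : InfTensor ξ hξ →L[ℂ] InfTensor ξ hξ} (hT : T ∈ readStage ξ hξ A k) :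
    (infTensorIncl ξ hξ m).toLinearMap.range.starProjection * T =
      T * (infTensorIncl ξ hξ m).toLinearMap.range.starProjection := by
  set U := (infTensorIncl ξ hξ m).toLinearMap.range
  have hinv : ∀ S k, k ≤ m + 1 → ∀ T, IsStableOp ξ hξ S k T →
      U.starProjection * (T * U.starProjection) = T * U.starProjection := by
    intro S k hk T hT
    ext x
    obtain ⟨ζ, hζ⟩ := U.starProjection_apply_mem x
    rw [mul_apply_eq_comp, mul_apply_eq_comp, ← hζ]
    refine Submodule.starProjection_eq_self_iff.2 ?_
    exact ⟨finTensorOp S m ζ, (hT m hk ζ).symm⟩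
  have hU : star U.starProjection = U.starProjection := isStarProjection_starProjection.2
  suffices h : readStage ξ hξ A k ≤
      NonUnitalStarSubalgebra.centralizer ℂ {U.starProjection} from
    (((NonUnitalStarSubalgebra.mem_centralizer_iff ℂ).1 (h hT)) _ rfl).1
  refine cstarGen_le_centralizer ?_
  rintro T ⟨S, -, hT, hSA⟩
  have hS : ∀ i, k ≤ i → S i (ξ i) = ξ i := fun i hi => by rw [hSA i hi, hAξ]
  have hS' : ∀ i, k ≤ i → star (S i) (ξ i) = ξ i := fun i hi => by
    rw [hSA i hi, (hA i).star_eq, hAξ]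
  rw [isInfTensorOp_iff_isStableOp hS] at hT
  have h1 := hinv S k hkm T hT
  have h2 := congrArg star (hinv _ k hkm _ (hT.star hS'))
  simp only [star_mul, star_star, hU] at h2
  have h3 : U.starProjection * T = T * U.starProjection := by
    rw [← h1, ← mul_assoc, h2]
  refine (NonUnitalStarSubalgebra.mem_centralizer_iff ℂ).2 ?_
  rintro _ rfl
  rw [hU]
  exact ⟨h3, h3⟩

theorem norm_starProjection_infTensorIncl_sub_lt [∀ n, FiniteDimensional ℂ (H n)]
    (x : InfTensor ξ hξ) {ε : ℝ} (hε : 0 < ε) : ∃ n, ∀ m, n ≤ m →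
      ‖(infTensorIncl ξ hξ m).toLinearMap.range.starProjection x - x‖ < ε := by
  obtain ⟨_, ⟨n, -, ζ, rfl⟩, hζ⟩ :=
    Metric.mem_closure_iff.1 (dense_infTensorIncl ξ hξ 0 x) (ε / 2) (by positivity)
  refine ⟨n, fun m hm => ?_⟩
  set P := (infTensorIncl ξ hξ m).toLinearMap.range.starProjection
  have h : P (infTensorIncl ξ hξ n ζ) = infTensorIncl ξ hξ n ζ :=
    Submodule.starProjection_eq_self_iff.2 ⟨_, infTensorIncl_embed ξ hξ n m hm ζ⟩
  rw [dist_eq_norm] at hζ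
  calc ‖P x - x‖ = ‖P (x - infTensorIncl ξ hξ n ζ) - (x - infTensorIncl ξ hξ n ζ)‖ := by
        rw [map_sub, h]; congr 1; abel
    _ ≤ ‖P (x - infTensorIncl ξ hξ n ζ)‖ + ‖x - infTensorIncl ξ hξ n ζ‖ := norm_sub_le _ _
    _ ≤ 1 * ‖x - infTensorIncl ξ hξ n ζ‖ + ‖x - infTensorIncl ξ hξ n ζ‖ := by
        gcongr; exact P.le_of_opNorm_le (Submodule.starProjection_norm_le _) _
    _ < ε := by linarith

theorem isQuasidiagonalCStar_readAlgebra [∀ n, FiniteDimensional ℂ (H n)]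
    [∀ n, CompleteSpace (H n)] (hA : ∀ n, IsSelfAdjoint (A n)) (hAξ : ∀ n, A n (ξ n) = ξ n) :
    IsQuasidiagonalCStar (readAlgebra ξ hξ A) := by
  refine ⟨InfTensor ξ hξ, inferInstance, inferInstance, inferInstance,
    NonUnitalStarSubalgebraClass.subtype (readAlgebra ξ hξ A), Subtype.val_injective,
    fun F G ε hF hε => ?_⟩
  have h1 : ∀ T ∈ F, ∃ k, ∃ T' ∈ readStage ξ hξ A k, ‖T - T'‖ < ε / 2 := by
    intro T hT
    obtain ⟨x, rfl⟩ := hF hT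
    have hx : (x : InfTensor ξ hξ →L[ℂ] InfTensor ξ hξ) ∈
        closure (⋃ k, (readStage ξ hξ A k : Set (InfTensor ξ hξ →L[ℂ] InfTensor ξ hξ))) := by
      rw [closure_iUnion_readStage]; exact x.2
    obtain ⟨T', hT', h⟩ := Metric.mem_closure_iff.1 hx (ε / 2) (by positivity)
    obtain ⟨k, hk⟩ := Set.mem_iUnion.1 hT'
    exact ⟨k, T', hk, by rwa [dist_eq_norm] at h⟩
  choose! k T' hT' hTT' using h1
  choose n hn using fun x : InfTensor ξ hξ => norm_starProjection_infTensorIncl_sub_lt x hε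
  set m := max (F.sup k) (G.sup n)
  set P := (infTensorIncl ξ hξ m).toLinearMap.range.starProjection
  refine ⟨P, isStarProjection_starProjection, ?_, fun T hT => ?_, fun x hx =>
    hn x m ((Finset.le_sup hx).trans (le_max_right _ _))⟩
  · have : P.toLinearMap.range = (infTensorIncl ξ hξ m).toLinearMap.range :=
      Submodule.range_starProjection _
    rw [this]
    infer_instance
  · have hk : k T ≤ m + 1 := ((Finset.le_sup hT).trans (le_max_left _ _)).trans m.le_succ
    have hc := starProjection_commute hA hAξ hk (hT' T hT)
    have hP : ‖P‖ ≤ 1 := Submodule.starProjection_norm_le _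
    calc ‖P * T - T * P‖ = ‖P * (T - T' T) - (T - T' T) * P‖ := by
          rw [mul_sub, sub_mul, hc]; congr 1; abel
      _ ≤ ‖P * (T - T' T)‖ + ‖(T - T' T) * P‖ := norm_sub_le _ _
      _ ≤ 1 * ‖T - T' T‖ + ‖T - T' T‖ * 1 := by
          refine add_le_add ((norm_mul_le _ _).trans ?_) ((norm_mul_le _ _).trans ?_) <;> gcongr
      _ < ε := by linarith [hTT' T hT]

end

/-! ### Tensor product decomposition of the stages -/

/-- A subalgebra `D` of `E`, as a direct sum with one summand. -/
def NonUnitalStarSubalgebra.comapSubtypeEquiv {B : Type u} [NonUnitalCStarAlgebra B]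
    {D E : NonUnitalStarSubalgebra ℂ B} (h : D ≤ E) :
    D.comap (NonUnitalStarSubalgebraClass.subtype E) ≃⋆ₐ[ℂ] (Fin 1 → D) where
  toFun x := fun _ => ⟨x.1.1, x.2⟩
  invFun y := ⟨⟨(y 0).1, h (y 0).2⟩, (y 0).2⟩
  left_inv x := rfl
  right_inv y := by ext i; rw [Subsingleton.elim i 0]
  map_mul' x y := rfl
  map_add' x y := rfl
  map_star' x := rfl
  map_smul' c x := rfl

namespace HilbertFactor

variable {V : Type v} {T K : Type u} [NormedAddCommGroup V] [InnerProductSpace ℂ V]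
  [NormedAddCommGroup T] [InnerProductSpace ℂ T] [NormedAddCommGroup K] [InnerProductSpace ℂ K]
  [CompleteSpace T] [CompleteSpace K] [FiniteDimensional ℂ V] (f : HilbertFactor V T K)
  {D : NonUnitalStarSubalgebra ℂ (T →L[ℂ] T)} {E : NonUnitalStarSubalgebra ℂ (K →L[ℂ] K)}

theorem equiv_mul_tmul {e : ((V →L[ℂ] V) ⊗[ℂ] D) ≃ₗ[ℂ] E}
    (he : ∀ S b, (e (S ⊗ₜ b) : K →L[ℂ] K) = f.op S b) (S R : V →L[ℂ] V) (b c : D) :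
    e ((S * R) ⊗ₜ (b * c)) = e (S ⊗ₜ b) * e (R ⊗ₜ c) := by
  refine Subtype.ext ?_
  change _ = (e (S ⊗ₜ b) : K →L[ℂ] K) * e (R ⊗ₜ c)
  rw [he, he, he, f.op_mul_op]
  rfl

theorem equiv_star_tmul [CompleteSpace V] {e : ((V →L[ℂ] V) ⊗[ℂ] D) ≃ₗ[ℂ] E}
    (he : ∀ S b, (e (S ⊗ₜ b) : K →L[ℂ] K) = f.op S b) (S : V →L[ℂ] V) (b : D) :
    e (star S ⊗ₜ star b) = star (e (S ⊗ₜ b)) := by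
  refine Subtype.ext ?_
  change _ = star (e (S ⊗ₜ b) : K →L[ℂ] K)
  rw [he, he, f.star_op]
  rfl

/-- An isomorphism `𝓑(V) ⊗ D ≅ E` can be precomposed with a linear isomorphism onto `𝓑(V)`; it is
multiplicative and ⋆-preserving wherever the latter is. -/
theorem exists_equiv_comp [CompleteSpace V] {W : Type*} [AddCommMonoid W] [Module ℂ W]
    (m : W ≃ₗ[ℂ] (V →L[ℂ] V)) {e : ((V →L[ℂ] V) ⊗[ℂ] D) ≃ₗ[ℂ] E}
    (he : ∀ S b, (e (S ⊗ₜ b) : K →L[ℂ] K) = f.op S b) :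
    ∃ e' : (W ⊗[ℂ] D) ≃ₗ[ℂ] E,
      (∀ w b, (e' (w ⊗ₜ b) : K →L[ℂ] K) = f.op (m w) b) ∧
      (∀ x y z, m z = m x * m y → ∀ b c, e' (z ⊗ₜ (b * c)) = e' (x ⊗ₜ b) * e' (y ⊗ₜ c)) ∧
      ∀ x y, m y = star (m x) → ∀ b, e' (y ⊗ₜ star b) = star (e' (x ⊗ₜ b)) := by
  refine ⟨TensorProduct.congr m (LinearEquiv.refl ℂ D) ≪≫ₗ e, fun w b => he _ _,
    fun x y z h b c => ?_, fun x y h b => ?_⟩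
  · change e (m z ⊗ₜ (b * c)) = e (m x ⊗ₜ b) * e (m y ⊗ₜ c)
    rw [h, f.equiv_mul_tmul he]
  · change e (m y ⊗ₜ star b) = star (e (m x ⊗ₜ b))
    rw [h, f.equiv_star_tmul he]

theorem isHomogeneousCStar_cstarGen [CompleteSpace V] (hcomm : ∀ x y : D, x * y = y * x)
    {s : Set (K →L[ℂ] K)} {e : ((V →L[ℂ] V) ⊗[ℂ] D) ≃ₗ[ℂ] cstarGen s}
    (he : ∀ S b, (e (S ⊗ₜ b) : K →L[ℂ] K) = f.op S b) :
    IsHomogeneousCStar (Module.finrank ℂ V) (cstarGen s) := by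
  refine isHomogeneousCStar_of_tensor hcomm ((TensorProduct.mk ℂ _ _).compr₂ e.toLinearMap)
    (fun S R b c => (f.equiv_mul_tmul he S R b c).symm)
    (fun S b => (f.equiv_star_tmul he S b).symm) ?_
  have h : {x | ∃ S b, (TensorProduct.mk ℂ (V →L[ℂ] V) D).compr₂ e.toLinearMap S b = x} =
      e.toLinearMap '' {t | ∃ S b, S ⊗ₜ b = t} := by
    ext x; simp
  rw [h, ← Submodule.map_span, TensorProduct.span_tmul_eq_top, Submodule.map_top,
    LinearEquiv.range]

end HilbertFactor

section
variable {H : ℕ → Type u} [∀ n, NormedAddCommGroup (H n)] [∀ n, InnerProductSpace ℂ (H n)]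
  {ξ : ∀ n, H n} {hξ : ∀ n, ‖ξ n‖ = 1} {A : ∀ n, H n →L[ℂ] H n}

theorem exists_norm_eq_one_finTensor {ξ : ∀ n, H n} (hξ : ∀ n, ‖ξ n‖ = 1) (n : ℕ) :
    ∃ v : FinTensor H n, ‖v‖ = 1 :=
  ⟨finTensorEmbed ξ hξ 0 n n.zero_le (finTensorZero H (ξ 0)), by
    rw [LinearIsometry.norm_map, LinearIsometryEquiv.norm_map, hξ]⟩

theorem exists_isTailOp (hA : ∀ n, ‖A n‖ ≤ 1) (hAξ : ∀ n, A n (ξ n) = ξ n) (k : ℕ) :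
    ∃ a, ‖a‖ ≤ 1 ∧ IsTailOp ξ hξ A k a := by
  simp only [isTailOp_iff hAξ]
  exact exists_isStableOp (fun n => hA (n + k)) (fun n => hAξ (n + k))

/-- The tail operator is unique, so the tail algebra is generated by one element. -/
theorem tailAlgebra_eq (hAξ : ∀ n, A n (ξ n) = ξ n) {k : ℕ}
    {a : TailTensor ξ hξ k →L[ℂ] TailTensor ξ hξ k} (ha : IsTailOp ξ hξ A k a) :
    tailAlgebra ξ hξ A k = cstarGen {a} := by
  have h : {b | IsTailOp ξ hξ A k b} = {a} := by
    ext b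
    refine ⟨fun hb => ?_, fun hb => hb ▸ ha⟩
    exact ((isTailOp_iff hAξ k).1 hb).unique ((isTailOp_iff hAξ k).1 ha)
  rw [tailAlgebra, h]

namespace StageModel

variable [∀ n, FiniteDimensional ℂ (H n)] {k : ℕ} {V : Type v}
  [NormedAddCommGroup V] [InnerProductSpace ℂ V] [FiniteDimensional ℂ V]
  (M : StageModel ξ hξ A k V)

/-- The generators of the stage `C_k` are the operators `S ⊗ a_k` with `S` an elementary tensor. -/
theorem readSet_eq (hA : ∀ n, ‖A n‖ ≤ 1) (hAξ : ∀ n, A n (ξ n) = ξ n)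
    {a : TailTensor ξ hξ k →L[ℂ] TailTensor ξ hξ k} (ha : IsTailOp ξ hξ A k a) :
    readSet ξ hξ A k = {X | ∃ S ∈ Set.range fun S : ∀ i : Fin k, H i →L[ℂ] H i =>
      M.equiv (PiTensorProduct.tprod ℂ S), M.factor.op S a = X} := by
  ext X
  constructor
  · rintro ⟨S, -, hX, hSA⟩
    refine ⟨_, ⟨fun i => S i, rfl⟩, ?_⟩
    have h := M.isInfTensorOp a ha (fun i => S i)
    rw [extendBy_restrict hSA] at h
    have hS : ∀ i, k ≤ i → S i (ξ i) = ξ i := fun i hi => by rw [hSA i hi, hAξ]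
    exact ((isInfTensorOp_iff_isStableOp hS).1 h).unique ((isInfTensorOp_iff_isStableOp hS).1 hX)
  · rintro ⟨_, ⟨S, rfl⟩, rfl⟩
    exact ⟨extendBy A k S, tensorAdmissible_extendBy hA hAξ k S, M.isInfTensorOp a ha S,
      fun n hn => extendBy_of_le _ _ hn⟩

/-- The stage `C_k` is `𝓑(V) ⊗ C⋆(a_k)`. -/
theorem readStage_eq (hA : ∀ n, ‖A n‖ ≤ 1) (hAξ : ∀ n, A n (ξ n) = ξ n) :
    readStage ξ hξ A k = M.factor.matAlgebra (tailAlgebra ξ hξ A k) := by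
  obtain ⟨a, -, ha⟩ := exists_isTailOp (hξ := hξ) hA hAξ k
  rw [readStage, M.readSet_eq hA hAξ ha, tailAlgebra_eq hAξ ha]
  refine M.factor.cstarGen_op_eq ?_ ?_ ?_ a
  · exact ⟨_, M.equiv_one⟩
  · rintro _ ⟨S, rfl⟩
    exact ⟨_, M.equiv_star S⟩
  · rw [show (Set.range fun S : ∀ i : Fin k, H i →L[ℂ] H i =>
      M.equiv (PiTensorProduct.tprod ℂ S)) = M.equiv.toLinearMap ''
        Set.range (PiTensorProduct.tprod ℂ) from Set.range_comp _ _, ← Submodule.map_span,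
      PiTensorProduct.span_tprod_eq_top, Submodule.map_top, LinearEquiv.range]

theorem exists_equiv_readStage (hA : ∀ n, ‖A n‖ ≤ 1) (hAξ : ∀ n, A n (ξ n) = ξ n) :
    ∃ e : ((V →L[ℂ] V) ⊗[ℂ] tailAlgebra ξ hξ A k) ≃ₗ[ℂ] readStage ξ hξ A k,
      ∀ S b, (e (S ⊗ₜ b) : InfTensor ξ hξ →L[ℂ] InfTensor ξ hξ) = M.factor.op S b := by
  rw [M.readStage_eq hA hAξ]
  exact ⟨M.factor.tensorEquiv _, M.factor.tensorEquiv_tmul _⟩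

set_option maxHeartbeats 1000000 in
/-- The isomorphism `𝓑(H 0) ⊗ ⋯ ⊗ 𝓑(H (k - 1)) ⊗ A_k ≅ C_k`. -/
theorem exists_tprodEquiv_readStage [∀ n, CompleteSpace (H n)] (M : StageModel ξ hξ A k V)
    (hA : ∀ n, ‖A n‖ ≤ 1) (hAξ : ∀ n, A n (ξ n) = ξ n) :
    ∃ e : ((⨂[ℂ] i : Fin k, (H i →L[ℂ] H i)) ⊗[ℂ] tailAlgebra ξ hξ A k) ≃ₗ[ℂ]
        readStage ξ hξ A k,
      (∀ (S R : ∀ i : Fin k, H i →L[ℂ] H i) (b c : tailAlgebra ξ hξ A k),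
        e (PiTensorProduct.tprod ℂ (fun i => S i * R i) ⊗ₜ[ℂ] (b * c)) =
          e (PiTensorProduct.tprod ℂ S ⊗ₜ[ℂ] b) * e (PiTensorProduct.tprod ℂ R ⊗ₜ[ℂ] c)) ∧
      (∀ (S : ∀ i : Fin k, H i →L[ℂ] H i) (b : tailAlgebra ξ hξ A k),
        e (PiTensorProduct.tprod ℂ (fun i => star (S i)) ⊗ₜ[ℂ] star b) =
          star (e (PiTensorProduct.tprod ℂ S ⊗ₜ[ℂ] b))) ∧
      ∃ a : tailAlgebra ξ hξ A k, IsTailOp ξ hξ A k a ∧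
        ∀ S : ∀ i : Fin k, H i →L[ℂ] H i,
          IsInfTensorOp ξ hξ (extendBy A k S)
            (e (PiTensorProduct.tprod ℂ S ⊗ₜ[ℂ] a) : InfTensor ξ hξ →L[ℂ] InfTensor ξ hξ) := by
  obtain ⟨e, he⟩ := M.exists_equiv_readStage hA hAξ
  obtain ⟨a, -, ha⟩ := exists_isTailOp (hξ := hξ) hA hAξ k
  have := FiniteDimensional.complete ℂ V
  refine Exists.elim (M.factor.exists_equiv_comp M.equiv he) fun e' h => ?_
  refine ⟨e', fun S R => h.2.1 _ _ _ (M.equiv_mul S R), fun S => h.2.2 _ _ (M.equiv_star S),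
    ⟨a, subset_cstarGen _ ha⟩, ha, fun S => ?_⟩
  rw [h.1]
  exact M.isInfTensorOp a ha S

theorem isHomogeneousCStar [CompleteSpace V] (M : StageModel ξ hξ A k V) (hA : ∀ n, ‖A n‖ ≤ 1)
    (hAξ : ∀ n, A n (ξ n) = ξ n)
    (hcomm : ∀ x y : tailAlgebra ξ hξ A k, x * y = y * x) :
    @IsHomogeneousCStar (Module.finrank ℂ V) (readStage ξ hξ A k)
      (cstarGen.instNonUnitalCStarAlgebra _) := by
  obtain ⟨e, he⟩ := M.exists_equiv_readStage hA hAξ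
  exact M.factor.isHomogeneousCStar_cstarGen hcomm he

end StageModel

/-- The stage `C_k`, as a subalgebra of `readAlgebra`. -/
noncomputable def stageIn (ξ : ∀ n, H n) (hξ : ∀ n, ‖ξ n‖ = 1) (A : ∀ n, H n →L[ℂ] H n)
    (k : ℕ) : NonUnitalStarSubalgebra ℂ (readAlgebra ξ hξ A) :=
  (readStage ξ hξ A k).comap (NonUnitalStarSubalgebraClass.subtype (readAlgebra ξ hξ A))

theorem stageIn_mono : Monotone (stageIn ξ hξ A) := fun _ _ hkl _ hx => readStage_mono hkl hx

theorem isClosed_stageIn (k : ℕ) : IsClosed (stageIn ξ hξ A k : Set (readAlgebra ξ hξ A)) :=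
  (cstarGen_isClosed (readSet ξ hξ A k)).preimage continuous_subtype_val

theorem dense_iUnion_stageIn :
    Dense (⋃ k, (stageIn ξ hξ A (k + 1) : Set (readAlgebra ξ hξ A))) := by
  intro x
  have hx : (x : InfTensor ξ hξ →L[ℂ] InfTensor ξ hξ) ∈
      closure (⋃ k, (readStage ξ hξ A k : Set (InfTensor ξ hξ →L[ℂ] InfTensor ξ hξ))) := by
    rw [closure_iUnion_readStage]; exact x.2
  refine Metric.mem_closure_iff.2 fun ε hε => ?_
  obtain ⟨T, hT, h⟩ := Metric.mem_closure_iff.1 hx ε hε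
  obtain ⟨k, hk⟩ := Set.mem_iUnion.1 hT
  exact ⟨⟨T, readStage_le_readAlgebra k hk⟩,
    Set.mem_iUnion.2 ⟨k, readStage_mono k.le_succ hk⟩, h⟩

end

/-! ### Structure of the read algebra -/

theorem lemma4p5 {H : ℕ → Type u} [∀ n, NormedAddCommGroup (H n)]
    [∀ n, InnerProductSpace ℂ (H n)] [∀ n, CompleteSpace (H n)]
    [∀ n, FiniteDimensional ℂ (H n)]
    (A M : ∀ n, H n →L[ℂ] H n) (ξ : ∀ n, H n)
    (hApos : ∀ n, (A n).IsPositive) (hAnorm : ∀ n, ‖A n‖ = 1)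
    (hM : ∀ n, IsNilpotent (M n)) (hAM : Summable (fun n => ‖A n - M n‖))
    (hξ : ∀ n, ‖ξ n‖ = 1) (hAξ : ∀ n, A n (ξ n) = ξ n) :
    TopologicalSpace.SeparableSpace (readAlgebra ξ hξ A) ∧
    IsNuclearCStar (readAlgebra ξ hξ A) ∧
    IsQuasidiagonalCStar (readAlgebra ξ hξ A) ∧
    IsApproximatelyHomogeneous (readAlgebra ξ hξ A) ∧
    Monotone (readStage ξ hξ A) ∧
    closure (⋃ k, (readStage ξ hξ A k : Set (InfTensor ξ hξ →L[ℂ] InfTensor ξ hξ))) =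
      (readAlgebra ξ hξ A : Set (InfTensor ξ hξ →L[ℂ] InfTensor ξ hξ)) ∧
    ∀ k : ℕ,
      (∀ x y : tailAlgebra ξ hξ A k, x * y = y * x) ∧
      ∃ e : ((⨂[ℂ] i : Fin k, (H i →L[ℂ] H i)) ⊗[ℂ] tailAlgebra ξ hξ A k) ≃ₗ[ℂ]
          readStage ξ hξ A k,
        (∀ (S R : ∀ i : Fin k, H i →L[ℂ] H i) (b c : tailAlgebra ξ hξ A k),
          e (PiTensorProduct.tprod ℂ (fun i => S i * R i) ⊗ₜ[ℂ] (b * c)) =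
            e (PiTensorProduct.tprod ℂ S ⊗ₜ[ℂ] b) * e (PiTensorProduct.tprod ℂ R ⊗ₜ[ℂ] c)) ∧
        (∀ (S : ∀ i : Fin k, H i →L[ℂ] H i) (b : tailAlgebra ξ hξ A k),
          e (PiTensorProduct.tprod ℂ (fun i => star (S i)) ⊗ₜ[ℂ] star b) =
            star (e (PiTensorProduct.tprod ℂ S ⊗ₜ[ℂ] b))) ∧
        ∃ a : tailAlgebra ξ hξ A k, IsTailOp ξ hξ A k a ∧
          ∀ S : ∀ i : Fin k, H i →L[ℂ] H i,
            IsInfTensorOp ξ hξ (extendBy A k S)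
              (e (PiTensorProduct.tprod ℂ S ⊗ₜ[ℂ] a) : InfTensor ξ hξ →L[ℂ] InfTensor ξ hξ) := by
  have hA1 : ∀ n, ‖A n‖ ≤ 1 := fun n => (hAnorm n).le
  have hAsa : ∀ n, IsSelfAdjoint (A n) := fun n => (hApos n).isSelfAdjoint
  have htail : ∀ k, ∃ a, ‖a‖ ≤ 1 ∧ 0 ≤ a ∧ IsTailOp ξ hξ A k a := fun k => by
    obtain ⟨a, ha1, ha⟩ := exists_isTailOp (hξ := hξ) hA1 hAξ k
    exact ⟨a, ha1, ((isTailOp_iff hAξ k).1 ha).nonneg fun n => hApos (n + k), ha⟩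
  have hcomm : ∀ k, ∀ x y : tailAlgebra ξ hξ A k, x * y = y * x := by
    intro k x y
    obtain ⟨a, -, ha0, ha⟩ := htail k
    have h := tailAlgebra_eq hAξ ha
    exact Subtype.ext (cstarGen_singleton_comm ha0.isSelfAdjoint (h ▸ x.2) (h ▸ y.2))
  refine ⟨?_, ?_, isQuasidiagonalCStar_readAlgebra hAsa hAξ, ?_, readStage_mono,
    closure_iUnion_readStage, fun k => ⟨hcomm k, ?_⟩⟩
  · have h : ∀ n, TopologicalSpace.IsSeparable
        (readStage ξ hξ A (n + 1) : Set (InfTensor ξ hξ →L[ℂ] InfTensor ξ hξ)) := fun n => by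
      obtain ⟨a, -, ha0, ha⟩ := htail (n + 1)
      rw [(stageModelSucc hAξ n).readStage_eq hA1 hAξ, tailAlgebra_eq hAξ ha]
      exact HilbertFactor.isSeparable_matAlgebra _
        (isSeparable_cstarGen_singleton ha0.isSelfAdjoint)
    refine TopologicalSpace.IsSeparable.separableSpace
      (s := (readAlgebra ξ hξ A : Set (InfTensor ξ hξ →L[ℂ] InfTensor ξ hξ))) ?_
    rw [← closure_iUnion_readStage]
    refine (TopologicalSpace.IsSeparable.iUnion fun k => ?_).closure
    exact (h k).mono (readStage_mono k.le_succ)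
  · refine isNuclearCStar_of_dense (fun k => (stageIn ξ hξ A (k + 1) : Set _))
      (fun k l hkl => stageIn_mono (Nat.succ_le_succ hkl)) dense_iUnion_stageIn ?_
    intro n F hF ε hε
    obtain ⟨a, ha1, ha0, ha⟩ := htail (n + 1)
    have hst := (stageModelSucc (hξ := hξ) hAξ n).readStage_eq hA1 hAξ
    rw [tailAlgebra_eq hAξ ha] at hst
    let _ : PartialOrder (readAlgebra ξ hξ A) := CStarAlgebra.spectralOrder _
    have _ := CStarAlgebra.spectralOrderedRing (readAlgebra ξ hξ A)
    obtain ⟨v, hv⟩ := exists_norm_eq_one_finTensor hξ n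
    exact (stageModelSucc (hξ := hξ) hAξ n).factor.exists_cp_approx_finset a ha0 ha1 ⟨v, hv⟩
      (NonUnitalStarSubalgebraClass.subtype (readAlgebra ξ hξ A)) Subtype.val_injective
      (fun X hX => ⟨⟨X, readStage_le_readAlgebra (n + 1) (hst ▸ hX)⟩, rfl⟩) F
      (fun x hx => hst ▸ hF x hx) hε
  · refine ⟨fun k => stageIn ξ hξ A (k + 1), fun k l hkl => stageIn_mono (Nat.succ_le_succ hkl),
      fun k => isClosed_stageIn _, dense_iUnion_stageIn, fun k => ⟨1,
        fun _ => readStage ξ hξ A (k + 1), fun _ => cstarGen.instNonUnitalCStarAlgebra _,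
        fun _ => ⟨_, (stageModelSucc hAξ k).isHomogeneousCStar hA1 hAξ (hcomm (k + 1))⟩,
        ⟨NonUnitalStarSubalgebra.comapSubtypeEquiv (readStage_le_readAlgebra _)⟩⟩⟩
  · cases k with
    | zero => exact stageModelZero.exists_tprodEquiv_readStage hA1 hAξ
    | succ n => exact (stageModelSucc hAξ n).exists_tprodEquiv_readStage hA1 hAξ
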